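/- Let $\mathbb B$ be a (strict) double category; 1h-cells, 1v-cells and 2-cells (squares) are its horizontal arrows, vertical arrows and cells. A pseudodouble functor is strict in the vertical direction and has vertically invertible globular compositors and unitors in the horizontal direction. A horizontal pseudonatural transformation $\alpha$ has 1h-cells $\alpha(X)$, 2-cells $\alpha|_u$ for 1v-cells $u$ and vertically invertible globular 2-cells $\alpha|_k\colon F(k)\,|\,\alpha(X')\Rightarrow\alpha(X)\,|\,G(k)$ for 1h-cells $k\colon X\to X'$ (its oplax structure; the inverses are its lax structure). A vertical pseudonatural transformation $\beta$ has 1v-cells $\beta(X)$, 2-cells $\beta|_k$ and horizontally invertible 2-cells $\beta|_u$ with identity top and bottom, from $\frac{\beta(X)}{G(u)}$ to $\frac{F(u)}{\beta(\tilde X)}$, for 1v-cells $u\colon X\to\tilde X$ (its lax structure; the inverses are its oplax structure). **Quasi-functors.** A pseudodouble quasi-functor $H\colon\mathbb B\times\mathbb B\to\mathbb B$ consists of two families of pseudodouble functors $(-,A),(B,-)\colon\mathbb B\to\mathbb B$ for objects $A,B$, agreeing on objects ($(-,A)|_B=(B,-)|_A$), and 2-cells $(k,K)$ (globular, vertically invertible),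 $(u,K)$, $(k,U)$ and $(u,U)$ (with identity top and bottom, horizontally invertible) for 1h-cells $k,K$ and 1v-cells $u,U$, subject to the usual 20 axioms: compatibility with identities and with composition in each of the two variables (8 + 8 axioms) and naturality with respect to 2-cells in each variable (4 axioms). **Binoidal structures.** A binoidal structure on $\mathbb B$ consists of pseudodouble functors $A\ltimes-,\ -\rtimes B\colon\mathbb B\to\mathbb B$ for objects $A,B$ with $A\ltimes B=A\rtimes B$. For a binoidal $\mathbb B$, a 1h-cell $K\colon A\to A'$ is left central via a horizontal pseudonatural transformation $K\ltimes-\colon A\ltimes-\to A'\ltimes-$ with $(K\ltimes-)(X)=K\rtimes X$; a 1v-cell $U\colon A\to\tilde A$ is left central via a vertical pseudonatural transformation $U\ltimes-\colon A\ltimes-\to\tilde A\ltimes-$ with $(U\ltimes-)(X)=U\rtimes X$; a 2-cell $\zeta$ whose boundary cells are left central is left central if the family $\zeta\ltimes-:=(\zeta\rtimes X)_X$ is a modification between the structural transformations of its boundary. Right centrality, via $-\rtimes k$, $-\rtimes u$, $-\rtimes\omega$, is obtained by exchanging the two families of functors. The left center $\mathcal Z_l(\mathbb B)$ is the double category of left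 central 1h-cells and 1v-cells, each paired with a structural transformation, and left central 2-cells; 1h-cells are composed by composing the transformations and conjugating with the compositors of $-\rtimes X$ (identities: conjugating with the unitors). The right center $\mathcal Z_r(\mathbb B)$ is defined symmetrically. Both have projections $\Pi$ to $\mathbb B$. A binoidal $\mathbb B$ is *purely central* if there are double functors $Z_l\colon\mathbb B\to\mathcal Z_l(\mathbb B)$ and $Z_r\colon\mathbb B\to\mathcal Z_r(\mathbb B)$ with $\Pi\circ Z_l=\mathrm{Id}$ and $\Pi\circ Z_r=\mathrm{Id}$, written $b\mapsto(b,b\ltimes-)$ and $b\mapsto(b,-\rtimes b)$, such that for all 1h-cells $K,k$ and 1v-cells $U,u$ $$K\ltimes-|_k=(-\rtimes k|_K)^{-1},\quad U\ltimes-|_u=(-\rtimes u|_U)^{-1},\quad K\ltimes-|_u=-\rtimes u|_K,\quad U\ltimes-|_k=-\rtimes k|_U. \qquad(*)$$ **Theorem.** The following are equivalent: 1. there is a pseudodouble quasi-functor $H\colon\mathbb B\times\mathbb B\to\mathbb B$; 2. $\mathbb B$ has a binoidal structure for which one can choose structural transformations $K\ltimes-$, $-\rtimes k$, $U\ltimes-$,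 $-\rtimes u$ making all 1h-cells and all 1v-cells left and right central, such that all 2-cells are left and right central with respect to them and $(*)$ holds; 3. $\mathbb B$ has a binoidal structure for which it is purely central. More precisely, for every pair of families of pseudodouble functors $A\ltimes-=(-,A)$ and $-\rtimes B=(B,-)$ that agree on objects (that is, for every binoidal structure on $\mathbb B$) the following are equivalent: there is a pseudodouble quasi-functor with these families; there are choices as in 2.; $\mathbb B$ is purely central. Moreover the quasi-functors with these families, the choices as in 2., and the pairs $(Z_l,Z_r)$ as in the definition of pure centrality are in bijective correspondence, by $$K\ltimes-=(-,K),\quad -\rtimes k=(k,-),\quad U\ltimes-=(-,U),\quad -\rtimes u=(u,-),\quad Z_l(b)=(b,b\ltimes-),\quad Z_r(b)=(b,-\rtimes b),$$ that is, $(k,K)$ is the component of the oplax structure of $K\ltimes-$ at $k$ and of the lax structure of $-\rtimes k$ at $K$, $(u,K)=K\ltimes-|_u=-\rtimes u|_K$, $(k,U)=U\ltimes-|_k=-\rtimes k|_U$, and $(u,U)$ is the component of the lax structure of $U\ltimes-$ at $u$ and of the oplax structure of $-\rtimes u$ at $U$. In particular, for any choices as in 2., the component $K\ltimes-|_k$ of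 the oplax (resp. lax) structure of $K\ltimes-$ is the component at $K$ of the lax (resp. oplax) structure of $-\rtimes k$, and the component $U\ltimes-|_u$ of the lax (resp. oplax) structure of $U\ltimes-$ is the component at $U$ of the oplax (resp. lax) structure of $-\rtimes u$. -/

import Mathlib

/-- A category presented by its set `O` of objects and its set `M` of all arrows, with source,
target, identities and a composition defined on composable pairs (in diagrammatic order). -/
structure ArrCat (O : Type*) (M : Type*) where
  src : M → O
  tgt : M → O
  id : O → M
  comp : (f g : M) → tgt f = src g → M
  src_id : ∀ A, src (id A) = A
  tgt_id : ∀ A, tgt (id A) = A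
  src_comp : ∀ f g h, src (comp f g h) = src f
  tgt_comp : ∀ f g h, tgt (comp f g h) = tgt g
  id_comp : ∀ f, comp (id (src f)) f (tgt_id _) = f
  comp_id : ∀ f, comp f (id (tgt f)) (src_id _).symm = f
  assoc : ∀ f g k (h₁ : tgt f = src g) (h₂ : tgt g = src k),
    comp (comp f g h₁) k ((tgt_comp f g h₁).trans h₂) =
      comp f (comp g k h₂) (h₁.trans (src_comp g k h₂).symm)

namespace ArrCat

variable {O M : Type*} (C : ArrCat O M)

open Classical in
/-- Composition as a total operation: it is the composite of `f` and `g` whenever these are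
composable (and the irrelevant value `f` otherwise). -/
noncomputable def cmp (f g : M) : M := if h : C.tgt f = C.src g then C.comp f g h else f

/-- `f` and `g` are mutually inverse arrows. -/
structure IsInverse (f g : M) : Prop where
  tgt_eq : C.tgt f = C.src g
  src_eq : C.tgt g = C.src f
  hom_inv : C.comp f g tgt_eq = C.id (C.src f)
  inv_hom : C.comp g f src_eq = C.id (C.src g)

/-- `f` is an isomorphism. -/
def IsIso (f : M) : Prop := ∃ g, C.IsInverse f g

open Classical in
/-- The inverse of an isomorphism (and the irrelevant value `f` if `f` is not one). -/
noncomputable def inv (f : M) : M := if h : C.IsIso f then h.choose else f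

theorem cmp_eq {f g : M} (h : C.tgt f = C.src g) : C.cmp f g = C.comp f g h := dif_pos h

@[simp] theorem src_id' (A : O) : C.src (C.id A) = A := C.src_id A
@[simp] theorem tgt_id' (A : O) : C.tgt (C.id A) = A := C.tgt_id A

@[simp] theorem src_cmp (f g : M) : C.src (C.cmp f g) = C.src f := by
  unfold cmp; split
  · exact C.src_comp _ _ _
  · rfl

@[simp] theorem tgt_cmp {f g : M} (h : C.tgt f = C.src g) : C.tgt (C.cmp f g) = C.tgt g := by
  rw [C.cmp_eq h, C.tgt_comp]

@[simp] theorem id_cmp {f : M} {A : O} (h : C.src f = A) : C.cmp (C.id A) f = f := by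
  subst h; rw [C.cmp_eq (C.tgt_id _), C.id_comp]

@[simp] theorem cmp_id (f : M) (A : O) : C.cmp f (C.id A) = f := by
  unfold cmp; split
  · rename_i h
    have : A = C.tgt f := (h.trans (C.src_id A)).symm
    subst this; exact C.comp_id f
  · rfl

theorem cmp_assoc {f g : M} (k : M) (h : C.tgt f = C.src g) :
    C.cmp (C.cmp f g) k = C.cmp f (C.cmp g k) := by
  by_cases h₂ : C.tgt g = C.src k
  · rw [C.cmp_eq h, C.cmp_eq h₂, C.cmp_eq ((C.tgt_comp f g h).trans h₂),
      C.cmp_eq (h.trans (C.src_comp g k h₂).symm), C.assoc]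
  · have h₃ : ¬ C.tgt (C.cmp f g) = C.src k := by rw [C.tgt_cmp h]; exact h₂
    rw [cmp, dif_neg h₃, cmp.eq_1 C g k, dif_neg h₂]

theorem inv_spec {f : M} (h : C.IsIso f) : C.IsInverse f (C.inv f) := by
  rw [inv, dif_pos h]; exact h.choose_spec

theorem IsInverse.symm {f g : M} (h : C.IsInverse f g) : C.IsInverse g f :=
  ⟨h.src_eq, h.tgt_eq, h.inv_hom, h.hom_inv⟩

theorem src_inv {f : M} (h : C.IsIso f) : C.src (C.inv f) = C.tgt f := (C.inv_spec h).tgt_eq.symm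
theorem tgt_inv {f : M} (h : C.IsIso f) : C.tgt (C.inv f) = C.src f := (C.inv_spec h).src_eq

theorem cmp_inv {f : M} (h : C.IsIso f) : C.cmp f (C.inv f) = C.id (C.src f) := by
  rw [C.cmp_eq (C.inv_spec h).tgt_eq, (C.inv_spec h).hom_inv]

theorem inv_cmp {f : M} (h : C.IsIso f) : C.cmp (C.inv f) f = C.id (C.tgt f) := by
  rw [C.cmp_eq (C.inv_spec h).src_eq, (C.inv_spec h).inv_hom, C.src_inv h]

theorem IsInverse.mk_cmp {f g : M} (h₁ : C.tgt f = C.src g) (h₂ : C.tgt g = C.src f)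
    (h₃ : C.cmp f g = C.id (C.src f)) (h₄ : C.cmp g f = C.id (C.src g)) : C.IsInverse f g :=
  ⟨h₁, h₂, by rw [← C.cmp_eq h₁, h₃], by rw [← C.cmp_eq h₂, h₄]⟩

end ArrCat

universe u₁ u₂ u₃ u₄

/-- A (strict) double category: objects, horizontal 1-cells (1h-cells), vertical 1-cells (1v-cells)
and 2-cells (squares), where
* 1h-cells form a category `h` and 1v-cells form a category `v` on the objects;
* 2-cells form a category `ch` on the 1v-cells (horizontal composition; source and target are the
  left and the right boundary) and a category `cv` on the 1h-cells (vertical composition; source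
  and target are the top and the bottom boundary);
* these four structures are compatible; equivalently this is a category internal to categories. -/
structure DoubleCat where
  Obj : Type u₁
  Hor : Type u₂
  Ver : Type u₃
  Cell : Type u₄
  h : ArrCat Obj Hor
  v : ArrCat Obj Ver
  ch : ArrCat Ver Cell
  cv : ArrCat Hor Cell
  src_top : ∀ a, h.src (cv.src a) = v.src (ch.src a)
  tgt_top : ∀ a, h.tgt (cv.src a) = v.src (ch.tgt a)
  src_bot : ∀ a, h.src (cv.tgt a) = v.tgt (ch.src a)
  tgt_bot : ∀ a, h.tgt (cv.tgt a) = v.tgt (ch.tgt a)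
  top_hid : ∀ u, cv.src (ch.id u) = h.id (v.src u)
  bot_hid : ∀ u, cv.tgt (ch.id u) = h.id (v.tgt u)
  left_vid : ∀ f, ch.src (cv.id f) = v.id (h.src f)
  right_vid : ∀ f, ch.tgt (cv.id f) = v.id (h.tgt f)
  top_hcomp : ∀ a b (w : ch.tgt a = ch.src b), cv.src (ch.comp a b w) =
    h.comp (cv.src a) (cv.src b) (by rw [tgt_top, src_top, w])
  bot_hcomp : ∀ a b (w : ch.tgt a = ch.src b), cv.tgt (ch.comp a b w) =
    h.comp (cv.tgt a) (cv.tgt b) (by rw [tgt_bot, src_bot, w])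
  left_vcomp : ∀ a b (w : cv.tgt a = cv.src b), ch.src (cv.comp a b w) =
    v.comp (ch.src a) (ch.src b) (by rw [← src_bot, ← src_top, w])
  right_vcomp : ∀ a b (w : cv.tgt a = cv.src b), ch.tgt (cv.comp a b w) =
    v.comp (ch.tgt a) (ch.tgt b) (by rw [← tgt_bot, ← tgt_top, w])
  vid_hid : ∀ A, cv.id (h.id A) = ch.id (v.id A)
  vid_hcomp : ∀ f g (w : h.tgt f = h.src g), cv.id (h.comp f g w) =
    ch.comp (cv.id f) (cv.id g) (by rw [left_vid, right_vid, w])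
  hid_vcomp : ∀ x y (w : v.tgt x = v.src y), ch.id (v.comp x y w) =
    cv.comp (ch.id x) (ch.id y) (by rw [top_hid, bot_hid, w])
  interchange : ∀ a b c d (ac : ch.tgt a = ch.src c) (bd : ch.tgt b = ch.src d)
    (ab : cv.tgt a = cv.src b) (cd : cv.tgt c = cv.src d),
    ch.comp (cv.comp a b ab) (cv.comp c d cd) (by simp only [left_vcomp, right_vcomp, ac, bd]) =
    cv.comp (ch.comp a c ac) (ch.comp b d bd) (by simp only [top_hcomp, bot_hcomp, ab, cd])

namespace DoubleCat

/-- Composite of 1h-cells, in diagrammatic order. -/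
noncomputable def Hor.seq {D : DoubleCat.{u₁, u₂, u₃, u₄}} (f g : D.Hor) : D.Hor := D.h.cmp f g
/-- Composite of 1v-cells, in diagrammatic order. -/
noncomputable def Ver.seq {D : DoubleCat.{u₁, u₂, u₃, u₄}} (x y : D.Ver) : D.Ver := D.v.cmp x y
/-- Horizontal composite of 2-cells, `a` on the left of `b`. -/
noncomputable def Cell.beside {D : DoubleCat.{u₁, u₂, u₃, u₄}} (a b : D.Cell) : D.Cell :=
  D.ch.cmp a b
/-- Vertical composite of 2-cells, `a` on top of `b`. -/
noncomputable def Cell.over {D : DoubleCat.{u₁, u₂, u₃, u₄}} (a b : D.Cell) : D.Cell :=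
  D.cv.cmp a b

end DoubleCat

infixl:80 " ≫ₕ " => DoubleCat.Hor.seq
infixl:80 " ≫ᵥ " => DoubleCat.Ver.seq
infixl:75 " ⫿ " => DoubleCat.Cell.beside
infixl:70 " ⊟ " => DoubleCat.Cell.over

namespace DoubleCat

variable (D : DoubleCat.{u₁, u₂, u₃, u₄})

/-- The top boundary of a 2-cell. -/
def top (a : D.Cell) : D.Hor := D.cv.src a
/-- The bottom boundary of a 2-cell. -/
def bot (a : D.Cell) : D.Hor := D.cv.tgt a
/-- The left boundary of a 2-cell. -/
def left (a : D.Cell) : D.Ver := D.ch.src a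
/-- The right boundary of a 2-cell. -/
def right (a : D.Cell) : D.Ver := D.ch.tgt a
/-- The identity 1h-cell of an object. -/
def hid (A : D.Obj) : D.Hor := D.h.id A
/-- The identity 1v-cell of an object. -/
def vid (A : D.Obj) : D.Ver := D.v.id A
/-- The vertical identity 2-cell `Id_f` of a 1h-cell. -/
def idH (f : D.Hor) : D.Cell := D.cv.id f
/-- The horizontal identity 2-cell `Id^u` of a 1v-cell. -/
def idV (x : D.Ver) : D.Cell := D.ch.id x

/-- The 2-cell `a` has top `f`, bottom `g`, left boundary `x` and right boundary `y`. -/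
structure Bd (a : D.Cell) (f g : D.Hor) (x y : D.Ver) : Prop where
  top : D.top a = f
  bot : D.bot a = g
  left : D.left a = x
  right : D.right a = y

/-- The 1h-cell `f` goes from `A` to `B`. -/
structure HBd (f : D.Hor) (A B : D.Obj) : Prop where
  src : D.h.src f = A
  tgt : D.h.tgt f = B

/-- The 1v-cell `x` goes from `A` to `B`. -/
structure VBd (x : D.Ver) (A B : D.Obj) : Prop where
  src : D.v.src x = A
  tgt : D.v.tgt x = B

/-- The 2-cell `a` is vertically invertible. -/
def VIso (a : D.Cell) : Prop := D.cv.IsIso a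
/-- The 2-cell `a` is horizontally invertible. -/
def HIso (a : D.Cell) : Prop := D.ch.IsIso a

end DoubleCat
namespace DoubleCat

section Lib

variable {D : DoubleCat.{u₁, u₂, u₃, u₄}}

@[simp] theorem src_of_top (a : D.Cell) : D.h.src (D.top a) = D.v.src (D.left a) := D.src_top a
@[simp] theorem tgt_of_top (a : D.Cell) : D.h.tgt (D.top a) = D.v.src (D.right a) := D.tgt_top a
@[simp] theorem src_of_bot (a : D.Cell) : D.h.src (D.bot a) = D.v.tgt (D.left a) := D.src_bot a
@[simp] theorem tgt_of_bot (a : D.Cell) : D.h.tgt (D.bot a) = D.v.tgt (D.right a) := D.tgt_bot a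
@[simp] theorem src_hid (A : D.Obj) : D.h.src (D.hid A) = A := D.h.src_id A
@[simp] theorem tgt_hid (A : D.Obj) : D.h.tgt (D.hid A) = A := D.h.tgt_id A
@[simp] theorem src_vid (A : D.Obj) : D.v.src (D.vid A) = A := D.v.src_id A
@[simp] theorem tgt_vid (A : D.Obj) : D.v.tgt (D.vid A) = A := D.v.tgt_id A
@[simp] theorem top_idH (f : D.Hor) : D.top (D.idH f) = f := D.cv.src_id f
@[simp] theorem bot_idH (f : D.Hor) : D.bot (D.idH f) = f := D.cv.tgt_id f
@[simp] theorem left_idH (f : D.Hor) : D.left (D.idH f) = D.vid (D.h.src f) := D.left_vid f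
@[simp] theorem right_idH (f : D.Hor) : D.right (D.idH f) = D.vid (D.h.tgt f) := D.right_vid f
@[simp] theorem top_idV (x : D.Ver) : D.top (D.idV x) = D.hid (D.v.src x) := D.top_hid x
@[simp] theorem bot_idV (x : D.Ver) : D.bot (D.idV x) = D.hid (D.v.tgt x) := D.bot_hid x
@[simp] theorem left_idV (x : D.Ver) : D.left (D.idV x) = x := D.ch.src_id x
@[simp] theorem right_idV (x : D.Ver) : D.right (D.idV x) = x := D.ch.tgt_id x
theorem idH_hid (A : D.Obj) : D.idH (D.hid A) = D.idV (D.vid A) := D.vid_hid A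

@[simp] theorem src_seqH (f g : D.Hor) : D.h.src (f ≫ₕ g) = D.h.src f := D.h.src_cmp f g
@[simp] theorem tgt_seqH {f g : D.Hor} (w : D.h.tgt f = D.h.src g) : D.h.tgt (f ≫ₕ g) = D.h.tgt g :=
  D.h.tgt_cmp w
@[simp] theorem src_seqV (x y : D.Ver) : D.v.src (x ≫ᵥ y) = D.v.src x := D.v.src_cmp x y
@[simp] theorem tgt_seqV {x y : D.Ver} (w : D.v.tgt x = D.v.src y) : D.v.tgt (x ≫ᵥ y) = D.v.tgt y :=
  D.v.tgt_cmp w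
@[simp] theorem hid_seq {f : D.Hor} {A : D.Obj} (w : D.h.src f = A) : D.hid A ≫ₕ f = f := D.h.id_cmp w
@[simp] theorem seq_hid (f : D.Hor) (A : D.Obj) : f ≫ₕ D.hid A = f := D.h.cmp_id f A
@[simp] theorem vid_seq {f : D.Ver} {A : D.Obj} (w : D.v.src f = A) : D.vid A ≫ᵥ f = f := D.v.id_cmp w
@[simp] theorem seq_vid (f : D.Ver) (A : D.Obj) : f ≫ᵥ D.vid A = f := D.v.cmp_id f A
@[simp] theorem seqH_assoc {f g : D.Hor} (k : D.Hor) (w : D.h.tgt f = D.h.src g) :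
    f ≫ₕ g ≫ₕ k = f ≫ₕ (g ≫ₕ k) := D.h.cmp_assoc k w
@[simp] theorem seqV_assoc {f g : D.Ver} (k : D.Ver) (w : D.v.tgt f = D.v.src g) :
    f ≫ᵥ g ≫ᵥ k = f ≫ᵥ (g ≫ᵥ k) := D.v.cmp_assoc k w

@[simp] theorem left_beside (a b : D.Cell) : D.left (a ⫿ b) = D.left a := D.ch.src_cmp a b
@[simp] theorem right_beside {a b : D.Cell} (w : D.right a = D.left b) : D.right (a ⫿ b) = D.right b :=
  D.ch.tgt_cmp w
@[simp] theorem top_over (a b : D.Cell) : D.top (a ⊟ b) = D.top a := D.cv.src_cmp a b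
@[simp] theorem bot_over {a b : D.Cell} (w : D.bot a = D.top b) : D.bot (a ⊟ b) = D.bot b :=
  D.cv.tgt_cmp w
@[simp] theorem top_beside {a b : D.Cell} (w : D.right a = D.left b) :
    D.top (a ⫿ b) = D.top a ≫ₕ D.top b :=
  (congrArg D.cv.src (D.ch.cmp_eq w)).trans ((D.top_hcomp a b w).trans (D.h.cmp_eq _).symm)
@[simp] theorem bot_beside {a b : D.Cell} (w : D.right a = D.left b) :
    D.bot (a ⫿ b) = D.bot a ≫ₕ D.bot b :=
  (congrArg D.cv.tgt (D.ch.cmp_eq w)).trans ((D.bot_hcomp a b w).trans (D.h.cmp_eq _).symm)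
@[simp] theorem left_over {a b : D.Cell} (w : D.bot a = D.top b) :
    D.left (a ⊟ b) = D.left a ≫ᵥ D.left b :=
  (congrArg D.ch.src (D.cv.cmp_eq w)).trans ((D.left_vcomp a b w).trans (D.v.cmp_eq _).symm)
@[simp] theorem right_over {a b : D.Cell} (w : D.bot a = D.top b) :
    D.right (a ⊟ b) = D.right a ≫ᵥ D.right b :=
  (congrArg D.ch.tgt (D.cv.cmp_eq w)).trans ((D.right_vcomp a b w).trans (D.v.cmp_eq _).symm)

theorem idV_beside {a : D.Cell} {x : D.Ver} (w : D.left a = x) : D.idV x ⫿ a = a := D.ch.id_cmp w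
theorem beside_idV (a : D.Cell) (x : D.Ver) : a ⫿ D.idV x = a := D.ch.cmp_id a x
theorem idH_over {a : D.Cell} {f : D.Hor} (w : D.top a = f) : D.idH f ⊟ a = a := D.cv.id_cmp w
theorem over_idH (a : D.Cell) (f : D.Hor) : a ⊟ D.idH f = a := D.cv.cmp_id a f
theorem beside_assoc {a b : D.Cell} (c : D.Cell) (w : D.right a = D.left b) :
    a ⫿ b ⫿ c = a ⫿ (b ⫿ c) := D.ch.cmp_assoc c w
theorem over_assoc {a b : D.Cell} (c : D.Cell) (w : D.bot a = D.top b) :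
    a ⊟ b ⊟ c = a ⊟ (b ⊟ c) := D.cv.cmp_assoc c w
theorem idH_seq {f g : D.Hor} (w : D.h.tgt f = D.h.src g) :
    D.idH (f ≫ₕ g) = D.idH f ⫿ D.idH g :=
  (congrArg D.cv.id (D.h.cmp_eq w)).trans ((D.vid_hcomp f g w).trans (D.ch.cmp_eq _).symm)
theorem idV_seq {x y : D.Ver} (w : D.v.tgt x = D.v.src y) :
    D.idV (x ≫ᵥ y) = D.idV x ⊟ D.idV y :=
  (congrArg D.ch.id (D.v.cmp_eq w)).trans ((D.hid_vcomp x y w).trans (D.cv.cmp_eq _).symm)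
theorem interchange' {a b c d : D.Cell} (ac : D.right a = D.left c) (bd : D.right b = D.left d)
    (ab : D.bot a = D.top b) (cd : D.bot c = D.top d) :
    (a ⊟ b) ⫿ (c ⊟ d) = (a ⫿ c) ⊟ (b ⫿ d) := by
  have h1 : a ⊟ b = D.cv.comp a b ab := D.cv.cmp_eq ab
  have h2 : c ⊟ d = D.cv.comp c d cd := D.cv.cmp_eq cd
  have h3 : a ⫿ c = D.ch.comp a c ac := D.ch.cmp_eq ac
  have h4 : b ⫿ d = D.ch.comp b d bd := D.ch.cmp_eq bd
  rw [h1, h2, h3, h4]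
  have h5 : D.ch.tgt (D.cv.comp a b ab) = D.ch.src (D.cv.comp c d cd) := by
    refine (D.right_vcomp a b ab).trans (Eq.trans ?_ (D.left_vcomp c d cd).symm); congr 1
  have h6 : D.cv.tgt (D.ch.comp a c ac) = D.cv.src (D.ch.comp b d bd) := by
    refine (D.bot_hcomp a c ac).trans (Eq.trans ?_ (D.top_hcomp b d bd).symm); congr 1
  exact (D.ch.cmp_eq h5).trans ((D.interchange a b c d ac bd ab cd).trans (D.cv.cmp_eq h6).symm)

theorem HBd.seq {f g : D.Hor} {A B C : D.Obj} (hf : D.HBd f A B) (hg : D.HBd g B C) :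
    D.HBd (f ≫ₕ g) A C :=
  ⟨by rw [src_seqH, hf.src], by rw [tgt_seqH (hf.tgt.trans hg.src.symm), hg.tgt]⟩
theorem VBd.seq {f g : D.Ver} {A B C : D.Obj} (hf : D.VBd f A B) (hg : D.VBd g B C) :
    D.VBd (f ≫ᵥ g) A C :=
  ⟨by rw [src_seqV, hf.src], by rw [tgt_seqV (hf.tgt.trans hg.src.symm), hg.tgt]⟩
theorem HBd.id (A : D.Obj) : D.HBd (D.hid A) A A := ⟨D.h.src_id A, D.h.tgt_id A⟩
theorem VBd.id (A : D.Obj) : D.VBd (D.vid A) A A := ⟨D.v.src_id A, D.v.tgt_id A⟩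

variable {a b c d : D.Cell} {f f' g g' k k' l l' : D.Hor} {x x' y y' z z' : D.Ver}

theorem Bd.beside (ha : D.Bd a f g x y) (hb : D.Bd b f' g' y z) :
    D.Bd (a ⫿ b) (f ≫ₕ f') (g ≫ₕ g') x z :=
  have w := ha.right.trans hb.left.symm
  ⟨by rw [top_beside w, ha.top, hb.top], by rw [bot_beside w, ha.bot, hb.bot],
    by rw [left_beside, ha.left], by rw [right_beside w, hb.right]⟩

theorem Bd.over (ha : D.Bd a f g x y) (hb : D.Bd b g k x' y') :
    D.Bd (a ⊟ b) f k (x ≫ᵥ x') (y ≫ᵥ y') :=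
  have w := ha.bot.trans hb.top.symm
  ⟨by rw [top_over, ha.top], by rw [bot_over w, hb.bot],
    by rw [left_over w, ha.left, hb.left], by rw [right_over w, ha.right, hb.right]⟩

theorem Bd.idH {A B : D.Obj} (hf : D.HBd f A B) : D.Bd (D.idH f) f f (D.vid A) (D.vid B) :=
  ⟨top_idH f, bot_idH f, by rw [left_idH, hf.src], by rw [right_idH, hf.tgt]⟩

theorem Bd.idV {A B : D.Obj} (hx : D.VBd x A B) : D.Bd (D.idV x) (D.hid A) (D.hid B) x x :=
  ⟨by rw [top_idV, hx.src], by rw [bot_idV, hx.tgt], left_idV x, right_idV x⟩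

theorem Bd.self (a : D.Cell) : D.Bd a (D.top a) (D.bot a) (D.left a) (D.right a) :=
  ⟨rfl, rfl, rfl, rfl⟩

theorem Bd.congr (ha : D.Bd a f g x y) (hf : f = f') (hg : g = g') (hx : x = x') (hy : y = y') :
    D.Bd a f' g' x' y' := by subst hf hg hx hy; exact ha

/-- Corners of a cell, in terms of its boundary. -/
theorem Bd.topBd (ha : D.Bd a f g x y) : D.HBd f (D.v.src x) (D.v.src y) := by
  rw [← ha.top, ← ha.left, ← ha.right]; exact ⟨src_of_top a, tgt_of_top a⟩
theorem Bd.botBd (ha : D.Bd a f g x y) : D.HBd g (D.v.tgt x) (D.v.tgt y) := by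
  rw [← ha.bot, ← ha.left, ← ha.right]; exact ⟨src_of_bot a, tgt_of_bot a⟩

/-- The inverse of a vertically invertible cell. -/
noncomputable def vinv (a : D.Cell) : D.Cell := D.cv.inv a
/-- The inverse of a horizontally invertible cell. -/
noncomputable def hinv (a : D.Cell) : D.Cell := D.ch.inv a

theorem over_vinv (ha : D.top a = f) (i : D.VIso a) : a ⊟ vinv a = D.idH f := by
  subst ha; exact D.cv.cmp_inv i
theorem vinv_over (ha : D.bot a = f) (i : D.VIso a) : vinv a ⊟ a = D.idH f := by
  subst ha; exact D.cv.inv_cmp i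
theorem beside_hinv (ha : D.left a = x) (i : D.HIso a) : a ⫿ hinv a = D.idV x := by
  subst ha; exact D.ch.cmp_inv i
theorem hinv_beside (ha : D.right a = x) (i : D.HIso a) : hinv a ⫿ a = D.idV x := by
  subst ha; exact D.ch.inv_cmp i
theorem top_vinv (i : D.VIso a) : D.top (vinv a) = D.bot a := D.cv.src_inv i
theorem bot_vinv (i : D.VIso a) : D.bot (vinv a) = D.top a := D.cv.tgt_inv i

theorem Bd.vinv {A B : D.Obj} (ha : D.Bd a f g (D.vid A) (D.vid B)) (i : D.VIso a) :
    D.Bd (vinv a) g f (D.vid A) (D.vid B) := by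
  have h3 := over_vinv ha.top i
  have h4 := ha.over ((Bd.self (DoubleCat.vinv a)).congr ((top_vinv i).trans ha.bot) rfl rfl rfl)
  rw [h3] at h4
  have hf := ha.topBd
  have h5 := h4.left.symm.trans (Bd.idH hf).left
  have h6 := h4.right.symm.trans (Bd.idH hf).right
  have s1 : D.v.src (D.left (DoubleCat.vinv a)) = A := by
    rw [← src_of_top, top_vinv i, src_of_bot, ha.left, tgt_vid]
  have s2 : D.v.src (D.right (DoubleCat.vinv a)) = B := by
    rw [← tgt_of_top, top_vinv i, tgt_of_bot, ha.right, tgt_vid]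
  rw [vid_seq s1, src_vid] at h5
  rw [vid_seq s2, src_vid] at h6
  exact ⟨(top_vinv i).trans ha.bot, (bot_vinv i).trans ha.top, h5, h6⟩

end Lib

end DoubleCat

universe w₁ w₂ w₃ w₄ t₁ t₂ t₃ t₄

namespace DoubleCat

/-- A pseudodouble functor: strictly functorial in the vertical direction, and functorial in the
horizontal direction up to vertically invertible globular 2-cells (compositors and unitors). -/
structure PsFunctor (C : DoubleCat.{u₁, u₂, u₃, u₄}) (D : DoubleCat.{w₁, w₂, w₃, w₄}) where
  obj : C.Obj → D.Obj
  hor : C.Hor → D.Hor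
  ver : C.Ver → D.Ver
  cell : C.Cell → D.Cell
  hor_bd : ∀ f, D.HBd (hor f) (obj (C.h.src f)) (obj (C.h.tgt f))
  ver_bd : ∀ x, D.VBd (ver x) (obj (C.v.src x)) (obj (C.v.tgt x))
  cell_bd : ∀ a, D.Bd (cell a) (hor (C.top a)) (hor (C.bot a)) (ver (C.left a)) (ver (C.right a))
  ver_seq : ∀ x y, C.v.tgt x = C.v.src y → ver (x ≫ᵥ y) = ver x ≫ᵥ ver y
  ver_id : ∀ A, ver (C.vid A) = D.vid (obj A)
  cell_over : ∀ a b, C.bot a = C.top b → cell (a ⊟ b) = cell a ⊟ cell b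
  cell_idH : ∀ f, cell (C.idH f) = D.idH (hor f)
  /-- The compositor, a globular 2-cell from the composite of the images of `f`, `g` to the image
  of the composite. -/
  cmpr : ∀ f g, C.h.tgt f = C.h.src g → D.Cell
  cmpr_bd : ∀ f g w, D.Bd (cmpr f g w) (hor f ≫ₕ hor g) (hor (f ≫ₕ g))
    (D.vid (obj (C.h.src f))) (D.vid (obj (C.h.tgt g)))
  cmpr_iso : ∀ f g w, D.VIso (cmpr f g w)
  /-- The unitor, a globular 2-cell from the identity to the image of the identity. -/
  unit : C.Obj → D.Cell
  unit_bd : ∀ A, D.Bd (unit A) (D.hid (obj A)) (hor (C.hid A)) (D.vid (obj A)) (D.vid (obj A))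
  unit_iso : ∀ A, D.VIso (unit A)
  cmpr_assoc : ∀ f g k (w₁ : C.h.tgt f = C.h.src g) (w₂ : C.h.tgt g = C.h.src k),
    (cmpr f g w₁ ⫿ D.idH (hor k)) ⊟ cmpr (f ≫ₕ g) k ((tgt_seqH w₁).trans w₂) =
      (D.idH (hor f) ⫿ cmpr g k w₂) ⊟ cmpr f (g ≫ₕ k) (w₁.trans (src_seqH g k).symm)
  unit_cmpr : ∀ f, (unit (C.h.src f) ⫿ D.idH (hor f)) ⊟ cmpr (C.hid (C.h.src f)) f (C.h.tgt_id _) =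
    D.idH (hor f)
  cmpr_unit : ∀ f, (D.idH (hor f) ⫿ unit (C.h.tgt f)) ⊟
    cmpr f (C.hid (C.h.tgt f)) (C.h.src_id _).symm = D.idH (hor f)
  cmpr_nat : ∀ a b (w : C.right a = C.left b),
    (cell a ⫿ cell b) ⊟ cmpr (C.bot a) (C.bot b) (by rw [tgt_of_bot, src_of_bot, w]) =
      cmpr (C.top a) (C.top b) (by rw [tgt_of_top, src_of_top, w]) ⊟ cell (a ⫿ b)
  unit_nat : ∀ x, D.idV (ver x) ⊟ unit (C.v.tgt x) = unit (C.v.src x) ⊟ cell (C.idV x)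

section Trans

variable {C : DoubleCat.{u₁, u₂, u₃, u₄}} {D : DoubleCat.{w₁, w₂, w₃, w₄}}

/-- A horizontal pseudonatural transformation `F ⟶ G` between pseudodouble functors (a horizontal
oplax transformation whose 2-cells `δ f` are vertically invertible). -/
structure HTrans (F G : PsFunctor C D) where
  /-- The 1h-cell component at an object. -/
  app : C.Obj → D.Hor
  /-- The 2-cell component at a 1v-cell. -/
  sq : C.Ver → D.Cell
  /-- The (oplax) 2-cell component at a 1h-cell. -/
  δ : C.Hor → D.Cell
  app_bd : ∀ A, D.HBd (app A) (F.obj A) (G.obj A)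
  sq_bd : ∀ x, D.Bd (sq x) (app (C.v.src x)) (app (C.v.tgt x)) (F.ver x) (G.ver x)
  δ_bd : ∀ f, D.Bd (δ f) (F.hor f ≫ₕ app (C.h.tgt f)) (app (C.h.src f) ≫ₕ G.hor f)
    (D.vid (F.obj (C.h.src f))) (D.vid (G.obj (C.h.tgt f)))
  δ_iso : ∀ f, D.VIso (δ f)
  δ_seq : ∀ f g (w : C.h.tgt f = C.h.src g),
    (F.cmpr f g w ⫿ D.idH (app (C.h.tgt g))) ⊟ δ (f ≫ₕ g) =
      (D.idH (F.hor f) ⫿ δ g) ⊟ (δ f ⫿ D.idH (G.hor g)) ⊟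
        (D.idH (app (C.h.src f)) ⫿ G.cmpr f g w)
  δ_hid : ∀ A, (F.unit A ⫿ D.idH (app A)) ⊟ δ (C.hid A) = D.idH (app A) ⫿ G.unit A
  sq_seq : ∀ x y, C.v.tgt x = C.v.src y → sq (x ≫ᵥ y) = sq x ⊟ sq y
  sq_vid : ∀ A, sq (C.vid A) = D.idH (app A)
  nat : ∀ a, (F.cell a ⫿ sq (C.right a)) ⊟ δ (C.bot a) = δ (C.top a) ⊟ (sq (C.left a) ⫿ G.cell a)

/-- The 2-cell component at a 1h-cell of the lax structure of a horizontal pseudonatural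
transformation. -/
noncomputable def HTrans.lax {F G : PsFunctor C D} (α : HTrans F G) (f : C.Hor) : D.Cell :=
  vinv (α.δ f)

/-- A vertical pseudonatural transformation `F ⟶ G` between pseudodouble functors (a vertical
lax transformation whose 2-cells `δ x` are horizontally invertible). -/
structure VTrans (F G : PsFunctor C D) where
  /-- The 1v-cell component at an object. -/
  app : C.Obj → D.Ver
  /-- The 2-cell component at a 1h-cell. -/
  sq : C.Hor → D.Cell
  /-- The (lax) 2-cell component at a 1v-cell. -/
  δ : C.Ver → D.Cell
  app_bd : ∀ A, D.VBd (app A) (F.obj A) (G.obj A)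
  sq_bd : ∀ f, D.Bd (sq f) (F.hor f) (G.hor f) (app (C.h.src f)) (app (C.h.tgt f))
  δ_bd : ∀ x, D.Bd (δ x) (D.hid (F.obj (C.v.src x))) (D.hid (G.obj (C.v.tgt x)))
    (app (C.v.src x) ≫ᵥ G.ver x) (F.ver x ≫ᵥ app (C.v.tgt x))
  δ_iso : ∀ x, D.HIso (δ x)
  sq_seq : ∀ f g (w : C.h.tgt f = C.h.src g),
    (sq f ⫿ sq g) ⊟ G.cmpr f g w = F.cmpr f g w ⊟ sq (f ≫ₕ g)
  sq_hid : ∀ A, F.unit A ⊟ sq (C.hid A) = D.idV (app A) ⊟ G.unit A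
  δ_seq : ∀ x y, C.v.tgt x = C.v.src y →
    δ (x ≫ᵥ y) = (δ x ⊟ D.idV (G.ver y)) ⫿ (D.idV (F.ver x) ⊟ δ y)
  δ_vid : ∀ A, δ (C.vid A) = D.idV (app A)
  nat : ∀ a, δ (C.left a) ⫿ (F.cell a ⊟ sq (C.bot a)) = (sq (C.top a) ⊟ G.cell a) ⫿ δ (C.right a)

/-- The 2-cell component at a 1v-cell of the oplax structure of a vertical pseudonatural
transformation. -/
noncomputable def VTrans.oplax {F G : PsFunctor C D} (α : VTrans F G) (x : C.Ver) : D.Cell :=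
  hinv (α.δ x)

/-- The family of 2-cells `θ A` is a modification with horizontal boundaries `α : F ⟶ G` (top) and
`β : F' ⟶ G'` (bottom) and vertical boundaries `α₀ : F ⟶ F'` (left) and `β₀ : G ⟶ G'` (right). The
domains and codomains have to match; this is recorded by equations. -/
structure IsModification {F₁ F₂ G₁ G₂ F₁' F₂' G₁' G₂' : PsFunctor C D} (α : HTrans F₁ G₁)
    (β : HTrans F₁' G₁') (α₀ : VTrans F₂ F₂') (β₀ : VTrans G₂ G₂') (θ : C.Obj → D.Cell) :
    Prop where
  eq_F : F₁ = F₂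
  eq_G : G₁ = G₂
  eq_F' : F₁' = F₂'
  eq_G' : G₁' = G₂'
  bd : ∀ A, D.Bd (θ A) (α.app A) (β.app A) (α₀.app A) (β₀.app A)
  hor : ∀ f, (α₀.sq f ⫿ θ (C.h.tgt f)) ⊟ β.δ f = α.δ f ⊟ (θ (C.h.src f) ⫿ β₀.sq f)
  ver : ∀ x, α₀.δ x ⫿ (α.sq x ⊟ θ (C.v.tgt x)) = (θ (C.v.src x) ⊟ β.sq x) ⫿ β₀.δ x

end Trans
end DoubleCat
namespace DoubleCat
section
variable {C : DoubleCat.{u₁, u₂, u₃, u₄}} {D : DoubleCat.{w₁, w₂, w₃, w₄}}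
namespace PsFunctor
variable (F : PsFunctor C D)
@[simp] theorem src_hor (f : C.Hor) : D.h.src (F.hor f) = F.obj (C.h.src f) := (F.hor_bd f).src
@[simp] theorem tgt_hor (f : C.Hor) : D.h.tgt (F.hor f) = F.obj (C.h.tgt f) := (F.hor_bd f).tgt
@[simp] theorem src_ver (x : C.Ver) : D.v.src (F.ver x) = F.obj (C.v.src x) := (F.ver_bd x).src
@[simp] theorem tgt_ver (x : C.Ver) : D.v.tgt (F.ver x) = F.obj (C.v.tgt x) := (F.ver_bd x).tgt
@[simp] theorem top_cell (a : C.Cell) : D.top (F.cell a) = F.hor (C.top a) := (F.cell_bd a).top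
@[simp] theorem bot_cell (a : C.Cell) : D.bot (F.cell a) = F.hor (C.bot a) := (F.cell_bd a).bot
@[simp] theorem left_cell (a : C.Cell) : D.left (F.cell a) = F.ver (C.left a) := (F.cell_bd a).left
@[simp] theorem right_cell (a : C.Cell) : D.right (F.cell a) = F.ver (C.right a) := (F.cell_bd a).right
@[simp] theorem top_cmpr (f g w) : D.top (F.cmpr f g w) = F.hor f ≫ₕ F.hor g := (F.cmpr_bd f g w).top
@[simp] theorem bot_cmpr (f g w) : D.bot (F.cmpr f g w) = F.hor (f ≫ₕ g) := (F.cmpr_bd f g w).bot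
@[simp] theorem left_cmpr (f g w) : D.left (F.cmpr f g w) = D.vid (F.obj (C.h.src f)) := (F.cmpr_bd f g w).left
@[simp] theorem right_cmpr (f g w) : D.right (F.cmpr f g w) = D.vid (F.obj (C.h.tgt g)) := (F.cmpr_bd f g w).right
@[simp] theorem top_unit (A) : D.top (F.unit A) = D.hid (F.obj A) := (F.unit_bd A).top
@[simp] theorem bot_unit (A) : D.bot (F.unit A) = F.hor (C.hid A) := (F.unit_bd A).bot
@[simp] theorem left_unit (A) : D.left (F.unit A) = D.vid (F.obj A) := (F.unit_bd A).left
@[simp] theorem right_unit (A) : D.right (F.unit A) = D.vid (F.obj A) := (F.unit_bd A).right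
end PsFunctor
namespace HTrans
variable {F G : PsFunctor C D} (α : HTrans F G)
@[simp] theorem src_app (A) : D.h.src (α.app A) = F.obj A := (α.app_bd A).src
@[simp] theorem tgt_app (A) : D.h.tgt (α.app A) = G.obj A := (α.app_bd A).tgt
@[simp] theorem top_sq (x) : D.top (α.sq x) = α.app (C.v.src x) := (α.sq_bd x).top
@[simp] theorem bot_sq (x) : D.bot (α.sq x) = α.app (C.v.tgt x) := (α.sq_bd x).bot
@[simp] theorem left_sq (x) : D.left (α.sq x) = F.ver x := (α.sq_bd x).left
@[simp] theorem right_sq (x) : D.right (α.sq x) = G.ver x := (α.sq_bd x).right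
@[simp] theorem top_δ (f) : D.top (α.δ f) = F.hor f ≫ₕ α.app (C.h.tgt f) := (α.δ_bd f).top
@[simp] theorem bot_δ (f) : D.bot (α.δ f) = α.app (C.h.src f) ≫ₕ G.hor f := (α.δ_bd f).bot
@[simp] theorem left_δ (f) : D.left (α.δ f) = D.vid (F.obj (C.h.src f)) := (α.δ_bd f).left
@[simp] theorem right_δ (f) : D.right (α.δ f) = D.vid (G.obj (C.h.tgt f)) := (α.δ_bd f).right
end HTrans
namespace VTrans
variable {F G : PsFunctor C D} (α : VTrans F G)
@[simp] theorem src_app (A) : D.v.src (α.app A) = F.obj A := (α.app_bd A).src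
@[simp] theorem tgt_app (A) : D.v.tgt (α.app A) = G.obj A := (α.app_bd A).tgt
@[simp] theorem top_sq (f) : D.top (α.sq f) = F.hor f := (α.sq_bd f).top
@[simp] theorem bot_sq (f) : D.bot (α.sq f) = G.hor f := (α.sq_bd f).bot
@[simp] theorem left_sq (f) : D.left (α.sq f) = α.app (C.h.src f) := (α.sq_bd f).left
@[simp] theorem right_sq (f) : D.right (α.sq f) = α.app (C.h.tgt f) := (α.sq_bd f).right
@[simp] theorem top_δ (x) : D.top (α.δ x) = D.hid (F.obj (C.v.src x)) := (α.δ_bd x).top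
@[simp] theorem bot_δ (x) : D.bot (α.δ x) = D.hid (G.obj (C.v.tgt x)) := (α.δ_bd x).bot
@[simp] theorem left_δ (x) : D.left (α.δ x) = α.app (C.v.src x) ≫ᵥ G.ver x := (α.δ_bd x).left
@[simp] theorem right_δ (x) : D.right (α.δ x) = F.ver x ≫ᵥ α.app (C.v.tgt x) := (α.δ_bd x).right
end VTrans


section Pasting
variable {D : DoubleCat.{u₁, u₂, u₃, u₄}} {a b : D.Cell} {f g : D.Hor}

theorem over_beside_id (h : D.bot a = D.top b) (ha : D.right a = D.vid (D.h.src f))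
    (hb : D.right b = D.vid (D.h.src f)) :
    (a ⊟ b) ⫿ D.idH f = (a ⫿ D.idH f) ⊟ (b ⫿ D.idH f) := by
  conv_lhs => rw [← over_idH (D.idH f) f]
  rw [interchange'] <;> simp [*]
theorem id_beside_over (h : D.bot a = D.top b) (ha : D.left a = D.vid (D.h.tgt f))
    (hb : D.left b = D.vid (D.h.tgt f)) :
    D.idH f ⫿ (a ⊟ b) = (D.idH f ⫿ a) ⊟ (D.idH f ⫿ b) := by
  conv_lhs => rw [← over_idH (D.idH f) f]
  rw [interchange'] <;> simp [*]
theorem merge₁ (w : D.h.tgt f = D.h.src g) : D.idH f ⫿ D.idH g = D.idH (f ≫ₕ g) := (idH_seq w).symm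
theorem merge₂ (ha : D.right a = D.vid (D.h.src f)) (w : D.h.tgt f = D.h.src g) :
    a ⫿ D.idH f ⫿ D.idH g = a ⫿ D.idH (f ≫ₕ g) := by
  rw [beside_assoc _ (by simp [ha]), merge₁ w]
theorem merge₃ (w : D.h.tgt f = D.h.src g) :
    D.idH f ⫿ (D.idH g ⫿ a) = D.idH (f ≫ₕ g) ⫿ a := by
  rw [← beside_assoc _ (by simp [w]), merge₁ w]
theorem merge₄ (ha : D.left a = D.vid (D.h.tgt f)) :
    D.idH f ⫿ a ⫿ D.idH g = D.idH f ⫿ (a ⫿ D.idH g) := beside_assoc _ (by simp [ha])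
theorem exch (w : D.h.tgt f = D.h.src g) (ha : D.right a = D.vid (D.h.tgt f))
    (hb : D.left b = D.vid (D.h.tgt f)) (hf : D.bot a = f) (hg : D.top b = g) :
    (a ⫿ D.idH g) ⊟ (D.idH f ⫿ b) = a ⫿ b := by
  subst hf hg
  rw [← interchange' (by simp [ha, w]) (by simp [hb]) (by simp) (by simp), over_idH, idH_over rfl]
theorem exch' (w : D.h.tgt f = D.h.src g) (ha : D.right a = D.vid (D.h.tgt f))
    (hb : D.left b = D.vid (D.h.tgt f)) (hf : D.top a = f) (hg : D.bot b = g) :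
    (D.idH f ⫿ b) ⊟ (a ⫿ D.idH g) = a ⫿ b := by
  subst hf hg
  rw [← interchange' (by simp [hb]) (by simp [ha, w]) (by simp) (by simp), over_idH, idH_over rfl]
/-- Sliding two globular 2-cells past each other. -/
theorem slide {f' g' : D.Hor} (w : D.h.tgt f = D.h.src g) (ha : D.right a = D.vid (D.h.tgt f))
    (hb : D.left b = D.vid (D.h.tgt f)) (w' : D.h.tgt f' = D.h.tgt f) (w'' : D.h.src g' = D.h.src g)
    (hf : D.bot a = f) (hg : D.top b = g) (hf' : D.top a = f') (hg' : D.bot b = g') :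
    (a ⫿ D.idH g) ⊟ (D.idH f ⫿ b) = (D.idH f' ⫿ b) ⊟ (a ⫿ D.idH g') := by
  rw [exch w ha hb hf hg, exch' (w'.trans (w.trans w''.symm)) (by rw [ha, w']) (by rw [hb, w']) hf' hg']

theorem VIso.over (ha : D.VIso a) (hb : D.VIso b) (w : D.bot a = D.top b) : D.VIso (a ⊟ b) := by
  refine ⟨vinv b ⊟ vinv a, ?_⟩
  have e1 : D.bot (vinv b) = D.top (vinv a) := by rw [bot_vinv hb, top_vinv ha, w]
  refine ArrCat.IsInverse.mk_cmp _ ?_ ?_ ?_ ?_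
  · exact (bot_over w).trans ((top_vinv hb).symm.trans (top_over _ _).symm)
  · exact (bot_over e1).trans ((bot_vinv ha).trans (top_over _ _).symm)
  · change (a ⊟ b) ⊟ (vinv b ⊟ vinv a) = D.idH (D.top (a ⊟ b))
    rw [over_assoc _ w, ← over_assoc (vinv a) (top_vinv hb).symm, over_vinv rfl hb,
      idH_over ((top_vinv ha).trans w), over_vinv rfl ha, top_over]
  · change (vinv b ⊟ vinv a) ⊟ (a ⊟ b) = D.idH (D.top (vinv b ⊟ vinv a))
    rw [over_assoc _ e1, ← over_assoc b (bot_vinv ha), vinv_over rfl ha,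
      idH_over w.symm, vinv_over rfl hb, top_over, top_vinv hb]
end Pasting
end
end DoubleCat

namespace DoubleCat

/-- The double category with the horizontal and the vertical direction exchanged. -/
def transpose (D : DoubleCat.{u₁, u₂, u₃, u₄}) : DoubleCat.{u₁, u₃, u₂, u₄} where
  Obj := D.Obj
  Hor := D.Ver
  Ver := D.Hor
  Cell := D.Cell
  h := D.v
  v := D.h
  ch := D.cv
  cv := D.ch
  src_top a := (D.src_top a).symm
  tgt_top a := (D.src_bot a).symm
  src_bot a := (D.tgt_top a).symm
  tgt_bot a := (D.tgt_bot a).symm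
  top_hid := D.left_vid
  bot_hid := D.right_vid
  left_vid := D.top_hid
  right_vid := D.bot_hid
  top_hcomp := D.left_vcomp
  bot_hcomp := D.right_vcomp
  left_vcomp := D.top_hcomp
  right_vcomp := D.bot_hcomp
  vid_hid A := (D.vid_hid A).symm
  vid_hcomp := D.hid_vcomp
  hid_vcomp := D.vid_hcomp
  interchange a b c d ac bd ab cd := (D.interchange a c b d ab cd ac bd).symm

section Pasting
variable {D : DoubleCat.{u₁, u₂, u₃, u₄}} {a b : D.Cell} {x y : D.Ver} {f : D.Hor}

theorem VIso.beside_id {A B : D.Obj} {g g' : D.Hor} (ha : D.VIso a)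
    (hb : D.Bd a g g' (D.vid A) (D.vid B)) (w : B = D.h.src f) : D.VIso (a ⫿ D.idH f) := by
  have hv := hb.vinv ha
  refine ⟨vinv a ⫿ D.idH f, ArrCat.IsInverse.mk_cmp _ ?_ ?_ ?_ ?_⟩
  · change D.bot _ = D.top _; simp [hb.right, hv.right, w, hb.bot, hv.top]
  · change D.bot _ = D.top _; simp [hb.right, hv.right, w, hb.top, hv.bot]
  · change _ ⊟ _ = D.idH (D.top _)
    rw [← over_beside_id (by rw [hb.bot, hv.top]) (by rw [hb.right, w]) (by rw [hv.right, w]),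
      over_vinv rfl ha, top_beside (by simp [hb.right, w]), idH_seq, top_idH]
    simp [hb.right, w]
  · change _ ⊟ _ = D.idH (D.top _)
    rw [← over_beside_id (by rw [hv.bot, hb.top]) (by rw [hv.right, w]) (by rw [hb.right, w]),
      vinv_over rfl ha, top_beside (by simp [hv.right, w]), idH_seq, top_idH, hv.top, hb.bot]
    simp [hv.top, ← hb.bot, hb.right, w]

theorem VIso.id_beside {A B : D.Obj} {g g' : D.Hor} (ha : D.VIso a)
    (hb : D.Bd a g g' (D.vid A) (D.vid B)) (w : D.h.tgt f = A) : D.VIso (D.idH f ⫿ a) := by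
  have hv := hb.vinv ha
  refine ⟨D.idH f ⫿ vinv a, ArrCat.IsInverse.mk_cmp _ ?_ ?_ ?_ ?_⟩
  · change D.bot _ = D.top _; simp [hb.left, hv.left, w, hb.bot, hv.top]
  · change D.bot _ = D.top _; simp [hb.left, hv.left, w, hb.top, hv.bot]
  · change _ ⊟ _ = D.idH (D.top _)
    rw [← id_beside_over (by rw [hb.bot, hv.top]) (by rw [hb.left, w]) (by rw [hv.left, w]),
      over_vinv rfl ha, top_beside (by simp [hb.left, w]), idH_seq, top_idH]
    simp [hb.left, w]
  · change _ ⊟ _ = D.idH (D.top _)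
    rw [← id_beside_over (by rw [hv.bot, hb.top]) (by rw [hv.left, w]) (by rw [hb.left, w]),
      vinv_over rfl ha, top_beside (by simp [hv.left, w]), idH_seq, top_idH, hv.top, hb.bot]
    simp [hv.top, ← hb.bot, hb.left, w]

theorem Bd.toTranspose {f g : D.Hor} (h : D.Bd a f g x y) : D.transpose.Bd a x y f g :=
  ⟨h.left, h.right, h.top, h.bot⟩

theorem HIso.over_id {A B : D.Obj} {z z' : D.Ver} (ha : D.HIso a)
    (hb : D.Bd a (D.hid A) (D.hid B) z z') (w : B = D.v.src x) : D.HIso (a ⊟ D.idV x) :=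
  VIso.beside_id (D := D.transpose) ha hb.toTranspose w
theorem HIso.id_over {A B : D.Obj} {z z' : D.Ver} (ha : D.HIso a)
    (hb : D.Bd a (D.hid A) (D.hid B) z z') (w : D.v.tgt x = A) : D.HIso (D.idV x ⊟ a) :=
  VIso.id_beside (D := D.transpose) ha hb.toTranspose w
theorem HIso.beside (ha : D.HIso a) (hb : D.HIso b) (w : D.right a = D.left b) : D.HIso (a ⫿ b) :=
  VIso.over (D := D.transpose) ha hb w
theorem VIso.idH (f : D.Hor) : D.VIso (D.idH f) :=
  ⟨D.idH f, ArrCat.IsInverse.mk_cmp _ ((bot_idH f).trans (top_idH f).symm)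
    ((bot_idH f).trans (top_idH f).symm)
    ((over_idH _ f).trans (congrArg D.idH (top_idH f).symm))
    ((over_idH _ f).trans (congrArg D.idH (top_idH f).symm))⟩
theorem HIso.idV (x : D.Ver) : D.HIso (D.idV x) := VIso.idH (D := D.transpose) x

theorem beside_over_id (h : D.right a = D.left b) (ha : D.bot a = D.hid (D.v.src x))
    (hb : D.bot b = D.hid (D.v.src x)) :
    (a ⫿ b) ⊟ D.idV x = (a ⊟ D.idV x) ⫿ (b ⊟ D.idV x) :=
  over_beside_id (D := D.transpose) h ha hb
theorem id_over_beside (h : D.right a = D.left b) (ha : D.top a = D.hid (D.v.tgt x))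
    (hb : D.top b = D.hid (D.v.tgt x)) :
    D.idV x ⊟ (a ⫿ b) = (D.idV x ⊟ a) ⫿ (D.idV x ⊟ b) :=
  id_beside_over (D := D.transpose) h ha hb
theorem vmerge₁ (w : D.v.tgt x = D.v.src y) : D.idV x ⊟ D.idV y = D.idV (x ≫ᵥ y) :=
  (idV_seq w).symm
theorem vmerge₂ (ha : D.bot a = D.hid (D.v.src x)) (w : D.v.tgt x = D.v.src y) :
    a ⊟ D.idV x ⊟ D.idV y = a ⊟ D.idV (x ≫ᵥ y) := merge₂ (D := D.transpose) ha w
theorem vmerge₃ (w : D.v.tgt x = D.v.src y) :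
    D.idV x ⊟ (D.idV y ⊟ a) = D.idV (x ≫ᵥ y) ⊟ a := merge₃ (D := D.transpose) w
theorem vmerge₄ (ha : D.top a = D.hid (D.v.tgt x)) :
    D.idV x ⊟ a ⊟ D.idV y = D.idV x ⊟ (a ⊟ D.idV y) := merge₄ (D := D.transpose) ha
theorem vslide {x' y' : D.Ver} (w : D.v.tgt x = D.v.src y) (ha : D.bot a = D.hid (D.v.tgt x))
    (hb : D.top b = D.hid (D.v.tgt x)) (w' : D.v.tgt x' = D.v.tgt x) (w'' : D.v.src y' = D.v.src y)
    (hf : D.right a = x) (hg : D.left b = y) (hf' : D.left a = x') (hg' : D.right b = y') :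
    (a ⊟ D.idV y) ⫿ (D.idV x ⊟ b) = (D.idV x' ⊟ b) ⫿ (a ⊟ D.idV y') :=
  slide (D := D.transpose) w ha hb w' w'' hf hg hf' hg'

end Pasting

section Trans
variable {C : DoubleCat.{u₁, u₂, u₃, u₄}} {D : DoubleCat.{w₁, w₂, w₃, w₄}}
variable {F G G' H : PsFunctor C D}


theorem reassoc {a b a' b' : D.Cell} (h : a ⊟ b = a' ⊟ b') (w : D.bot a = D.top b)
    (w' : D.bot a' = D.top b') (c : D.Cell) : a ⊟ (b ⊟ c) = a' ⊟ (b' ⊟ c) := by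
  rw [← over_assoc c w, h, over_assoc c w']
theorem reassoc₁ {a b a' : D.Cell} (h : a ⊟ b = a') (w : D.bot a = D.top b)
    (c : D.Cell) : a ⊟ (b ⊟ c) = a' ⊟ c := by
  rw [← over_assoc c w, h]

theorem comp_δ_seq (α : HTrans F G) (β : HTrans G H) (f g : C.Hor) (w : C.h.tgt f = C.h.src g) :
    (F.cmpr f g w ⫿ D.idH (α.app (C.h.tgt g) ≫ₕ β.app (C.h.tgt g))) ⊟
      ((α.δ (f ≫ₕ g) ⫿ D.idH (β.app (C.h.tgt (f ≫ₕ g)))) ⊟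
        (D.idH (α.app (C.h.src (f ≫ₕ g))) ⫿ β.δ (f ≫ₕ g))) =
    (D.idH (F.hor f) ⫿ ((α.δ g ⫿ D.idH (β.app (C.h.tgt g))) ⊟
        (D.idH (α.app (C.h.src g)) ⫿ β.δ g))) ⊟
      (((α.δ f ⫿ D.idH (β.app (C.h.tgt f))) ⊟
        (D.idH (α.app (C.h.src f)) ⫿ β.δ f)) ⫿ D.idH (H.hor g)) ⊟
      (D.idH (α.app (C.h.src f) ≫ₕ β.app (C.h.src f)) ⫿ H.cmpr f g w) := by
  rw [src_seqH, tgt_seqH w, ← merge₁ (by simp), ← beside_assoc _ (by simp),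
    ← over_assoc _ (by simp [w]), ← over_beside_id (by simp [w]) (by simp) (by simp [w]), α.δ_seq]
  have hs := slide (D := D) (a := α.δ f) (b := β.δ g) (f := α.app (C.h.src f) ≫ₕ G.hor f)
    (g := G.hor g ≫ₕ β.app (C.h.tgt g)) (f' := F.hor f ≫ₕ α.app (C.h.tgt f))
    (g' := β.app (C.h.src g) ≫ₕ H.hor g) (by simp [w]) (by simp) (by simp [w]) (by simp)
    (by simp) (by simp) (by simp) (by simp) (by simp)
  have hb := congrArg (fun t => D.idH (α.app (C.h.src f)) ⫿ t) (β.δ_seq f g w)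
  simp (disch := simp [w]) only [over_assoc, over_beside_id, id_beside_over, merge₂,
    merge₃, merge₄, w] at hb hs ⊢
  rw [hb, reassoc hs (by simp [w]) (by simp [w])]

theorem comp_δ_hid (α : HTrans F G) (β : HTrans G H) (A : C.Obj) :
    (F.unit A ⫿ D.idH (α.app A ≫ₕ β.app A)) ⊟ ((α.δ (C.hid A) ⫿ D.idH (β.app (C.h.tgt (C.hid A)))) ⊟
      (D.idH (α.app (C.h.src (C.hid A))) ⫿ β.δ (C.hid A))) =
    D.idH (α.app A ≫ₕ β.app A) ⫿ H.unit A := by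
  have ha := congrArg (fun t => t ⫿ D.idH (β.app A)) (α.δ_hid A)
  have hb := congrArg (fun t => D.idH (α.app A) ⫿ t) (β.δ_hid A)
  simp (disch := simp) only [over_beside_id, id_beside_over, merge₂, merge₃, merge₄,
    src_hid, tgt_hid] at ha hb ⊢
  rw [← over_assoc _ (by simp), ha, hb]

theorem absorb₁ {x y a : D.Cell} {f : D.Hor} (w : D.right x = D.left y) (h : D.bot y = f)
    (h₁ : D.right a = D.vid (D.h.src f)) (h₂ : D.bot x = D.top a) :
    (x ⫿ y) ⊟ (a ⫿ D.idH f) = (x ⊟ a) ⫿ y := by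
  rw [← interchange' w (by simp [h₁]) h₂ (by simp [h]), over_idH]
theorem absorb₂ {x y b : D.Cell} {f : D.Hor} (w : D.right x = D.left y) (h : D.bot x = f)
    (h₁ : D.left b = D.vid (D.h.tgt f)) (h₂ : D.bot y = D.top b) :
    (x ⫿ y) ⊟ (D.idH f ⫿ b) = x ⫿ (y ⊟ b) := by
  rw [← interchange' w (by simp [h₁]) (by simp [h]) h₂, over_idH]
theorem absorb₃ {x y a : D.Cell} {f : D.Hor} (w : D.right x = D.left y) (h : D.top y = f)
    (h₁ : D.right a = D.vid (D.h.src f)) (h₂ : D.bot a = D.top x) :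
    (a ⫿ D.idH f) ⊟ (x ⫿ y) = (a ⊟ x) ⫿ y := by
  rw [← interchange' (by simp [h₁]) w h₂ (by simp [h]), idH_over h]
theorem absorb₄ {x y b : D.Cell} {f : D.Hor} (w : D.right x = D.left y) (h : D.top x = f)
    (h₁ : D.left b = D.vid (D.h.tgt f)) (h₂ : D.bot b = D.top y) :
    (D.idH f ⫿ b) ⊟ (x ⫿ y) = x ⫿ (b ⊟ y) := by
  rw [← interchange' (by simp [h₁]) w (by simp [h]) h₂, idH_over h]

theorem comp_nat (α : HTrans F G) (β : HTrans G H) (a : C.Cell) :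
    (F.cell a ⫿ (α.sq (C.right a) ⫿ β.sq (C.right a))) ⊟
      ((α.δ (C.bot a) ⫿ D.idH (β.app (C.h.tgt (C.bot a)))) ⊟
        (D.idH (α.app (C.h.src (C.bot a))) ⫿ β.δ (C.bot a))) =
    ((α.δ (C.top a) ⫿ D.idH (β.app (C.h.tgt (C.top a)))) ⊟
        (D.idH (α.app (C.h.src (C.top a))) ⫿ β.δ (C.top a))) ⊟
      ((α.sq (C.left a) ⫿ β.sq (C.left a)) ⫿ H.cell a) := by
  rw [← beside_assoc _ (by simp), ← over_assoc _ (by simp),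
    absorb₁ (by simp) (by simp) (by simp) (by simp), α.nat,
    ← absorb₃ (f := β.app (C.v.src (C.right a))) (by simp) (by simp) (by simp) (by simp),
    over_assoc _ (by simp),
    beside_assoc _ (by simp), absorb₂ (by simp) (by simp) (by simp) (by simp), β.nat,
    ← absorb₄ (f := α.app (C.v.src (C.left a))) (by simp) (by simp) (by simp) (by simp),
    ← over_assoc _ (by simp), tgt_of_top, src_of_top,
    ← beside_assoc _ (by simp)]

/-- The composite of horizontal pseudonatural transformations `F ⟶ G ⟶ H` (the middle functors
are only required to be equal). -/
noncomputable def HTrans.comp (α : HTrans F G) (β : HTrans G' H) (e : G = G') : HTrans F H where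
  app A := α.app A ≫ₕ β.app A
  sq x := α.sq x ⫿ β.sq x
  δ f := (α.δ f ⫿ D.idH (β.app (C.h.tgt f))) ⊟ (D.idH (α.app (C.h.src f)) ⫿ β.δ f)
  app_bd A := by subst e; exact (α.app_bd A).seq (β.app_bd A)
  sq_bd x := by subst e; exact (α.sq_bd x).beside (β.sq_bd x)
  δ_bd f := by subst e; constructor <;> simp
  δ_iso f := by
    subst e
    refine VIso.over ((α.δ_iso f).beside_id (α.δ_bd f) (by simp))
      ((β.δ_iso f).id_beside (β.δ_bd f) (by simp)) (by simp)
  δ_seq f g w := by subst e; exact comp_δ_seq α β f g w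
  δ_hid A := by subst e; exact comp_δ_hid α β A
  sq_seq x y w := by
    subst e
    rw [α.sq_seq x y w, β.sq_seq x y w, interchange'] <;> simp [w]
  sq_vid A := by subst e; rw [α.sq_vid, β.sq_vid, idH_seq (by simp)]
  nat a := by subst e; exact comp_nat α β a

/-- The identity horizontal transformation. -/
noncomputable def HTrans.idt (F : PsFunctor C D) : HTrans F F where
  app A := D.hid (F.obj A)
  sq x := D.idV (F.ver x)
  δ f := D.idH (F.hor f)
  app_bd A := HBd.id _
  sq_bd x := by constructor <;> simp
  δ_bd f := by constructor <;> simp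
  δ_iso f := VIso.idH _
  δ_seq f g w := by
    simp only [idH_hid]
    rw [beside_idV, over_idH, idV_beside (by simp), merge₁ (by simp [w]), over_idH,
      idH_over (by simp)]
  δ_hid A := by
    simp only [idH_hid]
    rw [beside_idV, over_idH, idV_beside (by simp)]
  sq_seq x y w := by rw [F.ver_seq x y w, idV_seq (by simp [w])]
  sq_vid A := by rw [F.ver_id, idH_hid]
  nat a := by rw [beside_idV, over_idH, idH_over (by simp), idV_beside (by simp)]

/-- A family of vertically invertible globular 2-cells from the 1h-cells `p A : F A ⟶ G A` to the
1h-cells `q A : F A ⟶ G A`. -/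
structure GlobIso (F G : PsFunctor C D) (p q : C.Obj → D.Hor) where
  hom : C.Obj → D.Cell
  inv : C.Obj → D.Cell
  hom_bd : ∀ A, D.Bd (hom A) (p A) (q A) (D.vid (F.obj A)) (D.vid (G.obj A))
  inv_bd : ∀ A, D.Bd (inv A) (q A) (p A) (D.vid (F.obj A)) (D.vid (G.obj A))
  hom_inv : ∀ A, hom A ⊟ inv A = D.idH (p A)
  inv_hom : ∀ A, inv A ⊟ hom A = D.idH (q A)

namespace GlobIso
variable {p q : C.Obj → D.Hor} (θ : GlobIso F G p q)
@[simp] theorem top_hom (A) : D.top (θ.hom A) = p A := (θ.hom_bd A).top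
@[simp] theorem bot_hom (A) : D.bot (θ.hom A) = q A := (θ.hom_bd A).bot
@[simp] theorem left_hom (A) : D.left (θ.hom A) = D.vid (F.obj A) := (θ.hom_bd A).left
@[simp] theorem right_hom (A) : D.right (θ.hom A) = D.vid (G.obj A) := (θ.hom_bd A).right
@[simp] theorem top_inv (A) : D.top (θ.inv A) = q A := (θ.inv_bd A).top
@[simp] theorem bot_inv (A) : D.bot (θ.inv A) = p A := (θ.inv_bd A).bot
@[simp] theorem left_inv (A) : D.left (θ.inv A) = D.vid (F.obj A) := (θ.inv_bd A).left
@[simp] theorem right_inv (A) : D.right (θ.inv A) = D.vid (G.obj A) := (θ.inv_bd A).right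
theorem src_p (θ : GlobIso F G p q) (A) : D.h.src (p A) = F.obj A := by rw [← θ.top_hom, src_of_top, θ.left_hom, src_vid]
theorem tgt_p (θ : GlobIso F G p q) (A) : D.h.tgt (p A) = G.obj A := by rw [← θ.top_hom, tgt_of_top, θ.right_hom, src_vid]
theorem iso_hom (A) : D.VIso (θ.hom A) :=
  ⟨θ.inv A, ArrCat.IsInverse.mk_cmp _ ((θ.bot_hom A).trans (θ.top_inv A).symm)
    ((θ.bot_inv A).trans (θ.top_hom A).symm)
    ((θ.hom_inv A).trans (congrArg D.idH (θ.top_hom A).symm))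
    ((θ.inv_hom A).trans (congrArg D.idH (θ.top_inv A).symm))⟩
theorem iso_inv (A) : D.VIso (θ.inv A) :=
  ⟨θ.hom A, ArrCat.IsInverse.mk_cmp _ ((θ.bot_inv A).trans (θ.top_hom A).symm)
    ((θ.bot_hom A).trans (θ.top_inv A).symm)
    ((θ.inv_hom A).trans (congrArg D.idH (θ.top_inv A).symm))
    ((θ.hom_inv A).trans (congrArg D.idH (θ.top_hom A).symm))⟩
end GlobIso

theorem conj_δ_seq (α : HTrans F G) {p : C.Obj → D.Hor} (θ : GlobIso F G p α.app)
    (f g : C.Hor) (w : C.h.tgt f = C.h.src g) :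
    (F.cmpr f g w ⫿ D.idH (p (C.h.tgt g))) ⊟ ((D.idH (F.hor (f ≫ₕ g)) ⫿ θ.hom (C.h.tgt (f ≫ₕ g))) ⊟
      α.δ (f ≫ₕ g) ⊟ (θ.inv (C.h.src (f ≫ₕ g)) ⫿ D.idH (G.hor (f ≫ₕ g)))) =
    (D.idH (F.hor f) ⫿ ((D.idH (F.hor g) ⫿ θ.hom (C.h.tgt g)) ⊟
      α.δ g ⊟ (θ.inv (C.h.src g) ⫿ D.idH (G.hor g)))) ⊟
    (((D.idH (F.hor f) ⫿ θ.hom (C.h.tgt f)) ⊟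
      α.δ f ⊟ (θ.inv (C.h.src f) ⫿ D.idH (G.hor f))) ⫿ D.idH (G.hor g)) ⊟
    (D.idH (p (C.h.src f)) ⫿ G.cmpr f g w) := by
  have q1 := θ.src_p
  have q2 := θ.tgt_p
  have s1 := slide (D := D) (a := F.cmpr f g w) (b := θ.hom (C.h.tgt g)) (f := F.hor (f ≫ₕ g))
    (g := p (C.h.tgt g)) (f' := F.hor f ≫ₕ F.hor g) (g' := α.app (C.h.tgt g))
    (by simp [*]) (by simp [*]) (by simp [*]) (by simp [*]) (by simp [*]) (by simp [*])
    (by simp [*]) (by simp [*]) (by simp [*])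
  have s2 := slide (D := D) (a := θ.inv (C.h.src f)) (b := G.cmpr f g w) (f := p (C.h.src f))
    (g := G.hor f ≫ₕ G.hor g) (f' := α.app (C.h.src f)) (g' := G.hor (f ≫ₕ g))
    (by simp [*]) (by simp [*]) (by simp [*]) (by simp [*]) (by simp [*]) (by simp [*])
    (by simp [*]) (by simp [*]) (by simp [*])
  have ha := α.δ_seq f g w
  have he : D.idH (F.hor f) ⫿ (θ.inv (C.h.src g) ⫿ D.idH (G.hor g)) ⊟
      D.idH (F.hor f) ⫿ (θ.hom (C.h.src g) ⫿ D.idH (G.hor g)) =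
      D.idH (F.hor f ≫ₕ (α.app (C.h.src g) ≫ₕ G.hor g)) := by
    rw [← id_beside_over (by simp) (by simp [*]) (by simp [*]), ← over_beside_id (by simp) (by simp)
      (by simp), θ.inv_hom, merge₁ (by simp), merge₁ (by simp [*])]
  simp (disch := simp [*]) only [over_assoc, over_beside_id, id_beside_over, merge₁, merge₂,
    merge₃, merge₄, w, src_seqH, tgt_seqH] at s1 s2 he ha ⊢
  rw [reassoc s1 (by simp [*]) (by simp [*]), reassoc ha (by simp [*]) (by simp [*]),
    over_assoc _ (by simp [*]), ← s2, reassoc₁ he (by simp [*]), idH_over (by simp [*])]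

theorem conj_δ_hid (α : HTrans F G) {p : C.Obj → D.Hor} (θ : GlobIso F G p α.app) (A : C.Obj) :
    (F.unit A ⫿ D.idH (p A)) ⊟ ((D.idH (F.hor (C.hid A)) ⫿ θ.hom (C.h.tgt (C.hid A))) ⊟
      α.δ (C.hid A) ⊟ (θ.inv (C.h.src (C.hid A)) ⫿ D.idH (G.hor (C.hid A)))) =
    D.idH (p A) ⫿ G.unit A := by
  have q1 := θ.src_p
  have q2 := θ.tgt_p
  rw [src_hid, tgt_hid, over_assoc _ (by simp), ← over_assoc _ (by simp [*]),
    slide (f' := D.hid (F.obj A)) (g' := α.app A) (by simp [*]) (by simp [*]) (by simp [*]) (by simp [*])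
      (by simp [*]) (by simp [*]) (by simp [*]) (by simp [*]) (by simp [*]),
    over_assoc _ (by simp [*]), ← over_assoc (D := D) (a := F.unit A ⫿ D.idH (α.app A)) _ (by simp [*]), α.δ_hid,
    ← slide (f := p A) (g := D.hid (G.obj A)) (by simp [*]) (by simp [*]) (by simp [*]) (by simp [*])
      (by simp [*]) (by simp [*]) (by simp [*]) (by simp [*]) (by simp [*]),
    idH_hid, idH_hid, beside_idV, idV_beside (by simp), ← over_assoc _ (by simp), θ.hom_inv,
    idH_over (by simp [*])]


theorem conj_nat (α : HTrans F G) {p : C.Obj → D.Hor} (θ : GlobIso F G p α.app) (a : C.Cell) :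
    (F.cell a ⫿ (θ.hom (C.v.src (C.right a)) ⊟ α.sq (C.right a) ⊟ θ.inv (C.v.tgt (C.right a)))) ⊟
      ((D.idH (F.hor (C.bot a)) ⫿ θ.hom (C.h.tgt (C.bot a))) ⊟
        α.δ (C.bot a) ⊟ (θ.inv (C.h.src (C.bot a)) ⫿ D.idH (G.hor (C.bot a)))) =
    ((D.idH (F.hor (C.top a)) ⫿ θ.hom (C.h.tgt (C.top a))) ⊟
        α.δ (C.top a) ⊟ (θ.inv (C.h.src (C.top a)) ⫿ D.idH (G.hor (C.top a)))) ⊟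
    ((θ.hom (C.v.src (C.left a)) ⊟ α.sq (C.left a) ⊟ θ.inv (C.v.tgt (C.left a))) ⫿ G.cell a) := by
  have q1 := θ.src_p
  have q2 := θ.tgt_p
  have e : θ.hom (C.v.src (C.right a)) ⊟ α.sq (C.right a) ⊟ θ.inv (C.v.tgt (C.right a)) ⊟
      θ.hom (C.v.tgt (C.right a)) = θ.hom (C.v.src (C.right a)) ⊟ α.sq (C.right a) := by
    rw [over_assoc _ (by simp), θ.inv_hom, over_idH]
  have e' : θ.inv (C.v.src (C.left a)) ⊟ (θ.hom (C.v.src (C.left a)) ⊟ α.sq (C.left a) ⊟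
      θ.inv (C.v.tgt (C.left a))) = α.sq (C.left a) ⊟ θ.inv (C.v.tgt (C.left a)) := by
    rw [over_assoc _ (by simp), reassoc₁ (θ.inv_hom _) (by simp), idH_over (by simp)]
  rw [tgt_of_bot, src_of_bot, tgt_of_top, src_of_top]
  have h1 : (F.cell a ⫿ (θ.hom (C.v.src (C.right a)) ⊟ α.sq (C.right a) ⊟
      θ.inv (C.v.tgt (C.right a)))) ⊟ (D.idH (F.hor (C.bot a)) ⫿ θ.hom (C.v.tgt (C.right a))) =
      (D.idH (F.hor (C.top a)) ⫿ θ.hom (C.v.src (C.right a))) ⊟ (F.cell a ⫿ α.sq (C.right a)) := by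
    rw [absorb₂ (by simp [*]) (by simp) (by simp) (by simp), e, absorb₄] <;> simp [*]
  have h2 : (α.sq (C.left a) ⫿ G.cell a) ⊟ (θ.inv (C.v.tgt (C.left a)) ⫿ D.idH (G.hor (C.bot a))) =
      (θ.inv (C.v.src (C.left a)) ⫿ D.idH (G.hor (C.top a))) ⊟
      ((θ.hom (C.v.src (C.left a)) ⊟ α.sq (C.left a) ⊟ θ.inv (C.v.tgt (C.left a))) ⫿ G.cell a) := by
    rw [absorb₁ (by simp [*]) (by simp) (by simp) (by simp), ← e', absorb₃] <;> simp [*]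
  simp (disch := simp [q1, q2]) only [over_assoc] at h1 h2 ⊢
  rw [reassoc h1 (by simp [q1, q2]) (by simp [q1, q2]),
    reassoc (α.nat a) (by simp [q1, q2]) (by simp [q1, q2]), h2]

theorem conj_δ_bd (α : HTrans F G) {p : C.Obj → D.Hor} (θ : GlobIso F G p α.app) (f : C.Hor) :
    D.Bd ((D.idH (F.hor f) ⫿ θ.hom (C.h.tgt f)) ⊟ α.δ f ⊟ (θ.inv (C.h.src f) ⫿ D.idH (G.hor f)))
      (F.hor f ≫ₕ p (C.h.tgt f)) (p (C.h.src f) ≫ₕ G.hor f)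
      (D.vid (F.obj (C.h.src f))) (D.vid (G.obj (C.h.tgt f))) := by
  have q1 := θ.src_p
  have q2 := θ.tgt_p
  constructor <;> simp (disch := simp [q1, q2]) [q1, q2]

theorem conj_sq_bd (α : HTrans F G) {p : C.Obj → D.Hor} (θ : GlobIso F G p α.app) (x : C.Ver) :
    D.Bd (θ.hom (C.v.src x) ⊟ α.sq x ⊟ θ.inv (C.v.tgt x)) (p (C.v.src x)) (p (C.v.tgt x))
      (F.ver x) (G.ver x) := by
  refine ⟨?_, ?_, ?_, ?_⟩ <;> simp

/-- Replacing the 1h-cell components of a horizontal pseudonatural transformation by isomorphic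
ones, by conjugation. -/
noncomputable def HTrans.conj (α : HTrans F G) {p : C.Obj → D.Hor} (θ : GlobIso F G p α.app) :
    HTrans F G where
  app := p
  sq x := θ.hom (C.v.src x) ⊟ α.sq x ⊟ θ.inv (C.v.tgt x)
  δ f := (D.idH (F.hor f) ⫿ θ.hom (C.h.tgt f)) ⊟ α.δ f ⊟ (θ.inv (C.h.src f) ⫿ D.idH (G.hor f))
  app_bd A := ⟨θ.src_p A, θ.tgt_p A⟩
  sq_bd x := conj_sq_bd α θ x
  δ_bd f := conj_δ_bd α θ f
  δ_iso f := ((((θ.iso_hom _).id_beside (θ.hom_bd _) (by simp)).over (α.δ_iso f) (by simp)).over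
    ((θ.iso_inv _).beside_id (θ.inv_bd _) (by simp)) (by simp))
  δ_seq f g w := conj_δ_seq α θ f g w
  δ_hid A := conj_δ_hid α θ A
  sq_seq x y w := by
    rw [α.sq_seq x y w, src_seqV, tgt_seqV w, over_assoc _ (by simp), over_assoc _ (by simp [w]),
      over_assoc _ (by simp), over_assoc _ (by simp [w]), over_assoc _ (by simp), w,
      reassoc₁ (θ.inv_hom _) (by simp), idH_over (by simp)]
  sq_vid A := by rw [α.sq_vid, over_idH, src_vid, tgt_vid, θ.hom_inv]
  nat a := conj_nat α θ a

theorem vabsorb₁ {x y a : D.Cell} {u : D.Ver} (w : D.bot x = D.top y) (h : D.right y = u)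
    (h₁ : D.bot a = D.hid (D.v.src u)) (h₂ : D.right x = D.left a) :
    (x ⊟ y) ⫿ (a ⊟ D.idV u) = (x ⫿ a) ⊟ y := absorb₁ (D := D.transpose) w h h₁ h₂
theorem vabsorb₂ {x y b : D.Cell} {u : D.Ver} (w : D.bot x = D.top y) (h : D.right x = u)
    (h₁ : D.top b = D.hid (D.v.tgt u)) (h₂ : D.right y = D.left b) :
    (x ⊟ y) ⫿ (D.idV u ⊟ b) = x ⊟ (y ⫿ b) := absorb₂ (D := D.transpose) w h h₁ h₂
theorem vabsorb₃ {x y a : D.Cell} {u : D.Ver} (w : D.bot x = D.top y) (h : D.left y = u)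
    (h₁ : D.bot a = D.hid (D.v.src u)) (h₂ : D.right a = D.left x) :
    (a ⊟ D.idV u) ⫿ (x ⊟ y) = (a ⫿ x) ⊟ y := absorb₃ (D := D.transpose) w h h₁ h₂
theorem vabsorb₄ {x y b : D.Cell} {u : D.Ver} (w : D.bot x = D.top y) (h : D.left x = u)
    (h₁ : D.top b = D.hid (D.v.tgt u)) (h₂ : D.right b = D.left y) :
    (D.idV u ⊟ b) ⫿ (x ⊟ y) = x ⊟ (b ⫿ y) := absorb₄ (D := D.transpose) w h h₁ h₂

theorem vcomp_nat (α : VTrans F G) (β : VTrans G H) (a : C.Cell) :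
    ((D.idV (α.app (C.v.src (C.left a))) ⊟ β.δ (C.left a)) ⫿
      (α.δ (C.left a) ⊟ D.idV (β.app (C.v.tgt (C.left a))))) ⫿
      (F.cell a ⊟ (α.sq (C.bot a) ⊟ β.sq (C.bot a))) =
    (α.sq (C.top a) ⊟ β.sq (C.top a) ⊟ H.cell a) ⫿
    ((D.idV (α.app (C.v.src (C.right a))) ⊟ β.δ (C.right a)) ⫿
      (α.δ (C.right a) ⊟ D.idV (β.app (C.v.tgt (C.right a))))) := by
  rw [beside_assoc _ (by simp), ← over_assoc _ (by simp),
    vabsorb₃ (by simp) (by simp) (by simp) (by simp), α.nat,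
    ← vabsorb₁ (u := β.app (C.v.tgt (C.right a))) (by simp) (by simp) (by simp) (by simp),
    ← beside_assoc _ (by simp), over_assoc _ (by simp),
    vabsorb₄ (by simp) (by simp) (by simp) (by simp), β.nat,
    ← vabsorb₂ (u := α.app (C.v.src (C.right a))) (by simp) (by simp) (by simp) (by simp),
    beside_assoc _ (by simp), over_assoc _ (by simp)]

theorem vcomp_δ_seq (α : VTrans F G) (β : VTrans G H) (x y : C.Ver) (w : C.v.tgt x = C.v.src y) :
    (D.idV (α.app (C.v.src (x ≫ᵥ y))) ⊟ β.δ (x ≫ᵥ y)) ⫿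
      (α.δ (x ≫ᵥ y) ⊟ D.idV (β.app (C.v.tgt (x ≫ᵥ y)))) =
    (((D.idV (α.app (C.v.src x)) ⊟ β.δ x) ⫿ (α.δ x ⊟ D.idV (β.app (C.v.tgt x)))) ⊟
      D.idV (H.ver y)) ⫿
    (D.idV (F.ver x) ⊟ ((D.idV (α.app (C.v.src y)) ⊟ β.δ y) ⫿
      (α.δ y ⊟ D.idV (β.app (C.v.tgt y))))) := by
  have hs := vslide (D := D) (a := α.δ x) (b := β.δ y) (x := F.ver x ≫ᵥ α.app (C.v.tgt x))
    (y := β.app (C.v.src y) ≫ᵥ H.ver y) (x' := α.app (C.v.src x) ≫ᵥ G.ver x)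
    (y' := G.ver y ≫ᵥ β.app (C.v.tgt y)) (by simp [w]) (by simp) (by simp [w]) (by simp [w])
    (by simp) (by simp) (by simp) (by simp) (by simp)
  rw [src_seqV, tgt_seqV w, α.δ_seq x y w, β.δ_seq x y w]
  simp (disch := simp [w]) only [beside_assoc, beside_over_id, id_over_beside, vmerge₁, vmerge₂,
    vmerge₃, vmerge₄, w] at hs ⊢
  have r : ∀ {a b a' b' : D.Cell} (_ : a ⫿ b = a' ⫿ b') (_ : D.right a = D.left b)
    (_ : D.right a' = D.left b') (c : D.Cell), a ⫿ (b ⫿ c) = a' ⫿ (b' ⫿ c) :=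
    fun h w w' c => reassoc (D := D.transpose) h w w' c
  rw [r hs (by simp [w]) (by simp [w])]

/-- The composite of vertical pseudonatural transformations `F ⟶ G ⟶ H` (the middle functors
are only required to be equal). -/
noncomputable def VTrans.comp (α : VTrans F G) (β : VTrans G' H) (e : G = G') : VTrans F H where
  app A := α.app A ≫ᵥ β.app A
  sq f := α.sq f ⊟ β.sq f
  δ x := (D.idV (α.app (C.v.src x)) ⊟ β.δ x) ⫿ (α.δ x ⊟ D.idV (β.app (C.v.tgt x)))
  app_bd A := by subst e; exact (α.app_bd A).seq (β.app_bd A)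
  sq_bd f := by subst e; exact (α.sq_bd f).over (β.sq_bd f)
  δ_bd x := by subst e; refine ⟨?_, ?_, ?_, ?_⟩ <;> simp
  δ_iso x := by
    subst e
    exact HIso.beside ((β.δ_iso x).id_over (β.δ_bd x) (by simp))
      ((α.δ_iso x).over_id (α.δ_bd x) (by simp)) (by simp)
  sq_seq f g w := by
    subst e
    rw [interchange' (by simp [w]) (by simp [w]) (by simp) (by simp), over_assoc _ (by simp [w]),
      β.sq_seq f g w, ← over_assoc _ (by simp [w]), α.sq_seq f g w, over_assoc _ (by simp [w])]
  sq_hid A := by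
    subst e
    rw [← over_assoc _ (by simp), α.sq_hid, over_assoc _ (by simp), β.sq_hid,
      ← over_assoc _ (by simp), idV_seq (by simp)]
  δ_seq x y w := by subst e; exact vcomp_δ_seq α β x y w
  δ_vid A := by
    subst e
    rw [α.δ_vid, β.δ_vid, src_vid, tgt_vid, ← idV_seq (by simp), beside_idV]
  nat a := by subst e; exact vcomp_nat α β a

/-- The identity vertical transformation. -/
noncomputable def VTrans.idt (F : PsFunctor C D) : VTrans F F where
  app A := D.vid (F.obj A)
  sq f := D.idH (F.hor f)
  δ x := D.idV (F.ver x)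
  app_bd A := VBd.id _
  sq_bd f := by refine ⟨?_, ?_, ?_, ?_⟩ <;> simp
  δ_bd x := by refine ⟨?_, ?_, ?_, ?_⟩ <;> simp
  δ_iso x := HIso.idV _
  sq_seq f g w := by
    rw [over_idH, ← idH_seq (by simp [w]), idH_over (by simp)]
  sq_hid A := by rw [over_idH, ← idH_hid, idH_over (by simp)]
  δ_seq x y w := by
    rw [F.ver_seq x y w, ← idV_seq (by simp [w]), beside_idV]
  δ_vid A := by rw [F.ver_id]
  nat a := by rw [over_idH, idH_over (by simp), beside_idV, idV_beside (by simp)]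
end Trans
end DoubleCat

namespace DoubleCat

section Algebra
variable {D : DoubleCat.{w₁, w₂, w₃, w₄}}

theorem beside_over_split {a b c d : D.Cell} (ac : D.right a = D.left c) (bd : D.right b = D.left d)
    (ab : D.bot a = D.top b) (cd : D.bot c = D.top d) :
    (a ⫿ c) ⊟ (b ⫿ d) = (a ⊟ b) ⫿ (c ⊟ d) := (interchange' ac bd ab cd).symm

variable {C : DoubleCat.{u₁, u₂, u₃, u₄}} {F F' G G' H H' K K' : PsFunctor C D}

theorem HTrans.ext' {α β : HTrans F G} (h₁ : α.app = β.app) (h₂ : α.sq = β.sq) (h₃ : α.δ = β.δ) :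
    α = β := by
  cases α; cases β; cases h₁; cases h₂; cases h₃; rfl

theorem VTrans.ext' {α β : VTrans F G} (h₁ : α.app = β.app) (h₂ : α.sq = β.sq) (h₃ : α.δ = β.δ) :
    α = β := by
  cases α; cases β; cases h₁; cases h₂; cases h₃; rfl

/-- Replacing domain and codomain of a transformation by equal ones. -/
def HTrans.cast (α : HTrans F G) (e : F = F') (e' : G = G') : HTrans F' G' where
  app := α.app
  sq := α.sq
  δ := α.δ
  app_bd := by subst e e'; exact α.app_bd
  sq_bd := by subst e e'; exact α.sq_bd
  δ_bd := by subst e e'; exact α.δ_bd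
  δ_iso := α.δ_iso
  δ_seq := by subst e e'; exact α.δ_seq
  δ_hid := by subst e e'; exact α.δ_hid
  sq_seq := α.sq_seq
  sq_vid := α.sq_vid
  nat := by subst e e'; exact α.nat

/-- Replacing domain and codomain of a transformation by equal ones. -/
def VTrans.cast (α : VTrans F G) (e : F = F') (e' : G = G') : VTrans F' G' where
  app := α.app
  sq := α.sq
  δ := α.δ
  app_bd := by subst e e'; exact α.app_bd
  sq_bd := by subst e e'; exact α.sq_bd
  δ_bd := by subst e e'; exact α.δ_bd
  δ_iso := α.δ_iso
  sq_seq := by subst e e'; exact α.sq_seq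
  sq_hid := by subst e e'; exact α.sq_hid
  δ_seq := by subst e e'; exact α.δ_seq
  δ_vid := α.δ_vid
  nat := by subst e e'; exact α.nat

theorem HTrans.comp_assoc (α : HTrans F G) (β : HTrans G H) (γ : HTrans H K) :
    (α.comp β rfl).comp γ rfl = α.comp (β.comp γ rfl) rfl := by
  apply HTrans.ext'
  · funext A; exact seqH_assoc _ (by simp)
  · funext x; exact beside_assoc _ (by simp)
  · funext f
    change ((α.δ f ⫿ D.idH _ ⊟ D.idH _ ⫿ β.δ f) ⫿ D.idH _) ⊟ (D.idH (α.app _ ≫ₕ β.app _) ⫿ γ.δ f) =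
      (α.δ f ⫿ D.idH (β.app _ ≫ₕ γ.app _)) ⊟ (D.idH _ ⫿ (β.δ f ⫿ D.idH _ ⊟ D.idH _ ⫿ γ.δ f))
    simp (disch := simp) only [over_assoc, over_beside_id, id_beside_over, merge₂, merge₃, merge₄]

theorem HTrans.idt_comp (α : HTrans F G) : (HTrans.idt F).comp α rfl = α := by
  apply HTrans.ext'
  · funext A; exact hid_seq (by simp)
  · funext x; exact idV_beside (by simp)
  · funext f
    change (D.idH (F.hor f) ⫿ D.idH _) ⊟ (D.idH (D.hid _) ⫿ α.δ f) = _
    rw [idH_hid, idV_beside (by simp), merge₁ (by simp), idH_over (by simp)]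

theorem HTrans.comp_idt (α : HTrans F G) : α.comp (HTrans.idt G) rfl = α := by
  apply HTrans.ext'
  · funext A; exact seq_hid _ _
  · funext x; exact beside_idV _ _
  · funext f
    change (α.δ f ⫿ D.idH (D.hid _)) ⊟ (D.idH (α.app _) ⫿ D.idH (G.hor f)) = _
    rw [idH_hid, beside_idV, merge₁ (by simp), over_idH]

theorem VTrans.comp_assoc (α : VTrans F G) (β : VTrans G H) (γ : VTrans H K) :
    (α.comp β rfl).comp γ rfl = α.comp (β.comp γ rfl) rfl := by
  apply VTrans.ext'
  · funext A; exact seqV_assoc _ (by simp)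
  · funext x; exact over_assoc _ (by simp)
  · funext x
    change (D.idV (α.app _ ≫ᵥ β.app _) ⊟ γ.δ x) ⫿
        (((D.idV (α.app _) ⊟ β.δ x) ⫿ (α.δ x ⊟ D.idV (β.app _))) ⊟ D.idV _) =
      (D.idV (α.app _) ⊟ ((D.idV (β.app _) ⊟ γ.δ x) ⫿ (β.δ x ⊟ D.idV (γ.app _)))) ⫿
        (α.δ x ⊟ D.idV (β.app _ ≫ᵥ γ.app _))
    simp (disch := simp) only [beside_assoc, beside_over_id, id_over_beside, vmerge₂, vmerge₃,
      vmerge₄]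

theorem VTrans.idt_comp (α : VTrans F G) : (VTrans.idt F).comp α rfl = α := by
  apply VTrans.ext'
  · funext A; exact vid_seq (by simp)
  · funext x; exact idH_over (by simp)
  · funext x
    change (D.idV (D.vid _) ⊟ α.δ x) ⫿ (D.idV (F.ver x) ⊟ D.idV _) = _
    rw [← idH_hid, idH_over (by simp), ← idV_seq (by simp), beside_idV]

theorem VTrans.comp_idt (α : VTrans F G) : α.comp (VTrans.idt G) rfl = α := by
  apply VTrans.ext'
  · funext A; exact seq_vid _ _
  · funext x; exact over_idH _ _
  · funext x
    change (D.idV (α.app _) ⊟ D.idV (G.ver x)) ⫿ (α.δ x ⊟ D.idV (D.vid _)) = _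
    rw [← idH_hid, over_idH, ← idV_seq (by simp), idV_beside (by simp)]

section Mod
variable {α : HTrans F G} {β : HTrans F' G'} {x : VTrans F F'} {y : VTrans G G'}
variable {θ : C.Obj → D.Cell}

theorem IsModification.comp {α' : HTrans G H} {β' : HTrans G' H'} {z : VTrans H H'}
    {θ' : C.Obj → D.Cell}
    (m : IsModification α β x y θ) (m' : IsModification α' β' y z θ') :
    IsModification (α.comp α' rfl) (β.comp β' rfl) x z (fun A => θ A ⫿ θ' A) := by
  have t := fun A => (m.bd A).top
  have b := fun A => (m.bd A).bot
  have l := fun A => (m.bd A).left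
  have r := fun A => (m.bd A).right
  have t' := fun A => (m'.bd A).top
  have b' := fun A => (m'.bd A).bot
  have l' := fun A => (m'.bd A).left
  have r' := fun A => (m'.bd A).right
  refine ⟨rfl, rfl, rfl, rfl, fun A => (m.bd A).beside (m'.bd A), fun f => ?_, fun v => ?_⟩
  · change (x.sq f ⫿ (θ _ ⫿ θ' _)) ⊟ ((β.δ f ⫿ D.idH _) ⊟ (D.idH _ ⫿ β'.δ f)) =
      ((α.δ f ⫿ D.idH _) ⊟ (D.idH _ ⫿ α'.δ f)) ⊟ ((θ _ ⫿ θ' _) ⫿ z.sq f)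
    rw [← beside_assoc _ (by simp [*]), ← over_assoc _ (by simp [*]),
      absorb₁ (by simp [*]) (by simp [*]) (by simp [*]) (by simp [*]), m.hor,
      ← absorb₃ (f := α'.app (C.h.tgt f)) (by simp [*]) (by simp [*]) (by simp [*]) (by simp [*]),
      over_assoc _ (by simp [*]), beside_assoc _ (by simp [*]),
      absorb₂ (by simp [*]) (by simp [*]) (by simp [*]) (by simp [*]), m'.hor,
      ← absorb₄ (f := α.app (C.h.src f)) (by simp [*]) (by simp [*]) (by simp [*]) (by simp [*]),
      ← over_assoc _ (by simp [*]), ← beside_assoc _ (by simp [*])]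
  · change x.δ v ⫿ ((α.sq v ⫿ α'.sq v) ⊟ (θ _ ⫿ θ' _)) = ((θ _ ⫿ θ' _) ⊟ (β.sq v ⫿ β'.sq v)) ⫿ z.δ v
    rw [beside_over_split (by simp) (by simp [*]) (by simp [*]) (by simp [*]),
      ← beside_assoc _ (by simp [*]), m.ver, beside_assoc _ (by simp [*]), m'.ver,
      ← beside_assoc _ (by simp [*]),
      beside_over_split (by simp [*]) (by simp [*]) (by simp [*]) (by simp [*])]

theorem IsModification.over {F'' G'' : PsFunctor C D} {γ : HTrans F'' G''} {x' : VTrans F' F''}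
    {y' : VTrans G' G''} {θ' : C.Obj → D.Cell}
    (m : IsModification α β x y θ) (m' : IsModification β γ x' y' θ') :
    IsModification α γ (x.comp x' rfl) (y.comp y' rfl) (fun A => θ A ⊟ θ' A) := by
  have t := fun A => (m.bd A).top
  have b := fun A => (m.bd A).bot
  have l := fun A => (m.bd A).left
  have r := fun A => (m.bd A).right
  have t' := fun A => (m'.bd A).top
  have b' := fun A => (m'.bd A).bot
  have l' := fun A => (m'.bd A).left
  have r' := fun A => (m'.bd A).right
  refine ⟨rfl, rfl, rfl, rfl, fun A => (m.bd A).over (m'.bd A), fun f => ?_, fun v => ?_⟩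
  · change ((x.sq f ⊟ x'.sq f) ⫿ (θ _ ⊟ θ' _)) ⊟ γ.δ f = α.δ f ⊟ ((θ _ ⊟ θ' _) ⫿ (y.sq f ⊟ y'.sq f))
    rw [interchange' (by simp [*]) (by simp [*]) (by simp [*]) (by simp [*]),
      over_assoc _ (by simp [*]), m'.hor, ← over_assoc _ (by simp [*]), m.hor,
      over_assoc _ (by simp [*]),
      ← interchange' (by simp [*]) (by simp [*]) (by simp [*]) (by simp [*])]
  · change ((D.idV _ ⊟ x'.δ v) ⫿ (x.δ v ⊟ D.idV _)) ⫿ (α.sq v ⊟ (θ _ ⊟ θ' _)) =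
      ((θ _ ⊟ θ' _) ⊟ γ.sq v) ⫿ ((D.idV _ ⊟ y'.δ v) ⫿ (y.δ v ⊟ D.idV _))
    rw [beside_assoc _ (by simp [*]), ← over_assoc _ (by simp [*]),
      vabsorb₃ (by simp [*]) (by simp [*]) (by simp [*]) (by simp [*]), m.ver,
      ← vabsorb₁ (u := y'.app (C.v.tgt v)) (by simp [*]) (by simp [*]) (by simp [*]) (by simp [*]),
      ← beside_assoc _ (by simp [*]), over_assoc _ (by simp [*]),
      vabsorb₄ (by simp [*]) (by simp [*]) (by simp [*]) (by simp [*]), m'.ver,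
      ← vabsorb₂ (u := y.app (C.v.src v)) (by simp [*]) (by simp [*]) (by simp [*]) (by simp [*]),
      beside_assoc _ (by simp [*]), over_assoc _ (by simp [*])]

theorem IsModification.idH (α : HTrans F G) :
    IsModification α α (VTrans.idt F) (VTrans.idt G) (fun A => D.idH (α.app A)) := by
  refine ⟨rfl, rfl, rfl, rfl, fun A => Bd.idH (α.app_bd A), fun f => ?_, fun v => ?_⟩
  · change (D.idH _ ⫿ D.idH _) ⊟ α.δ f = α.δ f ⊟ (D.idH _ ⫿ D.idH _)
    rw [merge₁ (by simp), merge₁ (by simp), over_idH, idH_over (by simp)]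
  · change D.idV _ ⫿ (α.sq v ⊟ _) = (_ ⊟ α.sq v) ⫿ D.idV _
    rw [over_idH, idH_over (by simp), beside_idV, idV_beside (by simp)]

theorem IsModification.idV (x : VTrans F F') :
    IsModification (HTrans.idt F) (HTrans.idt F') x x (fun A => D.idV (x.app A)) := by
  refine ⟨rfl, rfl, rfl, rfl, fun A => Bd.idV (x.app_bd A), fun f => ?_, fun v => ?_⟩
  · change (x.sq f ⫿ D.idV _) ⊟ D.idH _ = D.idH _ ⊟ (D.idV _ ⫿ x.sq f)
    rw [beside_idV, over_idH, idV_beside (by simp), idH_over (by simp)]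
  · change x.δ v ⫿ (D.idV _ ⊟ D.idV _) = (D.idV _ ⊟ D.idV _) ⫿ x.δ v
    rw [← idV_seq (by simp), ← idV_seq (by simp), beside_idV, idV_beside (by simp)]

theorem IsModification.conj_hom (α : HTrans F G) {p : C.Obj → D.Hor} (θ : GlobIso F G p α.app) :
    IsModification (α.conj θ) α (VTrans.idt F) (VTrans.idt G) θ.hom := by
  have q1 := θ.src_p
  have q2 := θ.tgt_p
  refine ⟨rfl, rfl, rfl, rfl, θ.hom_bd, fun f => ?_, fun v => ?_⟩
  · change (D.idH _ ⫿ θ.hom _) ⊟ α.δ f = ((D.idH (F.hor f) ⫿ θ.hom (C.h.tgt f)) ⊟ α.δ f ⊟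
      (θ.inv (C.h.src f) ⫿ D.idH (G.hor f))) ⊟ (θ.hom _ ⫿ D.idH _)
    rw [over_assoc (D := D) (b := θ.inv (C.h.src f) ⫿ D.idH (G.hor f)) _ (by simp (disch := simp [*])),
      ← over_beside_id (by simp) (by simp) (by simp), θ.inv_hom, merge₁ (by simp), over_idH]
  · change D.idV _ ⫿ ((θ.hom _ ⊟ α.sq v ⊟ θ.inv _) ⊟ θ.hom _) = (θ.hom _ ⊟ α.sq v) ⫿ D.idV _
    rw [over_assoc (D := D) (b := θ.inv _) _ (by simp), θ.inv_hom, over_idH, beside_idV,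
      idV_beside (by simp)]

theorem IsModification.conj_inv (α : HTrans F G) {p : C.Obj → D.Hor} (θ : GlobIso F G p α.app) :
    IsModification α (α.conj θ) (VTrans.idt F) (VTrans.idt G) θ.inv := by
  have q1 := θ.src_p
  have q2 := θ.tgt_p
  refine ⟨rfl, rfl, rfl, rfl, θ.inv_bd, fun f => ?_, fun v => ?_⟩
  · change (D.idH _ ⫿ θ.inv _) ⊟ ((D.idH (F.hor f) ⫿ θ.hom (C.h.tgt f)) ⊟ α.δ f ⊟
      (θ.inv (C.h.src f) ⫿ D.idH (G.hor f))) = α.δ f ⊟ (θ.inv _ ⫿ D.idH _)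
    rw [← over_assoc (D := D) _ (by simp [*]), ← over_assoc (D := D) _ (by simp [*]),
      ← id_beside_over (by simp) (by simp) (by simp), θ.inv_hom, merge₁ (by simp), idH_over (by simp)]
  · change D.idV _ ⫿ (α.sq v ⊟ θ.inv _) = (θ.inv _ ⊟ (θ.hom _ ⊟ α.sq v ⊟ θ.inv _)) ⫿ D.idV _
    rw [over_assoc (D := D) (b := α.sq v) _ (by simp), reassoc₁ (θ.inv_hom _) (by simp),
      idH_over (by simp), beside_idV, idV_beside (by simp)]

theorem over_cancel {a b c : D.Cell} (i : D.VIso a) (w : D.bot a = D.top b) (w' : D.bot a = D.top c)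
    (h : a ⊟ b = a ⊟ c) : b = c := by
  have h2 : vinv a ⊟ (a ⊟ b) = vinv a ⊟ (a ⊟ c) := congrArg (fun t => vinv a ⊟ t) h
  rw [← over_assoc _ (bot_vinv i), ← over_assoc _ (bot_vinv i), vinv_over rfl i, idH_over w.symm,
    idH_over w'.symm] at h2
  exact h2

theorem IsModification.unique {β' : HTrans F G} {β : HTrans F G}
    (m : IsModification α β (VTrans.idt F) (VTrans.idt G) θ)
    (m' : IsModification α β' (VTrans.idt F) (VTrans.idt G) θ) (i : ∀ A, D.VIso (θ A)) :
    β = β' := by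
  have t := fun A => (m.bd A).top
  have b : ∀ A, D.bot (θ A) = β.app A := fun A => (m.bd A).bot
  have l : ∀ A, D.left (θ A) = D.vid (F.obj A) := fun A => (m.bd A).left
  have r : ∀ A, D.right (θ A) = D.vid (G.obj A) := fun A => (m.bd A).right
  have e : ∀ A, β.app A = β'.app A := fun A => (m.bd A).bot.symm.trans (m'.bd A).bot
  apply HTrans.ext'
  · funext A; exact e A
  · funext v
    have h1 := m.ver v
    have h2 := m'.ver v
    simp only [VTrans.idt] at h1 h2
    rw [beside_idV] at h1 h2
    exact over_cancel (i _) (by simp [b]) (by simp [b, e]) (h1.symm.trans h2)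
  · funext f
    refine over_cancel (a := (VTrans.idt F).sq f ⫿ θ (C.h.tgt f)) ?_ ?_ ?_
      ((m.hor f).trans (m'.hor f).symm)
    · exact (i _).id_beside (m.bd _) (by simp)
    · rw [bot_beside] <;> simp [*] <;> rfl
    · rw [bot_beside] <;> simp [*] <;> rfl

end Mod
end Algebra
end DoubleCat

namespace DoubleCat

/-- Two families of pseudodouble functors, `(-,X) : B → C` for the objects `X` of `A` and
`(Y,-) : A → C` for the objects `Y` of `B`, that agree on objects: `(-,X)` at `Y` is `(Y,-)` at
`X`. -/
structure Families (A : DoubleCat.{u₁, u₂, u₃, u₄}) (B : DoubleCat.{w₁, w₂, w₃, w₄})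
    (C : DoubleCat.{t₁, t₂, t₃, t₄}) where
  /-- `(-,X)`, also written `X ⋉ -`. -/
  ltimes : A.Obj → PsFunctor B C
  /-- `(Y,-)`, also written `- ⋊ Y`. -/
  rtimes : B.Obj → PsFunctor A C
  obj_eq : ∀ X Y, (ltimes X).obj Y = (rtimes Y).obj X

/-- A binoidal structure on a double category `B`: pseudodouble functors `X ⋉ -` and `- ⋊ Y` from
`B` to `B` for all objects `X`, `Y`, such that `X ⋉ Y = X ⋊ Y`. -/
abbrev Binoidal (B : DoubleCat.{u₁, u₂, u₃, u₄}) := Families B B B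

/-- Exchanging the roles of the two families. -/
def Families.swap {A : DoubleCat.{u₁, u₂, u₃, u₄}} {B : DoubleCat.{w₁, w₂, w₃, w₄}}
    {C : DoubleCat.{t₁, t₂, t₃, t₄}} (T : Families A B C) : Families B A C :=
  ⟨T.rtimes, T.ltimes, fun X Y => (T.obj_eq Y X).symm⟩

section Center
variable {B : DoubleCat.{u₁, u₂, u₃, u₄}}

/-- The 1h-cell `f` is left central via a horizontal pseudonatural transformation
`f ⋉ - : (src f) ⋉ - ⟶ (tgt f) ⋉ -`, whose component at `X` is `f ⋊ X`. -/
structure LeftCentralH (b : Binoidal B) (f : B.Hor) extends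
    HTrans (b.ltimes (B.h.src f)) (b.ltimes (B.h.tgt f)) where
  app_eq : ∀ X, app X = (b.rtimes X).hor f

/-- The 1v-cell `v` is left central via a vertical pseudonatural transformation
`v ⋉ - : (src v) ⋉ - ⟶ (tgt v) ⋉ -`, whose component at `X` is `v ⋊ X`. -/
structure LeftCentralV (b : Binoidal B) (v : B.Ver) extends
    VTrans (b.ltimes (B.v.src v)) (b.ltimes (B.v.tgt v)) where
  app_eq : ∀ X, app X = (b.rtimes X).ver v

/-- The 1h-cell `f` is right central via a horizontal pseudonatural transformation
`- ⋊ f : - ⋊ (src f) ⟶ - ⋊ (tgt f)`, whose component at `X` is `X ⋉ f`. -/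
abbrev RightCentralH (b : Binoidal B) (f : B.Hor) := LeftCentralH b.swap f

/-- The 1v-cell `v` is right central via a vertical pseudonatural transformation
`- ⋊ v : - ⋊ (src v) ⟶ - ⋊ (tgt v)`, whose component at `X` is `X ⋉ v`. -/
abbrev RightCentralV (b : Binoidal B) (v : B.Ver) := LeftCentralV b.swap v

/-- A 1h-cell of the left center: a 1h-cell with the structure of a left central 1h-cell. -/
abbrev CenterH (b : Binoidal B) := Σ f : B.Hor, LeftCentralH b f

/-- A 1v-cell of the left center: a 1v-cell with the structure of a left central 1v-cell. -/
abbrev CenterV (b : Binoidal B) := Σ v : B.Ver, LeftCentralV b v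

/-- A 2-cell of the left center: a 2-cell `ζ` whose boundary has been given the structure of left
central cells, such that `ζ ⋉ -`, with components `ζ ⋊ X`, is a modification. -/
structure CenterCell (b : Binoidal B) where
  top : CenterH b
  bot : CenterH b
  left : CenterV b
  right : CenterV b
  cell : B.Cell
  bd : B.Bd cell top.1 bot.1 left.1 right.1
  isMod : IsModification top.2.toHTrans bot.2.toHTrans left.2.toVTrans right.2.toVTrans
    (fun X => (b.rtimes X).cell cell)

variable {b : Binoidal B}

theorem CenterH.ext {f g : CenterH b} (h₁ : f.1 = g.1) (h₂ : f.2.sq = g.2.sq)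
    (h₃ : f.2.δ = g.2.δ) : f = g := by
  obtain ⟨f, α, hα⟩ := f
  obtain ⟨g, β, hβ⟩ := g
  cases h₁
  have : α = β := HTrans.ext' (by funext X; rw [hα, hβ]) h₂ h₃
  subst this; rfl

theorem CenterV.ext {f g : CenterV b} (h₁ : f.1 = g.1) (h₂ : f.2.sq = g.2.sq)
    (h₃ : f.2.δ = g.2.δ) : f = g := by
  obtain ⟨f, α, hα⟩ := f
  obtain ⟨g, β, hβ⟩ := g
  cases h₁
  have : α = β := VTrans.ext' (by funext X; rw [hα, hβ]) h₂ h₃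
  subst this; rfl

theorem CenterCell.ext' {x y : CenterCell b} (h₁ : x.top = y.top) (h₂ : x.bot = y.bot)
    (h₃ : x.left = y.left) (h₄ : x.right = y.right) (h₅ : x.cell = y.cell) : x = y := by
  cases x; cases y; cases h₁; cases h₂; cases h₃; cases h₄; cases h₅; rfl

/-- The inverse compositors of the functors `- ⋊ X`. -/
noncomputable def cmprIso (b : Binoidal B) (f g : B.Hor) (w : B.h.tgt f = B.h.src g) :
    GlobIso (b.ltimes (B.h.src f)) (b.ltimes (B.h.tgt g)) (fun X => (b.rtimes X).hor (f ≫ₕ g))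
      (fun X => (b.rtimes X).hor f ≫ₕ (b.rtimes X).hor g) where
  hom X := vinv ((b.rtimes X).cmpr f g w)
  inv X := (b.rtimes X).cmpr f g w
  hom_bd X := by
    rw [b.obj_eq, b.obj_eq]
    exact ((b.rtimes X).cmpr_bd f g w).vinv ((b.rtimes X).cmpr_iso f g w)
  inv_bd X := by rw [b.obj_eq, b.obj_eq]; exact (b.rtimes X).cmpr_bd f g w
  hom_inv X := vinv_over ((b.rtimes X).cmpr_bd f g w).bot ((b.rtimes X).cmpr_iso f g w)
  inv_hom X := over_vinv ((b.rtimes X).cmpr_bd f g w).top ((b.rtimes X).cmpr_iso f g w)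

/-- The inverse unitors of the functors `- ⋊ X`. -/
noncomputable def unitIso (b : Binoidal B) (A : B.Obj) :
    GlobIso (b.ltimes A) (b.ltimes A) (fun X => (b.rtimes X).hor (B.hid A))
      (HTrans.idt (b.ltimes A)).app where
  hom X := vinv ((b.rtimes X).unit A)
  inv X := (b.rtimes X).unit A
  hom_bd X := by
    simp only [HTrans.idt]
    rw [b.obj_eq]; exact ((b.rtimes X).unit_bd A).vinv ((b.rtimes X).unit_iso A)
  inv_bd X := by simp only [HTrans.idt]; rw [b.obj_eq]; exact (b.rtimes X).unit_bd A
  hom_inv X := vinv_over ((b.rtimes X).unit_bd A).bot ((b.rtimes X).unit_iso A)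
  inv_hom X := by
    simp only [HTrans.idt]
    rw [b.obj_eq]; exact over_vinv ((b.rtimes X).unit_bd A).top ((b.rtimes X).unit_iso A)

/-- Transport of a family of invertible cells along equalities. -/
def GlobIso.congr {C : DoubleCat.{u₁, u₂, u₃, u₄}} {D : DoubleCat.{w₁, w₂, w₃, w₄}}
    {F F' G G' : PsFunctor C D} {p q q' : C.Obj → D.Hor} (θ : GlobIso F G p q) (e₁ : F = F')
    (e₂ : G = G') (e : q = q') : GlobIso F' G' p q' where
  hom := θ.hom
  inv := θ.inv
  hom_bd := by subst e₁ e₂ e; exact θ.hom_bd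
  inv_bd := by subst e₁ e₂ e; exact θ.inv_bd
  hom_inv := θ.hom_inv
  inv_hom := by subst e; exact θ.inv_hom

theorem CenterH.comp_app (f g : CenterH b) (w : B.h.tgt f.1 = B.h.src g.1) :
    (fun X => (b.rtimes X).hor f.1 ≫ₕ (b.rtimes X).hor g.1) =
      (f.2.toHTrans.comp g.2.toHTrans (congrArg b.ltimes w)).app := by
  funext X; rw [← f.2.app_eq, ← g.2.app_eq]; rfl

/-- The composite `f ⋉ -` and `g ⋉ -` conjugated by the compositors of the functors `- ⋊ X`. -/
noncomputable def CenterH.compTrans (f g : CenterH b) (w : B.h.tgt f.1 = B.h.src g.1) :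
    HTrans (b.ltimes (B.h.src f.1)) (b.ltimes (B.h.tgt g.1)) :=
  (f.2.toHTrans.comp g.2.toHTrans (congrArg b.ltimes w)).conj
    ((cmprIso b f.1 g.1 w).congr rfl rfl (f.comp_app g w))

/-- Composition of 1h-cells in the left center. -/
noncomputable def CenterH.comp (f g : CenterH b) (w : B.h.tgt f.1 = B.h.src g.1) : CenterH b :=
  ⟨f.1 ≫ₕ g.1, (f.compTrans g w).cast (congrArg b.ltimes (src_seqH _ _).symm)
    (congrArg b.ltimes (tgt_seqH w).symm), fun _ => rfl⟩

/-- The identity of `A` conjugated by the unitors of the functors `- ⋊ X`. -/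
noncomputable def CenterH.idTrans (b : Binoidal B) (A : B.Obj) :
    HTrans (b.ltimes A) (b.ltimes A) :=
  (HTrans.idt (b.ltimes A)).conj (unitIso b A)

/-- Identity 1h-cells in the left center. -/
noncomputable def CenterH.id (b : Binoidal B) (A : B.Obj) : CenterH b :=
  ⟨B.hid A, (CenterH.idTrans b A).cast (congrArg b.ltimes (src_hid _).symm)
    (congrArg b.ltimes (tgt_hid _).symm), fun _ => rfl⟩

/-- Composition of 1v-cells in the left center. -/
noncomputable def CenterV.comp (f g : CenterV b) (w : B.v.tgt f.1 = B.v.src g.1) : CenterV b :=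
  ⟨f.1 ≫ᵥ g.1, (f.2.toVTrans.comp g.2.toVTrans (congrArg b.ltimes w)).cast
    (congrArg b.ltimes (src_seqV _ _).symm) (congrArg b.ltimes (tgt_seqV w).symm), fun X => by
      rw [(b.rtimes X).ver_seq _ _ w, ← f.2.app_eq, ← g.2.app_eq]; rfl⟩

/-- Identity 1v-cells in the left center. -/
noncomputable def CenterV.id (b : Binoidal B) (A : B.Obj) : CenterV b :=
  ⟨B.vid A, (VTrans.idt (b.ltimes A)).cast (congrArg b.ltimes (src_vid _).symm)
    (congrArg b.ltimes (tgt_vid _).symm), fun X => by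
      rw [(b.rtimes X).ver_id, ← b.obj_eq]; rfl⟩

end Center
end DoubleCat

namespace DoubleCat

section ModGen
variable {C : DoubleCat.{u₁, u₂, u₃, u₄}} {D : DoubleCat.{w₁, w₂, w₃, w₄}}
variable {F₁ F₂ G₁ G₂ F₁' F₂' G₁' G₂' H₁ H₁' K₁ K₂ K₁' K₂' : PsFunctor C D}
variable {α : HTrans F₁ G₁} {β : HTrans F₁' G₁'} {x : VTrans F₂ F₂'} {y : VTrans G₂ G₂'}
variable {θ θ' : C.Obj → D.Cell} {p p' : C.Obj → D.Hor}

theorem IsModification.comp' {α' : HTrans H₁ K₁} {β' : HTrans H₁' K₁'} {z : VTrans K₂ K₂'}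
    (m : IsModification α β x y θ) (m' : IsModification α' β' y z θ') (e : G₁ = H₁)
    (e' : G₁' = H₁') :
    IsModification (α.comp α' e) (β.comp β' e') x z (fun A => θ A ⫿ θ' A) := by
  cases m.eq_F; cases m.eq_G; cases m.eq_F'; cases m.eq_G'
  cases m'.eq_G; cases m'.eq_G'; cases e; cases e'
  exact m.comp m'

theorem IsModification.conj (m : IsModification α β x y θ) (θ₁ : GlobIso F₁ G₁ p α.app)
    (θ₂ : GlobIso F₁' G₁' p' β.app) :
    IsModification (α.conj θ₁) (β.conj θ₂) x y (fun A => θ₁.hom A ⊟ θ A ⊟ θ₂.inv A) := by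
  cases m.eq_F; cases m.eq_G; cases m.eq_F'; cases m.eq_G'
  have h := ((IsModification.conj_hom α θ₁).over m).over (IsModification.conj_inv β θ₂)
  rwa [VTrans.idt_comp, VTrans.idt_comp, VTrans.comp_idt, VTrans.comp_idt] at h

theorem IsModification.cast {J₁ J₂ J₁' J₂' L₁ L₂ L₁' L₂' : PsFunctor C D}
    (m : IsModification α β x y θ) (e₁ : F₁ = J₁) (e₂ : F₂ = J₂)
    (e₃ : F₁' = J₁') (e₄ : F₂' = J₂') (e₅ : G₁ = L₁) (e₆ : G₂ = L₂) (e₇ : G₁' = L₁')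
    (e₈ : G₂' = L₂') :
    IsModification (α.cast e₁ e₅) (β.cast e₃ e₇) (x.cast e₂ e₄) (y.cast e₆ e₈) θ := by
  cases e₁; cases e₂; cases e₃; cases e₄; cases e₅; cases e₆; cases e₇; cases e₈
  exact m

theorem IsModification.congr (m : IsModification α β x y θ) (h : ∀ A, θ' A = θ A) :
    IsModification α β x y θ' := by
  obtain rfl : θ' = θ := funext h
  exact m

theorem IsModification.over' {F₁'' F₂'' G₁'' G₂'' : PsFunctor C D} {γ : HTrans F₁'' G₁''}
    {x' : VTrans K₁ F₂''} {y' : VTrans K₁' G₂''}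
    (m : IsModification α β x y θ) (m' : IsModification β γ x' y' θ') (e : F₂' = K₁)
    (e' : G₂' = K₁') :
    IsModification α γ (x.comp x' e) (y.comp y' e') (fun A => θ A ⊟ θ' A) := by
  cases m.eq_F; cases m.eq_G; cases m.eq_F'; cases m.eq_G'
  cases m'.eq_F'; cases m'.eq_G'; cases e; cases e'
  exact m.over m'

end ModGen

section Center
variable {B : DoubleCat.{u₁, u₂, u₃, u₄}} {b : Binoidal B}

/-- Horizontal composition of 2-cells in the left center. -/
noncomputable def CenterCell.beside (x y : CenterCell b) (w : x.right = y.left) : CenterCell b where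
  top := x.top.comp y.top (by
    rw [← x.bd.top, ← y.bd.top, tgt_of_top, src_of_top, x.bd.right, y.bd.left, w])
  bot := x.bot.comp y.bot (by
    rw [← x.bd.bot, ← y.bd.bot, tgt_of_bot, src_of_bot, x.bd.right, y.bd.left, w])
  left := x.left
  right := y.right
  cell := x.cell ⫿ y.cell
  bd := x.bd.beside (y.bd.congr rfl rfl (by rw [w]) rfl)
  isMod := by
    obtain ⟨xt, xb, xl, xr, a, xd, xm⟩ := x
    obtain ⟨yt, yb, yl, yr, c, yd, ym⟩ := y
    cases w
    have wt : B.h.tgt xt.1 = B.h.src yt.1 := by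
      rw [← xd.top, ← yd.top, tgt_of_top, src_of_top, xd.right, yd.left]
    have wb : B.h.tgt xb.1 = B.h.src yb.1 := by
      rw [← xd.bot, ← yd.bot, tgt_of_bot, src_of_bot, xd.right, yd.left]
    have m := (xm.comp' ym (congrArg b.ltimes wt) (congrArg b.ltimes wb)).conj
      ((cmprIso b xt.1 yt.1 wt).congr rfl rfl (xt.comp_app yt wt))
      ((cmprIso b xb.1 yb.1 wb).congr rfl rfl (xb.comp_app yb wb))
    have m' := m.cast (congrArg b.ltimes (src_seqH xt.1 yt.1).symm) rfl
      (congrArg b.ltimes (src_seqH xb.1 yb.1).symm) rfl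
      (congrArg b.ltimes (tgt_seqH wt).symm) rfl (congrArg b.ltimes (tgt_seqH wb).symm) rfl
    refine m'.congr fun X => ?_
    change _ = vinv ((b.rtimes X).cmpr xt.1 yt.1 wt) ⊟ _ ⊟ (b.rtimes X).cmpr xb.1 yb.1 wb
    have h := (b.rtimes X).cmpr_nat a c (xd.right.trans yd.left.symm)
    simp only [xd.top, yd.top, xd.bot, yd.bot] at h
    have wc : B.right a = B.left c := xd.right.trans yd.left.symm
    rw [over_assoc _ (by simp [bot_vinv, (b.rtimes X).cmpr_iso, top_beside, wc, xd.top, yd.top]), h,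
      ← over_assoc _ (by simp [bot_vinv, top_vinv, (b.rtimes X).cmpr_iso]),
      vinv_over rfl ((b.rtimes X).cmpr_iso _ _ _), idH_over (by simp [wc, xd.top, yd.top])]

/-- Vertical composition of 2-cells in the left center. -/
noncomputable def CenterCell.over (x y : CenterCell b) (w : x.bot = y.top) : CenterCell b where
  top := x.top
  bot := y.bot
  left := x.left.comp y.left (by
    rw [← x.bd.left, ← y.bd.left, ← src_of_bot, ← src_of_top, x.bd.bot, y.bd.top, w])
  right := x.right.comp y.right (by
    rw [← x.bd.right, ← y.bd.right, ← tgt_of_bot, ← tgt_of_top, x.bd.bot, y.bd.top, w])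
  cell := x.cell ⊟ y.cell
  bd := x.bd.over (y.bd.congr (by rw [w]) rfl rfl rfl)
  isMod := by
    obtain ⟨xt, xb, xl, xr, a, xd, xm⟩ := x
    obtain ⟨yt, yb, yl, yr, c, yd, ym⟩ := y
    cases w
    have wl : B.v.tgt xl.1 = B.v.src yl.1 := by
      rw [← xd.left, ← yd.left, ← src_of_bot, ← src_of_top, xd.bot, yd.top]
    have wr : B.v.tgt xr.1 = B.v.src yr.1 := by
      rw [← xd.right, ← yd.right, ← tgt_of_bot, ← tgt_of_top, xd.bot, yd.top]
    have m := xm.over' ym (congrArg b.ltimes wl) (congrArg b.ltimes wr)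
    have m' := m.cast rfl (congrArg b.ltimes (src_seqV xl.1 yl.1).symm) rfl
      (congrArg b.ltimes (tgt_seqV wl).symm) rfl (congrArg b.ltimes (src_seqV xr.1 yr.1).symm) rfl
      (congrArg b.ltimes (tgt_seqV wr).symm)
    refine m'.congr fun X => ?_
    exact (b.rtimes X).cell_over a c (xd.bot.trans yd.top.symm)

/-- Vertical identity 2-cells in the left center. -/
noncomputable def CenterCell.idH (f : CenterH b) : CenterCell b where
  top := f
  bot := f
  left := CenterV.id b (B.h.src f.1)
  right := CenterV.id b (B.h.tgt f.1)
  cell := B.idH f.1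
  bd := Bd.idH ⟨rfl, rfl⟩
  isMod := by
    have m := (IsModification.idH f.2.toHTrans).cast rfl (congrArg b.ltimes (src_vid _).symm) rfl
      (congrArg b.ltimes (tgt_vid _).symm) rfl (congrArg b.ltimes (src_vid _).symm) rfl
      (congrArg b.ltimes (tgt_vid _).symm)
    refine m.congr fun X => ?_
    rw [(b.rtimes X).cell_idH, ← f.2.app_eq]

/-- Horizontal identity 2-cells in the left center. -/
noncomputable def CenterCell.idV (x : CenterV b) : CenterCell b where
  top := CenterH.id b (B.v.src x.1)
  bot := CenterH.id b (B.v.tgt x.1)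
  left := x
  right := x
  cell := B.idV x.1
  bd := Bd.idV ⟨rfl, rfl⟩
  isMod := by
    have m := ((IsModification.idV x.2.toVTrans).conj (unitIso b _) (unitIso b _)).cast
      (congrArg b.ltimes (src_hid _).symm) rfl (congrArg b.ltimes (src_hid _).symm) rfl
      (congrArg b.ltimes (tgt_hid _).symm) rfl (congrArg b.ltimes (tgt_hid _).symm) rfl
    refine m.congr fun X => ?_
    change _ = vinv ((b.rtimes X).unit _) ⊟ _ ⊟ (b.rtimes X).unit _
    have i := (b.rtimes X).unit_iso
    rw [x.2.app_eq, over_assoc _ (by simp [bot_vinv, i]), (b.rtimes X).unit_nat,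
      ← over_assoc _ (by simp [bot_vinv, top_vinv, i]), vinv_over rfl (i _), idH_over (by simp)]

end Center
end DoubleCat

namespace DoubleCat

section Laws
variable {C : DoubleCat.{u₁, u₂, u₃, u₄}} {D : DoubleCat.{w₁, w₂, w₃, w₄}}
variable {F G G' H H' K : PsFunctor C D} {p p' q q' : C.Obj → D.Hor}

theorem HTrans.conj_assoc {F₁ H₁ G₁ K₁ : PsFunctor C D} (α : HTrans F G) (β : HTrans G' H)
    (γ : HTrans H' K) (e : G = G') (i : H = H') (j : F = F₁) (k : H = H₁) (l : G' = G₁) (m : K = K₁)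
    (i' : H₁ = H') (e' : G = G₁)
    (θ₁ : GlobIso F H p (α.comp β e).app)
    (θ₂ : GlobIso F₁ K q ((((α.comp β e).conj θ₁).cast j k).comp γ i').app)
    (θ₃ : GlobIso G' K p' (β.comp γ i).app)
    (θ₄ : GlobIso F K₁ q' (α.comp (((β.comp γ i).conj θ₃).cast l m) e').app)
    (h : ∀ A, (θ₁.inv A ⫿ D.idH (γ.app A)) ⊟ θ₂.inv A = (D.idH (α.app A) ⫿ θ₃.inv A) ⊟ θ₄.inv A) :
    (((((α.comp β e).conj θ₁).cast j k).comp γ i').conj θ₂).sq =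
        ((α.comp (((β.comp γ i).conj θ₃).cast l m) e').conj θ₄).sq ∧
      (((((α.comp β e).conj θ₁).cast j k).comp γ i').conj θ₂).δ =
        ((α.comp (((β.comp γ i).conj θ₃).cast l m) e').conj θ₄).δ := by
  cases e; cases i; cases j; cases k; cases l; cases m
  have m₁ := ((IsModification.conj_inv _ θ₁).comp (IsModification.idH γ)).over
    (IsModification.conj_inv _ θ₂)
  have m₂ := ((IsModification.idH α).comp (IsModification.conj_inv _ θ₃)).over
    (IsModification.conj_inv _ θ₄)
  rw [VTrans.idt_comp, VTrans.idt_comp] at m₁ m₂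
  rw [← HTrans.comp_assoc] at m₂
  have key := m₁.unique (m₂.congr h) fun A => by
    refine VIso.over ((θ₁.iso_inv A).beside_id (θ₁.inv_bd A) (by simp)) (θ₂.iso_inv A) ?_
    rw [θ₂.top_inv, bot_beside (by simp), θ₁.bot_inv, bot_idH]
    rfl
  exact ⟨congrArg HTrans.sq key, congrArg HTrans.δ key⟩

theorem HTrans.conj_idt_comp {F₁ F₂ : PsFunctor C D} (α : HTrans F G) (j : F = F₁) (k : F = F₂)
    (i : F₂ = F) (θ₁ : GlobIso F F p (HTrans.idt F).app)
    (θ₂ : GlobIso F₁ G q ((((HTrans.idt F).conj θ₁).cast j k).comp α i).app)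
    (h : ∀ A, (θ₁.inv A ⫿ D.idH (α.app A)) ⊟ θ₂.inv A = D.idH (α.app A)) :
    (((((HTrans.idt F).conj θ₁).cast j k).comp α i).conj θ₂).sq = α.sq ∧
      (((((HTrans.idt F).conj θ₁).cast j k).comp α i).conj θ₂).δ = α.δ := by
  cases j; cases k
  have m₁ := ((IsModification.conj_inv _ θ₁).comp (IsModification.idH α)).over
    (IsModification.conj_inv _ θ₂)
  rw [VTrans.idt_comp, VTrans.idt_comp, HTrans.idt_comp] at m₁
  have key := ((m₁.congr fun A => (h A).symm).unique (IsModification.idH α) fun A => VIso.idH _)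
  exact ⟨congrArg HTrans.sq key, congrArg HTrans.δ key⟩

theorem HTrans.conj_comp_idt {G₁ G₂ : PsFunctor C D} (α : HTrans F G) (j : G = G₁) (k : G = G₂)
    (i : G = G₁) (θ₁ : GlobIso G G p (HTrans.idt G).app)
    (θ₂ : GlobIso F G₂ q (α.comp (((HTrans.idt G).conj θ₁).cast j k) i).app)
    (h : ∀ A, (D.idH (α.app A) ⫿ θ₁.inv A) ⊟ θ₂.inv A = D.idH (α.app A)) :
    ((α.comp (((HTrans.idt G).conj θ₁).cast j k) i).conj θ₂).sq = α.sq ∧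
      ((α.comp (((HTrans.idt G).conj θ₁).cast j k) i).conj θ₂).δ = α.δ := by
  cases j; cases k
  have m₁ := ((IsModification.idH α).comp (IsModification.conj_inv _ θ₁)).over
    (IsModification.conj_inv _ θ₂)
  rw [VTrans.idt_comp, VTrans.idt_comp, HTrans.comp_idt] at m₁
  have key := ((m₁.congr fun A => (h A).symm).unique (IsModification.idH α) fun A => VIso.idH _)
  exact ⟨congrArg HTrans.sq key, congrArg HTrans.δ key⟩

end Laws

section Center
variable {B : DoubleCat.{u₁, u₂, u₃, u₄}} {b : Binoidal B}

theorem CenterH.assoc (f g k : CenterH b) (w₁ : B.h.tgt f.1 = B.h.src g.1)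
    (w₂ : B.h.tgt g.1 = B.h.src k.1) :
    (f.comp g w₁).comp k ((tgt_seqH w₁).trans w₂) =
      f.comp (g.comp k w₂) (w₁.trans (src_seqH _ _).symm) := by
  have w₃ : B.h.tgt (f.1 ≫ₕ g.1) = B.h.src k.1 := (tgt_seqH w₁).trans w₂
  have w₄ : B.h.tgt f.1 = B.h.src (g.1 ≫ₕ k.1) := w₁.trans (src_seqH _ _).symm
  have key := HTrans.conj_assoc f.2.toHTrans g.2.toHTrans k.2.toHTrans (congrArg b.ltimes w₁)
    (congrArg b.ltimes w₂) (congrArg b.ltimes (src_seqH f.1 g.1).symm)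
    (congrArg b.ltimes (tgt_seqH w₁).symm) (congrArg b.ltimes (src_seqH g.1 k.1).symm)
    (congrArg b.ltimes (tgt_seqH w₂).symm) (congrArg b.ltimes w₃) (congrArg b.ltimes w₄)
    ((cmprIso b f.1 g.1 w₁).congr rfl rfl (f.comp_app g w₁))
    ((cmprIso b (f.1 ≫ₕ g.1) k.1 w₃).congr rfl rfl ((f.comp g w₁).comp_app k w₃))
    ((cmprIso b g.1 k.1 w₂).congr rfl rfl (g.comp_app k w₂))
    ((cmprIso b f.1 (g.1 ≫ₕ k.1) w₄).congr rfl rfl (f.comp_app (g.comp k w₂) w₄)) (fun X => by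
        rw [f.2.app_eq, k.2.app_eq]
        exact (b.rtimes X).cmpr_assoc f.1 g.1 k.1 w₁ w₂)
  exact CenterH.ext (seqH_assoc _ w₁) key.1 key.2

theorem CenterH.id_comp (f : CenterH b) :
    (CenterH.id b (B.h.src f.1)).comp f (tgt_hid _) = f := by
  have key := HTrans.conj_idt_comp f.2.toHTrans (congrArg b.ltimes (src_hid _).symm)
    (congrArg b.ltimes (tgt_hid _).symm) (congrArg b.ltimes (tgt_hid _)) (unitIso b (B.h.src f.1))
    ((cmprIso b (B.hid (B.h.src f.1)) f.1 (tgt_hid _)).congr rfl rfl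
      ((CenterH.id b (B.h.src f.1)).comp_app f (tgt_hid _))) (fun X => by
        rw [f.2.app_eq]; exact (b.rtimes X).unit_cmpr f.1)
  exact CenterH.ext (hid_seq rfl) key.1 key.2

theorem CenterH.comp_id (f : CenterH b) :
    f.comp (CenterH.id b (B.h.tgt f.1)) (src_hid _).symm = f := by
  have key := HTrans.conj_comp_idt f.2.toHTrans (congrArg b.ltimes (src_hid _).symm)
    (congrArg b.ltimes (tgt_hid _).symm) (congrArg b.ltimes (src_hid _).symm)
    (unitIso b (B.h.tgt f.1))
    ((cmprIso b f.1 (B.hid (B.h.tgt f.1)) (src_hid _).symm).congr rfl rfl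
      (f.comp_app (CenterH.id b (B.h.tgt f.1)) (src_hid _).symm)) (fun X => by
        rw [f.2.app_eq]; exact (b.rtimes X).cmpr_unit f.1)
  exact CenterH.ext (seq_hid _ _) key.1 key.2

theorem VTrans.comp_assoc' {C : DoubleCat.{u₁, u₂, u₃, u₄}} {D : DoubleCat.{w₁, w₂, w₃, w₄}}
    {F G G' H H' K F₁ H₁ G₁ K₁ : PsFunctor C D} (α : VTrans F G) (β : VTrans G' H) (γ : VTrans H' K)
    (e : G = G') (i : H = H') (j : F = F₁) (k : H = H₁) (l : G' = G₁) (m : K = K₁) (i' : H₁ = H')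
    (e' : G = G₁) :
    (((α.comp β e).cast j k).comp γ i').sq = (α.comp ((β.comp γ i).cast l m) e').sq ∧
      (((α.comp β e).cast j k).comp γ i').δ = (α.comp ((β.comp γ i).cast l m) e').δ := by
  cases e; cases i; cases j; cases k; cases l; cases m
  exact ⟨congrArg VTrans.sq (VTrans.comp_assoc α β γ), congrArg VTrans.δ (VTrans.comp_assoc α β γ)⟩

theorem VTrans.idt_comp' {C : DoubleCat.{u₁, u₂, u₃, u₄}} {D : DoubleCat.{w₁, w₂, w₃, w₄}}
    {F G F₁ F₂ : PsFunctor C D} (α : VTrans F G) (j : F = F₁) (k : F = F₂) (i : F₂ = F) :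
    (((VTrans.idt F).cast j k).comp α i).sq = α.sq ∧
      (((VTrans.idt F).cast j k).comp α i).δ = α.δ := by
  cases j; cases k
  exact ⟨congrArg VTrans.sq (VTrans.idt_comp α), congrArg VTrans.δ (VTrans.idt_comp α)⟩

theorem VTrans.comp_idt' {C : DoubleCat.{u₁, u₂, u₃, u₄}} {D : DoubleCat.{w₁, w₂, w₃, w₄}}
    {F G G₁ G₂ : PsFunctor C D} (α : VTrans F G) (j : G = G₁) (k : G = G₂) (i : G = G₁) :
    (α.comp ((VTrans.idt G).cast j k) i).sq = α.sq ∧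
      (α.comp ((VTrans.idt G).cast j k) i).δ = α.δ := by
  cases j; cases k
  exact ⟨congrArg VTrans.sq (VTrans.comp_idt α), congrArg VTrans.δ (VTrans.comp_idt α)⟩

theorem CenterV.assoc (f g k : CenterV b) (w₁ : B.v.tgt f.1 = B.v.src g.1)
    (w₂ : B.v.tgt g.1 = B.v.src k.1) :
    (f.comp g w₁).comp k ((tgt_seqV w₁).trans w₂) =
      f.comp (g.comp k w₂) (w₁.trans (src_seqV _ _).symm) := by
  have w₃ : B.v.tgt (f.1 ≫ᵥ g.1) = B.v.src k.1 := (tgt_seqV w₁).trans w₂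
  have w₄ : B.v.tgt f.1 = B.v.src (g.1 ≫ᵥ k.1) := w₁.trans (src_seqV _ _).symm
  have key := VTrans.comp_assoc' f.2.toVTrans g.2.toVTrans k.2.toVTrans (congrArg b.ltimes w₁)
    (congrArg b.ltimes w₂) (congrArg b.ltimes (src_seqV f.1 g.1).symm)
    (congrArg b.ltimes (tgt_seqV w₁).symm) (congrArg b.ltimes (src_seqV g.1 k.1).symm)
    (congrArg b.ltimes (tgt_seqV w₂).symm) (congrArg b.ltimes w₃) (congrArg b.ltimes w₄)
  exact CenterV.ext (seqV_assoc _ w₁) key.1 key.2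

theorem CenterV.id_comp (f : CenterV b) :
    (CenterV.id b (B.v.src f.1)).comp f (tgt_vid _) = f :=
  have key := VTrans.idt_comp' f.2.toVTrans (congrArg b.ltimes (src_vid _).symm)
    (congrArg b.ltimes (tgt_vid _).symm) (congrArg b.ltimes (tgt_vid _))
  CenterV.ext (vid_seq rfl) key.1 key.2

theorem CenterV.comp_id (f : CenterV b) :
    f.comp (CenterV.id b (B.v.tgt f.1)) (src_vid _).symm = f :=
  have key := VTrans.comp_idt' f.2.toVTrans (congrArg b.ltimes (src_vid _).symm)
    (congrArg b.ltimes (tgt_vid _).symm) (congrArg b.ltimes (src_vid _).symm)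
  CenterV.ext (seq_vid _ _) key.1 key.2

theorem CenterH.id_comp' (f : CenterH b) {A : B.Obj} (h : A = B.h.src f.1) :
    (CenterH.id b A).comp f ((tgt_hid _).trans h) = f := by
  subst h; exact CenterH.id_comp f

theorem CenterH.comp_id' (f : CenterH b) {A : B.Obj} (h : B.h.tgt f.1 = A) :
    f.comp (CenterH.id b A) (h.trans (src_hid _).symm) = f := by
  subst h; exact CenterH.comp_id f

theorem CenterV.id_comp' (f : CenterV b) {A : B.Obj} (h : A = B.v.src f.1) :
    (CenterV.id b A).comp f ((tgt_vid _).trans h) = f := by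
  subst h; exact CenterV.id_comp f

theorem CenterV.comp_id' (f : CenterV b) {A : B.Obj} (h : B.v.tgt f.1 = A) :
    f.comp (CenterV.id b A) (h.trans (src_vid _).symm) = f := by
  subst h; exact CenterV.comp_id f

theorem CenterCell.src_top (a : CenterCell b) : B.h.src a.top.1 = B.v.src a.left.1 := by
  rw [← a.bd.top, ← a.bd.left]; exact src_of_top _
theorem CenterCell.tgt_top (a : CenterCell b) : B.h.tgt a.top.1 = B.v.src a.right.1 := by
  rw [← a.bd.top, ← a.bd.right]; exact tgt_of_top _
theorem CenterCell.src_bot (a : CenterCell b) : B.h.src a.bot.1 = B.v.tgt a.left.1 := by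
  rw [← a.bd.bot, ← a.bd.left]; exact src_of_bot _
theorem CenterCell.tgt_bot (a : CenterCell b) : B.h.tgt a.bot.1 = B.v.tgt a.right.1 := by
  rw [← a.bd.bot, ← a.bd.right]; exact tgt_of_bot _
theorem CenterCell.fitsL (x y : CenterCell b) (w : x.bot = y.top) :
    B.v.tgt x.left.1 = B.v.src y.left.1 := by rw [← x.src_bot, ← y.src_top, w]
theorem CenterCell.fitsR (x y : CenterCell b) (w : x.bot = y.top) :
    B.v.tgt x.right.1 = B.v.src y.right.1 := by rw [← x.tgt_bot, ← y.tgt_top, w]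
theorem CenterCell.fits (x y : CenterCell b) (w : x.right = y.left) :
    B.right x.cell = B.left y.cell := by rw [x.bd.right, y.bd.left, w]
theorem CenterCell.fits' (x y : CenterCell b) (w : x.bot = y.top) :
    B.bot x.cell = B.top y.cell := by rw [x.bd.bot, y.bd.top, w]

theorem CenterH.vid_hid (b : Binoidal B) (A : B.Obj) :
    CenterCell.idH (CenterH.id b A) = CenterCell.idV (CenterV.id b A) := by
  have hs : B.h.src (CenterH.id b A).1 = A := src_hid A
  have ht : B.h.tgt (CenterH.id b A).1 = A := tgt_hid A
  have vs : B.v.src (CenterV.id b A).1 = A := src_vid A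
  have vt : B.v.tgt (CenterV.id b A).1 = A := tgt_vid A
  refine CenterCell.ext' ?_ ?_ ?_ ?_ (idH_hid A)
  · change CenterH.id b A = CenterH.id b _; rw [vs]
  · change CenterH.id b A = CenterH.id b _; rw [vt]
  · change CenterV.id b _ = CenterV.id b A; rw [hs]
  · change CenterV.id b _ = CenterV.id b A; rw [ht]

/-- The category of 1h-cells of the left center. -/
noncomputable def centerCatH (b : Binoidal B) : ArrCat B.Obj (CenterH b) where
  src f := B.h.src f.1
  tgt f := B.h.tgt f.1
  id := CenterH.id b
  comp := CenterH.comp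
  src_id _ := src_hid _
  tgt_id _ := tgt_hid _
  src_comp _ _ _ := src_seqH _ _
  tgt_comp _ _ w := tgt_seqH w
  id_comp := CenterH.id_comp
  comp_id := CenterH.comp_id
  assoc := CenterH.assoc

/-- The category of 1v-cells of the left center. -/
noncomputable def centerCatV (b : Binoidal B) : ArrCat B.Obj (CenterV b) where
  src f := B.v.src f.1
  tgt f := B.v.tgt f.1
  id := CenterV.id b
  comp := CenterV.comp
  src_id _ := src_vid _
  tgt_id _ := tgt_vid _
  src_comp _ _ _ := src_seqV _ _
  tgt_comp _ _ w := tgt_seqV w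
  id_comp := CenterV.id_comp
  comp_id := CenterV.comp_id
  assoc := CenterV.assoc

/-- The 2-cells of the left center with horizontal composition. -/
noncomputable def centerCatCH (b : Binoidal B) : ArrCat (CenterV b) (CenterCell b) where
  src := CenterCell.left
  tgt := CenterCell.right
  id := CenterCell.idV
  comp := CenterCell.beside
  src_id _ := rfl
  tgt_id _ := rfl
  src_comp _ _ _ := rfl
  tgt_comp _ _ _ := rfl
  id_comp a := CenterCell.ext' (CenterH.id_comp' a.top a.src_top.symm)
    (CenterH.id_comp' a.bot a.src_bot.symm) rfl rfl (idV_beside a.bd.left)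
  comp_id a := CenterCell.ext' (CenterH.comp_id' a.top a.tgt_top)
    (CenterH.comp_id' a.bot a.tgt_bot) rfl rfl (beside_idV _ _)
  assoc x y _ w₁ _ := CenterCell.ext' (CenterH.assoc _ _ _ _ _) (CenterH.assoc _ _ _ _ _) rfl rfl
    (beside_assoc _ (x.fits y w₁))

/-- The 2-cells of the left center with vertical composition. -/
noncomputable def centerCatCV (b : Binoidal B) : ArrCat (CenterH b) (CenterCell b) where
  src := CenterCell.top
  tgt := CenterCell.bot
  id := CenterCell.idH
  comp := CenterCell.over
  src_id _ := rfl
  tgt_id _ := rfl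
  src_comp _ _ _ := rfl
  tgt_comp _ _ _ := rfl
  id_comp a := CenterCell.ext' rfl rfl (CenterV.id_comp' a.left a.src_top)
    (CenterV.id_comp' a.right a.tgt_top) (idH_over a.bd.top)
  comp_id a := CenterCell.ext' rfl rfl (CenterV.comp_id' a.left a.src_bot.symm)
    (CenterV.comp_id' a.right a.tgt_bot.symm) (over_idH _ _)
  assoc x y z w₁ w₂ := CenterCell.ext' rfl rfl
    (CenterV.assoc x.left y.left z.left (x.fitsL y w₁) (y.fitsL z w₂))
    (CenterV.assoc x.right y.right z.right (x.fitsR y w₁) (y.fitsR z w₂))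
    (over_assoc _ (x.fits' y w₁))

/-- The left center of a binoidal double category: 1-cells are 1-cells with the structure of a left
central 1-cell, 2-cells are left central 2-cells. The composition of the structural transformations
of 1h-cells uses conjugation by the compositors of the functors `- ⋊ X`. -/
noncomputable def leftCenter (b : Binoidal B) : DoubleCat where
  Obj := B.Obj
  Hor := CenterH b
  Ver := CenterV b
  Cell := CenterCell b
  h := centerCatH b
  v := centerCatV b
  ch := centerCatCH b
  cv := centerCatCV b
  src_top := CenterCell.src_top
  tgt_top := CenterCell.tgt_top
  src_bot := CenterCell.src_bot
  tgt_bot := CenterCell.tgt_bot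
  top_hid _ := rfl
  bot_hid _ := rfl
  left_vid _ := rfl
  right_vid _ := rfl
  top_hcomp _ _ _ := rfl
  bot_hcomp _ _ _ := rfl
  left_vcomp _ _ _ := rfl
  right_vcomp _ _ _ := rfl
  vid_hid := CenterH.vid_hid b
  vid_hcomp _ _ w := CenterCell.ext' rfl rfl
    (congrArg (CenterV.id b) (src_seqH _ _)) (congrArg (CenterV.id b) (tgt_seqH w)) (idH_seq w)
  hid_vcomp _ _ w := CenterCell.ext' (congrArg (CenterH.id b) (src_seqV _ _))
    (congrArg (CenterH.id b) (tgt_seqV w)) rfl rfl (idV_seq w)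
  interchange x y z t ac bd ab cd := CenterCell.ext' rfl rfl rfl rfl
    (interchange' (x.fits z ac) (y.fits t bd) (x.fits' y ab) (z.fits' t cd))

/-- The right center of a binoidal double category: the left center for the binoidal structure with
the two families of functors exchanged. -/
noncomputable abbrev rightCenter (b : Binoidal B) : DoubleCat := leftCenter b.swap

end Center
end DoubleCat

namespace DoubleCat

section Quasi
variable {A : DoubleCat.{u₁, u₂, u₃, u₄}} {B : DoubleCat.{w₁, w₂, w₃, w₄}}
variable {C : DoubleCat.{t₁, t₂, t₃, t₄}}

/-- The 2-cells of a pseudodouble quasi-functor `A × B → C` whose two families of pseudodouble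
functors are `T`, with their twenty axioms. Here `K` and `U` stand for 1h- and 1v-cells of `A`, and
`k` and `u` stand for 1h- and 1v-cells of `B`; `L X = (-,X)` is `T.ltimes X` and `R Y = (Y,-)` is
`T.rtimes Y`. -/
structure QuasiCells (T : Families A B C) where
  /-- The 2-cell `(k,K)`. -/
  hh : B.Hor → A.Hor → C.Cell
  /-- The 2-cell `(u,K)`. -/
  vh : B.Ver → A.Hor → C.Cell
  /-- The 2-cell `(k,U)`. -/
  hv : B.Hor → A.Ver → C.Cell
  /-- The 2-cell `(u,U)`. -/
  vv : B.Ver → A.Ver → C.Cell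
  hh_bd : ∀ k K, C.Bd (hh k K)
    ((T.ltimes (A.h.src K)).hor k ≫ₕ (T.rtimes (B.h.tgt k)).hor K)
    ((T.rtimes (B.h.src k)).hor K ≫ₕ (T.ltimes (A.h.tgt K)).hor k)
    (C.vid ((T.ltimes (A.h.src K)).obj (B.h.src k)))
    (C.vid ((T.ltimes (A.h.tgt K)).obj (B.h.tgt k)))
  hh_iso : ∀ k K, C.VIso (hh k K)
  vh_bd : ∀ u K, C.Bd (vh u K)
    ((T.rtimes (B.v.src u)).hor K) ((T.rtimes (B.v.tgt u)).hor K)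
    ((T.ltimes (A.h.src K)).ver u) ((T.ltimes (A.h.tgt K)).ver u)
  hv_bd : ∀ k U, C.Bd (hv k U)
    ((T.ltimes (A.v.src U)).hor k) ((T.ltimes (A.v.tgt U)).hor k)
    ((T.rtimes (B.h.src k)).ver U) ((T.rtimes (B.h.tgt k)).ver U)
  vv_bd : ∀ u U, C.Bd (vv u U)
    (C.hid ((T.ltimes (A.v.src U)).obj (B.v.src u)))
    (C.hid ((T.ltimes (A.v.tgt U)).obj (B.v.tgt u)))
    ((T.rtimes (B.v.src u)).ver U ≫ᵥ (T.ltimes (A.v.tgt U)).ver u)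
    ((T.ltimes (A.v.src U)).ver u ≫ᵥ (T.rtimes (B.v.tgt u)).ver U)
  vv_iso : ∀ u U, C.HIso (vv u U)
  hid_hh : ∀ Y K,
    ((T.ltimes (A.h.src K)).unit Y ⫿ C.idH ((T.rtimes Y).hor K)) ⊟ hh (B.hid Y) K =
      C.idH ((T.rtimes Y).hor K) ⫿ (T.ltimes (A.h.tgt K)).unit Y
  hh_hid : ∀ k X,
    (C.idH ((T.ltimes X).hor k) ⫿ (T.rtimes (B.h.tgt k)).unit X) ⊟ hh k (A.hid X) =
      (T.rtimes (B.h.src k)).unit X ⫿ C.idH ((T.ltimes X).hor k)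
  vid_vh : ∀ Y K, vh (B.vid Y) K = C.idH ((T.rtimes Y).hor K)
  hv_vid : ∀ k X, hv k (A.vid X) = C.idH ((T.ltimes X).hor k)
  vh_hid : ∀ u X,
    (T.rtimes (B.v.src u)).unit X ⊟ vh u (A.hid X) =
      C.idV ((T.ltimes X).ver u) ⊟ (T.rtimes (B.v.tgt u)).unit X
  hid_hv : ∀ Y U,
    (T.ltimes (A.v.src U)).unit Y ⊟ hv (B.hid Y) U =
      C.idV ((T.rtimes Y).ver U) ⊟ (T.ltimes (A.v.tgt U)).unit Y
  vid_vv : ∀ Y U, vv (B.vid Y) U = C.idV ((T.rtimes Y).ver U)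
  vv_vid : ∀ u X, vv u (A.vid X) = C.idV ((T.ltimes X).ver u)
  /-- The axiom for `(k'k,K)`. -/
  seq_hh : ∀ k k' K (w : B.h.tgt k = B.h.src k'),
    ((T.ltimes (A.h.src K)).cmpr k k' w ⫿ C.idH ((T.rtimes (B.h.tgt k')).hor K)) ⊟
        hh (k ≫ₕ k') K =
      (C.idH ((T.ltimes (A.h.src K)).hor k) ⫿ hh k' K) ⊟
        (hh k K ⫿ C.idH ((T.ltimes (A.h.tgt K)).hor k')) ⊟
        (C.idH ((T.rtimes (B.h.src k)).hor K) ⫿ (T.ltimes (A.h.tgt K)).cmpr k k' w)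
  /-- The axiom for `(k,K'K)`. -/
  hh_seq : ∀ k K K' (w : A.h.tgt K = A.h.src K'),
    (C.idH ((T.ltimes (A.h.src K)).hor k) ⫿ (T.rtimes (B.h.tgt k)).cmpr K K' w) ⊟
        hh k (K ≫ₕ K') =
      (hh k K ⫿ C.idH ((T.rtimes (B.h.tgt k)).hor K')) ⊟
        (C.idH ((T.rtimes (B.h.src k)).hor K) ⫿ hh k K') ⊟
        ((T.rtimes (B.h.src k)).cmpr K K' w ⫿ C.idH ((T.ltimes (A.h.tgt K')).hor k))
  /-- The axiom for `(u/u',K)`. -/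
  seq_vh : ∀ u u' K, B.v.tgt u = B.v.src u' → vh (u ≫ᵥ u') K = vh u K ⊟ vh u' K
  /-- The axiom for `(k,U/U')`. -/
  hv_seq : ∀ k U U', A.v.tgt U = A.v.src U' → hv k (U ≫ᵥ U') = hv k U ⊟ hv k U'
  /-- The axiom for `(u,K'K)`. -/
  vh_seq : ∀ u K K' (w : A.h.tgt K = A.h.src K'),
    (T.rtimes (B.v.src u)).cmpr K K' w ⊟ vh u (K ≫ₕ K') =
      (vh u K ⫿ vh u K') ⊟ (T.rtimes (B.v.tgt u)).cmpr K K' w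
  /-- The axiom for `(k'k,U)`. -/
  seq_hv : ∀ k k' U (w : B.h.tgt k = B.h.src k'),
    (T.ltimes (A.v.src U)).cmpr k k' w ⊟ hv (k ≫ₕ k') U =
      (hv k U ⫿ hv k' U) ⊟ (T.ltimes (A.v.tgt U)).cmpr k k' w
  /-- The axiom for `(u/u',U)`. -/
  seq_vv : ∀ u u' U, B.v.tgt u = B.v.src u' →
    vv (u ≫ᵥ u') U = (vv u U ⊟ C.idV ((T.ltimes (A.v.tgt U)).ver u')) ⫿
      (C.idV ((T.ltimes (A.v.src U)).ver u) ⊟ vv u' U)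
  /-- The axiom for `(u,U/U')`. -/
  vv_seq : ∀ u U U', A.v.tgt U = A.v.src U' →
    vv u (U ≫ᵥ U') = (C.idV ((T.rtimes (B.v.src u)).ver U) ⊟ vv u U') ⫿
      (vv u U ⊟ C.idV ((T.rtimes (B.v.tgt u)).ver U'))
  /-- Naturality with respect to a 2-cell `ω` of `B`, at a 1h-cell `K`. -/
  nat_h : ∀ ω K,
    hh (B.top ω) K ⊟ (vh (B.left ω) K ⫿ (T.ltimes (A.h.tgt K)).cell ω) =
      ((T.ltimes (A.h.src K)).cell ω ⫿ vh (B.right ω) K) ⊟ hh (B.bot ω) K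
  /-- Naturality with respect to a 2-cell `ζ` of `A`, at a 1h-cell `k`. -/
  h_nat : ∀ k ζ,
    hh k (A.top ζ) ⊟ ((T.rtimes (B.h.src k)).cell ζ ⫿ hv k (A.right ζ)) =
      (hv k (A.left ζ) ⫿ (T.rtimes (B.h.tgt k)).cell ζ) ⊟ hh k (A.bot ζ)
  /-- Naturality with respect to a 2-cell `ω` of `B`, at a 1v-cell `U`. -/
  nat_v : ∀ ω U,
    vv (B.left ω) U ⫿ ((T.ltimes (A.v.src U)).cell ω ⊟ hv (B.bot ω) U) =
      (hv (B.top ω) U ⊟ (T.ltimes (A.v.tgt U)).cell ω) ⫿ vv (B.right ω) U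
  /-- Naturality with respect to a 2-cell `ζ` of `A`, at a 1v-cell `u`. -/
  v_nat : ∀ u ζ,
    vv u (A.left ζ) ⫿ (vh u (A.top ζ) ⊟ (T.rtimes (B.v.tgt u)).cell ζ) =
      ((T.rtimes (B.v.src u)).cell ζ ⊟ vh u (A.bot ζ)) ⫿ vv u (A.right ζ)

/-- A pseudodouble quasi-functor `A × B → C`. -/
structure QuasiFunctor (A : DoubleCat.{u₁, u₂, u₃, u₄}) (B : DoubleCat.{w₁, w₂, w₃, w₄})
    (C : DoubleCat.{t₁, t₂, t₃, t₄}) where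
  families : Families A B C
  cells : QuasiCells families

end Quasi

/-- A (strict) double functor. -/
structure DoubleFunctor (C : DoubleCat.{u₁, u₂, u₃, u₄}) (D : DoubleCat.{w₁, w₂, w₃, w₄}) where
  obj : C.Obj → D.Obj
  hor : C.Hor → D.Hor
  ver : C.Ver → D.Ver
  cell : C.Cell → D.Cell
  hor_bd : ∀ f, D.HBd (hor f) (obj (C.h.src f)) (obj (C.h.tgt f))
  ver_bd : ∀ x, D.VBd (ver x) (obj (C.v.src x)) (obj (C.v.tgt x))
  cell_bd : ∀ a, D.Bd (cell a) (hor (C.top a)) (hor (C.bot a)) (ver (C.left a)) (ver (C.right a))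
  hor_seq : ∀ f g, C.h.tgt f = C.h.src g → hor (f ≫ₕ g) = hor f ≫ₕ hor g
  hor_id : ∀ A, hor (C.hid A) = D.hid (obj A)
  ver_seq : ∀ x y, C.v.tgt x = C.v.src y → ver (x ≫ᵥ y) = ver x ≫ᵥ ver y
  ver_id : ∀ A, ver (C.vid A) = D.vid (obj A)
  cell_over : ∀ a b, C.bot a = C.top b → cell (a ⊟ b) = cell a ⊟ cell b
  cell_beside : ∀ a b, C.right a = C.left b → cell (a ⫿ b) = cell a ⫿ cell b
  cell_idH : ∀ f, cell (C.idH f) = D.idH (hor f)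
  cell_idV : ∀ x, cell (C.idV x) = D.idV (ver x)

namespace DoubleFunctor

/-- The identity double functor. -/
def id (C : DoubleCat.{u₁, u₂, u₃, u₄}) : DoubleFunctor C C where
  obj := fun A => A
  hor := fun f => f
  ver := fun x => x
  cell := fun a => a
  hor_bd _ := ⟨rfl, rfl⟩
  ver_bd _ := ⟨rfl, rfl⟩
  cell_bd _ := ⟨rfl, rfl, rfl, rfl⟩
  hor_seq _ _ _ := rfl
  hor_id _ := rfl
  ver_seq _ _ _ := rfl
  ver_id _ := rfl
  cell_over _ _ _ := rfl
  cell_beside _ _ _ := rfl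
  cell_idH _ := rfl
  cell_idV _ := rfl

/-- The composite of double functors, in diagrammatic order. -/
def comp {C : DoubleCat.{u₁, u₂, u₃, u₄}} {D : DoubleCat.{w₁, w₂, w₃, w₄}}
    {E : DoubleCat.{t₁, t₂, t₃, t₄}} (F : DoubleFunctor C D) (G : DoubleFunctor D E) :
    DoubleFunctor C E where
  obj A := G.obj (F.obj A)
  hor f := G.hor (F.hor f)
  ver x := G.ver (F.ver x)
  cell a := G.cell (F.cell a)
  hor_bd f := by rw [← (F.hor_bd f).src, ← (F.hor_bd f).tgt]; exact G.hor_bd _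
  ver_bd x := by rw [← (F.ver_bd x).src, ← (F.ver_bd x).tgt]; exact G.ver_bd _
  cell_bd a := by
    rw [← (F.cell_bd a).top, ← (F.cell_bd a).bot, ← (F.cell_bd a).left, ← (F.cell_bd a).right]
    exact G.cell_bd _
  hor_seq f g w := by
    rw [F.hor_seq f g w, G.hor_seq _ _ (by rw [(F.hor_bd f).tgt, (F.hor_bd g).src, w])]
  hor_id A := by rw [F.hor_id, G.hor_id]
  ver_seq x y w := by
    rw [F.ver_seq x y w, G.ver_seq _ _ (by rw [(F.ver_bd x).tgt, (F.ver_bd y).src, w])]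
  ver_id A := by rw [F.ver_id, G.ver_id]
  cell_over a b w := by
    rw [F.cell_over a b w, G.cell_over _ _ (by rw [(F.cell_bd a).bot, (F.cell_bd b).top, w])]
  cell_beside a b w := by
    rw [F.cell_beside a b w, G.cell_beside _ _ (by rw [(F.cell_bd a).right, (F.cell_bd b).left, w])]
  cell_idH f := by rw [F.cell_idH, G.cell_idH]
  cell_idV x := by rw [F.cell_idV, G.cell_idV]

end DoubleFunctor

section Central
variable {B : DoubleCat.{u₁, u₂, u₃, u₄}}

theorem leftCenter_seqH {b : Binoidal B} (f g : (leftCenter b).Hor)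
    (w : (leftCenter b).h.tgt f = (leftCenter b).h.src g) : (f ≫ₕ g).1 = f.1 ≫ₕ g.1 :=
  congrArg Sigma.fst ((leftCenter b).h.cmp_eq w)
theorem leftCenter_seqV {b : Binoidal B} (f g : (leftCenter b).Ver)
    (w : (leftCenter b).v.tgt f = (leftCenter b).v.src g) : (f ≫ᵥ g).1 = f.1 ≫ᵥ g.1 :=
  congrArg Sigma.fst ((leftCenter b).v.cmp_eq w)

/-- The projection from the left center which forgets the structural transformations. -/
noncomputable def leftCenterProj (b : Binoidal B) : DoubleFunctor (leftCenter b) B where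
  obj A := A
  hor f := f.1
  ver x := x.1
  cell a := a.cell
  hor_bd _ := ⟨rfl, rfl⟩
  ver_bd _ := ⟨rfl, rfl⟩
  cell_bd a := a.bd
  hor_seq := leftCenter_seqH
  hor_id _ := rfl
  ver_seq := leftCenter_seqV
  ver_id _ := rfl
  cell_over a c w := congrArg CenterCell.cell ((leftCenter b).cv.cmp_eq w)
  cell_beside a c w := congrArg CenterCell.cell ((leftCenter b).ch.cmp_eq w)
  cell_idH _ := rfl
  cell_idV _ := rfl

/-- The projection from the right center which forgets the structural transformations. -/
noncomputable abbrev rightCenterProj (b : Binoidal B) : DoubleFunctor (rightCenter b) B :=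
  leftCenterProj b.swap

/-- A purely central structure on a binoidal double category: double functors to the left center and
to the right center that are sections of the projections and satisfy four identities. -/
structure PureStr (b : Binoidal B) where
  Zl : DoubleFunctor B (leftCenter b)
  Zr : DoubleFunctor B (rightCenter b)
  Zl_proj : Zl.comp (leftCenterProj b) = DoubleFunctor.id B
  Zr_proj : Zr.comp (rightCenterProj b) = DoubleFunctor.id B
  /-- `K ⋉ -|_k = (- ⋊ k|_K)⁻¹`. -/
  hh_inv : ∀ k K, B.cv.IsInverse ((Zl.hor K).2.δ k) ((Zr.hor k).2.δ K)
  /-- `U ⋉ -|_u = (- ⋊ u|_U)⁻¹`. -/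
  vv_inv : ∀ u U, B.ch.IsInverse ((Zl.ver U).2.δ u) ((Zr.ver u).2.δ U)
  /-- `K ⋉ -|_u = - ⋊ u|_K`. -/
  vh_eq : ∀ u K, (Zl.hor K).2.sq u = (Zr.ver u).2.sq K
  /-- `U ⋉ -|_k = - ⋊ k|_U`. -/
  hv_eq : ∀ k U, (Zl.ver U).2.sq k = (Zr.hor k).2.sq U

/-- A binoidal double category is purely central if it has a purely central structure. -/
def PurelyCentral (b : Binoidal B) : Prop := Nonempty (PureStr b)

/-- A choice of structural transformations by which all cells of a binoidal double category are left
and right central, subject to four identities. -/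
structure LRCentral (b : Binoidal B) where
  /-- `K ⋉ -`. -/
  lh : ∀ K : B.Hor, LeftCentralH b K
  /-- `- ⋊ k`. -/
  rh : ∀ k : B.Hor, RightCentralH b k
  /-- `U ⋉ -`. -/
  lv : ∀ U : B.Ver, LeftCentralV b U
  /-- `- ⋊ u`. -/
  rv : ∀ u : B.Ver, RightCentralV b u
  lcell : ∀ ζ : B.Cell, IsModification (lh (B.top ζ)).toHTrans (lh (B.bot ζ)).toHTrans
    (lv (B.left ζ)).toVTrans (lv (B.right ζ)).toVTrans (fun X => (b.rtimes X).cell ζ)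
  rcell : ∀ ω : B.Cell, IsModification (rh (B.top ω)).toHTrans (rh (B.bot ω)).toHTrans
    (rv (B.left ω)).toVTrans (rv (B.right ω)).toVTrans (fun X => (b.ltimes X).cell ω)
  hh_inv : ∀ k K, B.cv.IsInverse ((lh K).δ k) ((rh k).δ K)
  vv_inv : ∀ u U, B.ch.IsInverse ((lv U).δ u) ((rv u).δ U)
  vh_eq : ∀ u K, (lh K).sq u = (rv u).sq K
  hv_eq : ∀ k U, (lv U).sq k = (rh k).sq U

/-- The 2-cells `(k,K)`, `(u,K)`, `(k,U)`, `(u,U)` are the components of the structural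
transformations: `K ⋉ - = (-,K)`, `- ⋊ k = (k,-)`, `U ⋉ - = (-,U)`, `- ⋊ u = (u,-)`. -/
structure QuasiCells.Corresponds {b : Binoidal B} (q : QuasiCells b) (c : LRCentral b) : Prop where
  lh_δ : ∀ k K, (c.lh K).δ k = q.hh k K
  rh_lax : ∀ k K, (c.rh k).lax K = q.hh k K
  lh_sq : ∀ u K, (c.lh K).sq u = q.vh u K
  rv_sq : ∀ u K, (c.rv u).sq K = q.vh u K
  lv_sq : ∀ k U, (c.lv U).sq k = q.hv k U
  rh_sq : ∀ k U, (c.rh k).sq U = q.hv k U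
  lv_δ : ∀ u U, (c.lv U).δ u = q.vv u U
  rv_oplax : ∀ u U, (c.rv u).oplax U = q.vv u U

/-- The double functors to the centers send `a` to `a` with `a ⋉ -` and `- ⋊ a`, respectively. -/
structure LRCentral.Corresponds {b : Binoidal B} (c : LRCentral b) (z : PureStr b) : Prop where
  lh : ∀ K, z.Zl.hor K = ⟨K, c.lh K⟩
  rh : ∀ k, z.Zr.hor k = ⟨k, c.rh k⟩
  lv : ∀ U, z.Zl.ver U = ⟨U, c.lv U⟩
  rv : ∀ u, z.Zr.ver u = ⟨u, c.rv u⟩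
  lcell : ∀ ζ, (z.Zl.cell ζ).cell = ζ
  rcell : ∀ ω, (z.Zr.cell ω).cell = ω

end Central
end DoubleCat

/-! A quasi-functor, a choice of structural transformations and a pair of sections of the centers
carry the same 2-cells; only the bookkeeping of the axioms differs. Fix the two families of
functors.

Freeze `K` or `U` in a quasi-functor and let the other variable run. The 2-cells `(k,K)` and `(u,K)`
are then the components of a horizontal transformation `K ⋉ -`, and `(k,U)` and `(u,U)` those of a
vertical transformation `U ⋉ -`. Its axioms in the running variable (two for identities, two for
composition and one for naturality, in each of the two cases) are exactly the axioms of these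
transformations. This uses ten of the twenty axioms. The naturality axioms for a 2-cell `ζ` of the
frozen variable, two more, say that `ζ ⋉ -` is a modification. The remaining eight concern
identities and composition in the frozen variable, and they can be read in two ways.

Read from the other side, they are the corresponding axioms of `- ⋊ k` and `- ⋊ u`. The definition
of a quasi-functor is symmetric up to replacing `(k,K)` and `(u,U)` by their inverses
(`QuasiCells.swap`), so the right-hand transformations come from the left-hand construction applied
to the swapped quasi-functor. The identities `(*)` say precisely that both sides are built from the
same 2-cells, with these inverses. Each naturality axiom occurs twice, as naturality of a
transformation on one side and as a modification condition on the other. This gives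
`quasiCellsEquiv`.

Read inside the left center, the same eight axioms say that `K ↦ (K, K ⋉ -)` and `U ↦ (U, U ⋉ -)`
preserve composition and identities. Compositors and unitors appear in the axioms for 1h-cells, and
moving them across the equation yields the conjugation by which the center composes its 1h-cells
(`QuasiCells.centerH_seq`, `QuasiCells.centerH_id`). A 2-cell of the center is determined by its
boundary and its underlying 2-cell, so nothing further is needed for a double functor.

Conversely, a section of the projection from a center amounts to a structural transformation for
every 1-cell, such that every 2-cell is central; two sections with the same values on 1-cells
coincide (`section_ext`). Together with `(*)` such data already form a choice of structural
transformations, and functoriality is recovered from it. This gives `lrCentralEquiv`. -/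

namespace ArrCat

/-! ### Calculus of inverse arrows for the total composition operation -/

variable {O M : Type*} {C : ArrCat O M} {a a' b b' x y : M}

theorem IsInverse.cmp_hom_inv (h : C.IsInverse a b) : C.cmp a b = C.id (C.src a) := by
  rw [C.cmp_eq h.tgt_eq, h.hom_inv]

theorem IsInverse.cmp_inv_hom (h : C.IsInverse a b) : C.cmp b a = C.id (C.src b) :=
  h.symm.cmp_hom_inv

/-- Reversing the two invertible sides of a commutative square. -/
theorem IsInverse.cmp_eq_cmp (ha : C.IsInverse a a') (hb : C.IsInverse b b')
    (wx : C.tgt x = C.src a) (wy : C.tgt b = C.src y) (h : C.cmp x a = C.cmp b y) :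
    C.cmp y a' = C.cmp b' x := by
  have e : C.tgt b' = C.src x := by rw [hb.src_eq, ← C.src_cmp b y, ← h, C.src_cmp]
  have h₁ : C.cmp b' (C.cmp b y) = y := by
    rw [← C.cmp_assoc _ hb.src_eq, hb.cmp_inv_hom, C.id_cmp (wy.symm.trans hb.tgt_eq)]
  rw [← h₁, ← h, ← C.cmp_assoc a e, C.cmp_assoc a' (by rw [C.tgt_cmp e, wx]),
    ha.cmp_hom_inv, C.cmp_id]

theorem IsInverse.unique (h : C.IsInverse a b) (h' : C.IsInverse a b') : b = b' := by
  have e : C.cmp (C.cmp b a) b' = C.cmp b (C.cmp a b') := C.cmp_assoc _ h.src_eq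
  rw [h.cmp_inv_hom, h'.cmp_hom_inv, C.cmp_id, C.id_cmp (by rw [← h.tgt_eq, h'.tgt_eq])] at e
  exact e.symm

/-- `inv` is obtained by choice, so an inverse that arises in any other way has to be compared with
it by uniqueness. This is how the inverses in `(*)` are matched with `vinv` and `hinv`, and with the
lax and oplax structures. -/
theorem IsInverse.eq_inv (h : C.IsInverse a b) : b = C.inv a := h.unique (C.inv_spec ⟨b, h⟩)

theorem IsInverse.cmp (ha : C.IsInverse a a') (hb : C.IsInverse b b') (w : C.tgt a = C.src b) :
    C.IsInverse (C.cmp a b) (C.cmp b' a') := by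
  have w' : C.tgt b' = C.src a' := by rw [hb.src_eq, ← w, ha.tgt_eq]
  refine .mk_cmp _ (by rw [C.tgt_cmp w, C.src_cmp, hb.tgt_eq])
    (by rw [C.tgt_cmp w', C.src_cmp, ha.src_eq]) ?_ ?_
  · rw [C.cmp_assoc _ w, ← C.cmp_assoc _ hb.tgt_eq, hb.cmp_hom_inv,
      C.id_cmp (w'.symm.trans hb.src_eq),
      ha.cmp_hom_inv, C.src_cmp]
  · rw [C.cmp_assoc _ w', ← C.cmp_assoc _ ha.src_eq, ha.cmp_inv_hom,
      C.id_cmp (w.symm.trans ha.tgt_eq),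
      hb.cmp_inv_hom, C.src_cmp]

end ArrCat

/-! ### Inverting 2-cells inside pasting equations -/

namespace DoubleCat

section Inverse
variable {D : DoubleCat.{u₁, u₂, u₃, u₄}} {a a' b b' c c' p q : D.Cell} {f g g' : D.Hor}
  {x z z' : D.Ver} {A B : D.Obj}

/-- The rule for square-shaped equations: it turns a naturality axiom for `(k,K)` into the one for
the inverse 2-cells. -/
theorem over_eq_over_of_isInverse (ha : D.cv.IsInverse a a') (hb : D.cv.IsInverse b b')
    (w : D.bot p = D.top a) (w' : D.bot b = D.top q) (h : p ⊟ a = b ⊟ q) : q ⊟ a' = b' ⊟ p :=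
  ha.cmp_eq_cmp hb w w' h

/-- The rule for the unit axioms, in which only one invertible 2-cell has to be moved. -/
theorem over_eq_of_isInverse (ha : D.cv.IsInverse a a') (w : D.bot p = D.top a) (h : p ⊟ a = q) :
    q ⊟ a' = p := by
  rw [← h, over_assoc _ w]
  exact (congrArg (p ⊟ ·) ha.cmp_hom_inv).trans (over_idH _ _)

/-- The rule for the composition axioms. The reversed order of `c'` and `b'` matters: the axioms for
composites in the two variables of a quasi-functor differ by the order of their two factors. -/
theorem over_eq_over₂_of_isInverse (ha : D.cv.IsInverse a a') (hb : D.cv.IsInverse b b')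
    (hc : D.cv.IsInverse c c') (w : D.bot p = D.top a) (w₁ : D.bot b = D.top c)
    (w₂ : D.bot c = D.top q) (h : p ⊟ a = b ⊟ c ⊟ q) : q ⊟ a' = c' ⊟ b' ⊟ p :=
  over_eq_over_of_isInverse ha (hb.cmp hc w₁) w ((bot_over w₁).trans w₂) h

theorem beside_eq_beside_of_isInverse (ha : D.ch.IsInverse a a') (hb : D.ch.IsInverse b b')
    (w : D.right p = D.left a) (w' : D.right b = D.left q) (h : p ⫿ a = b ⫿ q) :
    q ⫿ a' = b' ⫿ p :=
  ha.cmp_eq_cmp hb w w' h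

/-- Whiskering by a 1h-cell preserves vertical composites by interchange, as the boundary along
which it is glued is an identity. -/
theorem isInverse_beside_idH (h : D.cv.IsInverse a a') (ha : D.right a = D.vid B)
    (ha' : D.right a' = D.vid B) (w : B = D.h.src f) :
    D.cv.IsInverse (a ⫿ D.idH f) (a' ⫿ D.idH f) := by
  subst w
  have t : D.bot a = D.top a' := h.tgt_eq
  have t' : D.bot a' = D.top a := h.src_eq
  refine .mk_cmp _ ?_ ?_ ?_ ?_
  · change D.bot _ = D.top _; simp [ha, ha', t]
  · change D.bot _ = D.top _; simp [ha, ha', t']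
  · change _ ⊟ _ = D.idH (D.top _)
    rw [← over_beside_id t ha ha', top_beside (by simp [ha]), idH_seq, top_idH]
    · exact congrArg (· ⫿ D.idH f) h.cmp_hom_inv
    · simp [ha]
  · change _ ⊟ _ = D.idH (D.top _)
    rw [← over_beside_id t' ha' ha, top_beside (by simp [ha']), idH_seq, top_idH]
    · exact congrArg (· ⫿ D.idH f) h.cmp_inv_hom
    · simp [ha']

theorem isInverse_idH_beside (h : D.cv.IsInverse a a') (ha : D.left a = D.vid A)
    (ha' : D.left a' = D.vid A) (w : D.h.tgt f = A) :
    D.cv.IsInverse (D.idH f ⫿ a) (D.idH f ⫿ a') := by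
  subst w
  have t : D.bot a = D.top a' := h.tgt_eq
  have t' : D.bot a' = D.top a := h.src_eq
  refine .mk_cmp _ ?_ ?_ ?_ ?_
  · change D.bot _ = D.top _; simp [ha, ha', t]
  · change D.bot _ = D.top _; simp [ha, ha', t']
  · change _ ⊟ _ = D.idH (D.top _)
    rw [← id_beside_over t ha ha', top_beside (by simp [ha]), idH_seq, top_idH]
    · exact congrArg (D.idH f ⫿ ·) h.cmp_hom_inv
    · simp [ha]
  · change _ ⊟ _ = D.idH (D.top _)
    rw [← id_beside_over t' ha' ha, top_beside (by simp [ha']), idH_seq, top_idH]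
    · exact congrArg (D.idH f ⫿ ·) h.cmp_inv_hom
    · simp [ha']

/-- Statements about horizontal inverses are those about vertical inverses in the transposed double
category, where the two directions are exchanged definitionally. -/
theorem isInverse_over_idV (h : D.ch.IsInverse a a') (ha : D.bot a = D.hid B)
    (ha' : D.bot a' = D.hid B) (w : B = D.v.src x) :
    D.ch.IsInverse (a ⊟ D.idV x) (a' ⊟ D.idV x) :=
  isInverse_beside_idH (D := D.transpose) h ha ha' w

theorem isInverse_idV_over (h : D.ch.IsInverse a a') (ha : D.top a = D.hid A)
    (ha' : D.top a' = D.hid A) (w : D.v.tgt x = A) :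
    D.ch.IsInverse (D.idV x ⊟ a) (D.idV x ⊟ a') :=
  isInverse_idH_beside (D := D.transpose) h ha ha' w

theorem isInverse_idV (x : D.Ver) : D.ch.IsInverse (D.idV x) (D.idV x) :=
  .mk_cmp _ (D.ch.tgt_id' _ |>.trans (D.ch.src_id' _).symm)
    (D.ch.tgt_id' _ |>.trans (D.ch.src_id' _).symm)
    ((D.ch.cmp_id _ _).trans (congrArg D.ch.id (D.ch.src_id _).symm))
    ((D.ch.cmp_id _ _).trans (congrArg D.ch.id (D.ch.src_id _).symm))

theorem isInverse_vinv (i : D.VIso a) : D.cv.IsInverse a (vinv a) := D.cv.inv_spec i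

theorem isInverse_hinv (i : D.HIso a) : D.ch.IsInverse a (hinv a) := D.ch.inv_spec i

theorem Bd.hinv (ha : D.Bd a (D.hid A) (D.hid B) z z') (i : D.HIso a) :
    D.Bd (hinv a) (D.hid A) (D.hid B) z' z :=
  have h := Bd.vinv (D := D.transpose) ha.toTranspose i
  ⟨h.left, h.right, h.top, h.bot⟩

end Inverse

/-! ### Symmetry of quasi-functors in their two variables -/

section Swap
variable {A : DoubleCat.{u₁, u₂, u₃, u₄}} {B : DoubleCat.{w₁, w₂, w₃, w₄}}
variable {C : DoubleCat.{t₁, t₂, t₃, t₄}} {T : Families A B C}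

@[simp] theorem Families.swap_ltimes (Y) : T.swap.ltimes Y = T.rtimes Y := rfl
@[simp] theorem Families.swap_rtimes (X) : T.swap.rtimes X = T.ltimes X := rfl
-- Corner objects are normalized to the form `(Y,-)` at `X`; otherwise boundaries computed from the
-- two families agree only propositionally and do not match.
attribute [simp] Families.obj_eq

/-- Exchanging the two variables of a quasi-functor inverts the 2-cells `(k,K)` and `(u,U)`. -/
noncomputable def QuasiCells.swap (q : QuasiCells T) : QuasiCells T.swap where
  hh K k := vinv (q.hh k K)
  vh U k := q.hv k U
  hv K u := q.vh u K
  vv U u := hinv (q.vv u U)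
  hh_bd K k := ((q.hh_bd k K).vinv (q.hh_iso k K)).congr rfl rfl
    (by rw [T.obj_eq]; rfl) (by rw [T.obj_eq]; rfl)
  hh_iso K k := ⟨_, (isInverse_vinv (q.hh_iso k K)).symm⟩
  vh_bd U k := q.hv_bd k U
  hv_bd K u := q.vh_bd u K
  vv_bd U u := ((q.vv_bd u U).hinv (q.vv_iso u U)).congr
    (by rw [T.obj_eq]; rfl) (by rw [T.obj_eq]; rfl) rfl rfl
  vv_iso U u := ⟨_, (isInverse_hinv (q.vv_iso u U)).symm⟩
  -- The unit axioms of the two variables are interchanged: in each, the invertible 2-cell is moved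
  -- to the other side.
  hid_hh X k := over_eq_of_isInverse (isInverse_vinv (q.hh_iso _ _))
    (by simp [(q.hh_bd k (A.hid X)).top]) (q.hh_hid k X)
  hh_hid K Y := over_eq_of_isInverse (isInverse_vinv (q.hh_iso _ _))
    (by simp [(q.hh_bd (B.hid Y) K).top]) (q.hid_hh Y K)
  vid_vh X k := q.hv_vid k X
  hv_vid K Y := q.vid_vh Y K
  vh_hid U Y := q.hid_hv Y U
  hid_hv X u := q.vh_hid u X
  -- The chosen inverse of an identity 2-cell is that identity, by uniqueness of inverses.
  vid_vv X u := by rw [q.vv_vid]; exact (isInverse_idV _).eq_inv.symm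
  vv_vid U Y := by rw [q.vid_vv]; exact (isInverse_idV _).eq_inv.symm
  -- Inverting `hh_seq` reverses its two whiskered factors and moves the compositors to the opposite
  -- ends, which produces the shape of `seq_hh` with the families exchanged.
  seq_hh K K' k w := by
    have h₁ := q.hh_bd k K
    have h₂ := q.hh_bd k K'
    have h₃ := q.hh_bd k (K ≫ₕ K')
    have i₁ := h₁.vinv (q.hh_iso _ _)
    have i₂ := h₂.vinv (q.hh_iso _ _)
    refine over_eq_over₂_of_isInverse (isInverse_vinv (q.hh_iso _ _))
      (isInverse_beside_idH (isInverse_vinv (q.hh_iso _ _)) h₁.right i₁.right (by simp [w]))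
      (isInverse_idH_beside (isInverse_vinv (q.hh_iso _ _)) h₂.left i₂.left (by simp [w]))
      ?_ ?_ ?_ (q.hh_seq k K K' w)
    · simp [h₃.top]
    · simp [h₁.right, h₁.bot, h₂.left, h₂.top, w]
    · simp [h₂.left, h₂.bot, w]
  hh_seq K k k' w := by
    have h₁ := q.hh_bd k K
    have h₂ := q.hh_bd k' K
    have h₃ := q.hh_bd (k ≫ₕ k') K
    have i₁ := h₁.vinv (q.hh_iso _ _)
    have i₂ := h₂.vinv (q.hh_iso _ _)
    refine over_eq_over₂_of_isInverse (isInverse_vinv (q.hh_iso _ _))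
      (isInverse_idH_beside (isInverse_vinv (q.hh_iso _ _)) h₂.left i₂.left (by simp [w]))
      (isInverse_beside_idH (isInverse_vinv (q.hh_iso _ _)) h₁.right i₁.right (by simp [w]))
      ?_ ?_ ?_ (q.seq_hh k k' K w)
    · simp [h₃.top, w]
    · simp [h₁.right, h₁.top, h₂.left, h₂.bot, w]
    · simp [h₁.right, h₁.bot, w]
  seq_vh U U' k w := q.hv_seq k U U' w
  hv_seq K u u' w := q.seq_vh u u' K w
  vh_seq U k k' w := q.seq_hv k k' U w
  seq_hv K K' u w := q.vh_seq u K K' w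
  -- No compositors occur in the vertical direction, so `vv_seq` expresses the 2-cell itself as a
  -- composite of two whiskered factors; the claim is that its inverse is the reversed composite of
  -- their inverses.
  seq_vv U U' u w := by
    have h₁ := q.vv_bd u U
    have h₂ := q.vv_bd u U'
    have i₁ := h₁.hinv (q.vv_iso _ _)
    have i₂ := h₂.hinv (q.vv_iso _ _)
    rw [q.vv_seq u U U' w]
    refine (ArrCat.IsInverse.eq_inv (C := C.ch) (ArrCat.IsInverse.cmp
      (isInverse_idV_over (isInverse_hinv (q.vv_iso _ _)) h₂.top i₂.top (by simp [w]))
      (isInverse_over_idV (isInverse_hinv (q.vv_iso _ _)) h₁.bot i₁.bot (by simp [w])) ?_)).symm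
    change C.right _ = C.left _
    simp [h₁.left, h₁.bot, h₂.top, h₂.right, w]
  vv_seq U u u' w := by
    have h₁ := q.vv_bd u U
    have h₂ := q.vv_bd u' U
    have i₁ := h₁.hinv (q.vv_iso _ _)
    have i₂ := h₂.hinv (q.vv_iso _ _)
    rw [q.seq_vv u u' U w]
    refine (ArrCat.IsInverse.eq_inv (C := C.ch) (ArrCat.IsInverse.cmp
      (isInverse_over_idV (isInverse_hinv (q.vv_iso _ _)) h₁.bot i₁.bot (by simp [w]))
      (isInverse_idV_over (isInverse_hinv (q.vv_iso _ _)) h₂.top i₂.top (by simp [w])) ?_)).symm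
    change C.right _ = C.left _
    simp [h₁.right, h₁.bot, h₂.top, h₂.left, w]
  -- Naturality in one variable becomes naturality in the other; the noninvertible sides of the
  -- square stay and only `(k,K)` at top and bottom is inverted.
  nat_h ζ k := by
    have h₁ := q.hh_bd k (A.top ζ)
    have h₂ := q.hh_bd k (A.bot ζ)
    refine (over_eq_over_of_isInverse (isInverse_vinv (q.hh_iso _ _))
      (isInverse_vinv (q.hh_iso _ _)) ?_ ?_ (q.h_nat k ζ).symm).symm
    · simp [h₂.top, (q.hv_bd _ _).bot, (q.hv_bd _ _).right]
    · simp [h₁.bot, (q.hv_bd _ _).top, (q.hv_bd _ _).left]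
  h_nat K ω := by
    have h₁ := q.hh_bd (B.top ω) K
    have h₂ := q.hh_bd (B.bot ω) K
    refine (over_eq_over_of_isInverse (isInverse_vinv (q.hh_iso _ _))
      (isInverse_vinv (q.hh_iso _ _)) ?_ ?_ (q.nat_h ω K).symm).symm
    · simp [h₂.top, (q.vh_bd _ _).bot, (q.vh_bd _ _).left]
    · simp [h₁.bot, (q.vh_bd _ _).top, (q.vh_bd _ _).right]
  nat_v ζ u := by
    have h₁ := q.vv_bd u (A.left ζ)
    have h₂ := q.vv_bd u (A.right ζ)
    refine (beside_eq_beside_of_isInverse (isInverse_hinv (q.vv_iso _ _))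
      (isInverse_hinv (q.vv_iso _ _)) ?_ ?_ (q.v_nat u ζ).symm).symm
    · simp [h₂.left, (q.vh_bd _ _).top, (q.vh_bd _ _).right]
    · simp [h₁.right, (q.vh_bd _ _).bot, (q.vh_bd _ _).left]
  v_nat U ω := by
    have h₁ := q.vv_bd (B.left ω) U
    have h₂ := q.vv_bd (B.right ω) U
    refine (beside_eq_beside_of_isInverse (isInverse_hinv (q.vv_iso _ _))
      (isInverse_hinv (q.vv_iso _ _)) ?_ ?_ (q.nat_v ω U).symm).symm
    · simp [h₂.left, (q.hv_bd _ _).bot, (q.hv_bd _ _).right]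
    · simp [h₁.right, (q.hv_bd _ _).top, (q.hv_bd _ _).left]

end Swap
end DoubleCat

/-! ### Quasi-functors as choices of structural transformations -/

namespace DoubleCat

section LeftRight
variable {B : DoubleCat.{u₁, u₂, u₃, u₄}} {b : Binoidal B}

/-- The transformation `K ⋉ - = (-,K)` of a quasi-functor. -/
def QuasiCells.leftH (q : QuasiCells b) (K : B.Hor) : LeftCentralH b K where
  app X := (b.rtimes X).hor K
  sq u := q.vh u K
  δ k := q.hh k K
  app_bd X := ⟨by simp, by simp⟩
  sq_bd u := q.vh_bd u K
  δ_bd k := q.hh_bd k K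
  δ_iso k := q.hh_iso k K
  δ_seq k k' w := q.seq_hh k k' K w
  δ_hid Y := q.hid_hh Y K
  sq_seq u u' w := q.seq_vh u u' K w
  sq_vid Y := q.vid_vh Y K
  nat ω := (q.nat_h ω K).symm
  app_eq _ := rfl

/-- The transformation `U ⋉ - = (-,U)` of a quasi-functor. -/
def QuasiCells.leftV (q : QuasiCells b) (U : B.Ver) : LeftCentralV b U where
  app X := (b.rtimes X).ver U
  sq k := q.hv k U
  δ u := q.vv u U
  app_bd X := ⟨by simp, by simp⟩
  sq_bd k := q.hv_bd k U
  δ_bd u := q.vv_bd u U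
  δ_iso u := q.vv_iso u U
  sq_seq k k' w := (q.seq_hv k k' U w).symm
  sq_hid Y := q.hid_hv Y U
  δ_seq u u' w := q.seq_vv u u' U w
  δ_vid Y := q.vid_vv Y U
  nat ω := q.nat_v ω U
  app_eq _ := rfl

/-- The two conditions on a modification, at 1h-cells and at 1v-cells, are the two naturality axioms
for `ζ`. The four equations between functors only express that the corners of `ζ` match. -/
theorem QuasiCells.leftCell (q : QuasiCells b) (ζ : B.Cell) :
    IsModification (q.leftH (B.top ζ)).toHTrans (q.leftH (B.bot ζ)).toHTrans
      (q.leftV (B.left ζ)).toVTrans (q.leftV (B.right ζ)).toVTrans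
      (fun X => (b.rtimes X).cell ζ) where
  eq_F := by rw [src_of_top]
  eq_G := by rw [tgt_of_top]
  eq_F' := by rw [src_of_bot]
  eq_G' := by rw [tgt_of_bot]
  bd X := (b.rtimes X).cell_bd ζ
  hor k := (q.h_nat k ζ).symm
  ver u := q.v_nat u ζ

/-- The structural transformations given by a quasi-functor. -/
noncomputable def QuasiCells.toLRCentral (q : QuasiCells b) : LRCentral b where
  lh := q.leftH
  -- Right centrality is left centrality for the exchanged families. The swap has already inverted
  -- `(k,K)` and `(u,U)`, as `(*)` demands.
  rh := q.swap.leftH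
  lv := q.leftV
  rv := q.swap.leftV
  lcell := q.leftCell
  rcell := q.swap.leftCell
  hh_inv _ _ := isInverse_vinv (q.hh_iso _ _)
  vv_inv _ _ := isInverse_hinv (q.vv_iso _ _)
  vh_eq _ _ := rfl
  hv_eq _ _ := rfl

/-- The quasi-functor given by structural transformations. -/
def LRCentral.toQuasiCells (c : LRCentral b) : QuasiCells b where
  -- All four kinds of 2-cells are taken from the left-hand transformations. The axioms in the
  -- variable of `k` and `u` then hold immediately; those for identities and composites in the
  -- variable of `K` and `U` are imported from the right-hand transformations through `(*)`.
  hh k K := (c.lh K).δ k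
  vh u K := (c.lh K).sq u
  hv k U := (c.lv U).sq k
  vv u U := (c.lv U).δ u
  hh_bd k K := by simpa [(c.lh K).app_eq] using (c.lh K).δ_bd k
  hh_iso k K := (c.lh K).δ_iso k
  vh_bd u K := by simpa [(c.lh K).app_eq] using (c.lh K).sq_bd u
  hv_bd k U := by simpa [(c.lv U).app_eq] using (c.lv U).sq_bd k
  vv_bd u U := by simpa [(c.lv U).app_eq] using (c.lv U).δ_bd u
  vv_iso u U := (c.lv U).δ_iso u
  hid_hh Y K := by simpa only [(c.lh K).app_eq] using (c.lh K).δ_hid Y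
  -- The unit law of `- ⋊ k` is about the inverse of the required 2-cell, so that inverse has to be
  -- moved across.
  hh_hid k X := by
    have h := (c.rh k).δ_hid X
    rw [(c.rh k).app_eq] at h
    exact over_eq_of_isInverse (c.hh_inv k _).symm (by simp [(c.rh k).app_eq]) h
  vid_vh Y K := by simpa only [(c.lh K).app_eq] using (c.lh K).sq_vid Y
  hv_vid k X := by simpa only [(c.rh k).app_eq, ← c.hv_eq, Families.swap_ltimes,
    Families.swap_rtimes] using (c.rh k).sq_vid X
  vh_hid u X := by simpa only [(c.rv u).app_eq, ← c.vh_eq, Families.swap_ltimes,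
    Families.swap_rtimes] using (c.rv u).sq_hid X
  hid_hv Y U := by simpa only [(c.lv U).app_eq] using (c.lv U).sq_hid Y
  vid_vv Y U := by simpa only [(c.lv U).app_eq] using (c.lv U).δ_vid Y
  -- `- ⋊ u` has an identity as its component at `B.vid X`; both the required 2-cell and that
  -- identity are inverse to it.
  vv_vid u X := by
    have h := (c.vv_inv u (B.vid X)).symm
    rw [(c.rv u).δ_vid, (c.rv u).app_eq] at h
    exact h.unique (isInverse_idV _)
  seq_hh k k' K w := by simpa only [(c.lh K).app_eq] using (c.lh K).δ_seq k k' w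
  hh_seq k K K' w := by
    have h := (c.rh k).δ_seq K K' w
    simp only [(c.rh k).app_eq] at h
    -- Of each inverse pair, one 2-cell belongs to `- ⋊ k` and the other to `K ⋉ -` or `K' ⋉ -`.
    -- Their boundaries are therefore known from different transformations and agree only after
    -- `app_eq` and `obj_eq`.
    refine over_eq_over₂_of_isInverse (c.hh_inv k _).symm
      (isInverse_idH_beside (c.hh_inv k _).symm ((c.rh k).left_δ _)
        (((c.lh K').left_δ k).trans (by simp)) (by simp [w]))
      (isInverse_beside_idH (c.hh_inv k _).symm ((c.rh k).right_δ _)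
        (((c.lh K).right_δ k).trans (by simp)) (by simp [w]))
      ?_ ?_ ?_ h
    · simp [(c.rh k).app_eq, w]
    · simp [(c.rh k).app_eq, w]
    · simp [(c.rh k).app_eq, w]
  seq_vh u u' K w := (c.lh K).sq_seq u u' w
  hv_seq k U U' w := by simpa only [← c.hv_eq] using (c.rh k).sq_seq U U' w
  vh_seq u K K' w := by simpa only [← c.vh_eq, Families.swap_ltimes] using
    ((c.rv u).sq_seq K K' w).symm
  seq_hv k k' U w := ((c.lv U).sq_seq k k' w).symm
  seq_vv u u' U w := (c.lv U).δ_seq u u' w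
  vv_seq u U U' w := by
    have h := (c.vv_inv u (U ≫ᵥ U')).symm
    rw [(c.rv u).δ_seq U U' w] at h
    refine h.unique (ArrCat.IsInverse.cmp
      (isInverse_over_idV (c.vv_inv u _).symm ((c.rv u).bot_δ _)
        (((c.lv U).bot_δ u).trans (by simp)) (by simp [w]))
      (isInverse_idV_over (c.vv_inv u _).symm ((c.rv u).top_δ _)
        (((c.lv U').top_δ u).trans (by simp)) (by simp [w])) ?_)
    change B.right _ = B.left _
    simp [(c.rv u).app_eq, w]
  nat_h ω K := ((c.lh K).nat ω).symm
  -- Naturality in the frozen variable is the modification condition for `ζ ⋉ -`.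
  h_nat k ζ := ((c.lcell ζ).hor k).symm
  nat_v ω U := (c.lv U).nat ω
  v_nat u ζ := (c.lcell ζ).ver u

/-- The 1h-cell components are prescribed by `app_eq`, so only the 2-cell components can differ. -/
theorem LeftCentralH.ext' {f : B.Hor} {α β : LeftCentralH b f} (h₁ : α.sq = β.sq)
    (h₂ : α.δ = β.δ) : α = β :=
  eq_of_heq (Sigma.mk.inj (CenterH.ext (f := ⟨f, α⟩) (g := ⟨f, β⟩) rfl h₁ h₂)).2

theorem LeftCentralV.ext' {x : B.Ver} {α β : LeftCentralV b x} (h₁ : α.sq = β.sq)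
    (h₂ : α.δ = β.δ) : α = β :=
  eq_of_heq (Sigma.mk.inj (CenterV.ext (f := ⟨x, α⟩) (g := ⟨x, β⟩) rfl h₁ h₂)).2

/-- Centrality of 2-cells and the identities `(*)` are properties, not further data. -/
theorem LRCentral.ext' {c d : LRCentral b} (h₁ : c.lh = d.lh) (h₂ : c.rh = d.rh)
    (h₃ : c.lv = d.lv) (h₄ : c.rv = d.rv) : c = d := by
  cases c; cases d; cases h₁; cases h₂; cases h₃; cases h₄; rfl

/-- Quasi-functors correspond to choices of structural transformations. -/
noncomputable def quasiCellsEquiv (b : Binoidal B) : QuasiCells b ≃ LRCentral b where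
  toFun := QuasiCells.toLRCentral
  invFun := LRCentral.toQuasiCells
  left_inv _ := rfl
  right_inv c := by
    refine LRCentral.ext' ?_ ?_ ?_ ?_
    · funext K; exact LeftCentralH.ext' rfl rfl
    -- The right-hand transformations are determined by the left-hand ones: `(*)` gives the
    -- components at 1v-cells directly and those at 1h-cells as the unique inverses. The argument
    -- for `- ⋊ u` is dual.
    · funext k
      exact LeftCentralH.ext' (funext fun U => c.hv_eq k U)
        (funext fun K => (c.hh_inv k K).eq_inv.symm)
    · funext U; exact LeftCentralV.ext' rfl rfl
    · funext u
      exact LeftCentralV.ext' (funext fun K => c.vh_eq u K)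
        (funext fun U => (c.vv_inv u U).eq_inv.symm)

theorem quasiCellsEquiv_corresponds (q : QuasiCells b) :
    q.Corresponds (quasiCellsEquiv b q) where
  lh_δ _ _ := rfl
  -- The lax component is the chosen inverse of the chosen inverse of `(k,K)`, which is `(k,K)` by
  -- uniqueness and not by definition.
  rh_lax k K := ((isInverse_vinv (q.hh_iso k K)).symm.eq_inv).symm
  lh_sq _ _ := rfl
  rv_sq _ _ := rfl
  lv_sq _ _ := rfl
  rh_sq _ _ := rfl
  lv_δ _ _ := rfl
  rv_oplax u U := ((isInverse_hinv (q.vv_iso u U)).symm.eq_inv).symm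

end LeftRight
end DoubleCat

/-! ### Quasi-functors as double functors to the centers -/

namespace DoubleCat

/-- Composition in the center is given by conjugation, whereas the axioms of a quasi-functor have
one compositor or unitor on each side; this passes from the second form to the first. -/
theorem eq_over_of_isInverse {D : DoubleCat.{u₁, u₂, u₃, u₄}} {p p' x y : D.Cell}
    (h : D.cv.IsInverse p p') (w : D.bot p = D.top x) (e : p ⊟ x = y) : x = p' ⊟ y := by
  have l : p' ⊟ (p ⊟ x) = x := by
    rw [← over_assoc _ h.src_eq]
    exact (congrArg (· ⊟ x) h.cmp_inv_hom).trans (idH_over (w.symm.trans h.tgt_eq))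
  rw [← e, l]

theorem DoubleFunctor.ext' {C : DoubleCat.{u₁, u₂, u₃, u₄}} {D : DoubleCat.{w₁, w₂, w₃, w₄}}
    {F G : DoubleFunctor C D} (h₁ : F.obj = G.obj) (h₂ : F.hor = G.hor) (h₃ : F.ver = G.ver)
    (h₄ : F.cell = G.cell) : F = G := by
  cases F; cases G; cases h₁; cases h₂; cases h₃; cases h₄; rfl

section Pure
variable {B : DoubleCat.{u₁, u₂, u₃, u₄}} {b : Binoidal B}

/-- The equality holds componentwise: at 1v-cells it is `vh_seq` and at 1h-cells it is `hh_seq`,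
each with the left-hand compositor of `- ⋊ X` inverted and moved to the right. -/
theorem QuasiCells.centerH_seq (q : QuasiCells b) (f g : B.Hor) (w : B.h.tgt f = B.h.src g) :
    (⟨f ≫ₕ g, q.leftH (f ≫ₕ g)⟩ : CenterH b) =
      CenterH.comp ⟨f, q.leftH f⟩ ⟨g, q.leftH g⟩ w := by
  refine CenterH.ext rfl (funext fun u => ?_) (funext fun k => ?_)
  · change q.vh u (f ≫ₕ g) = vinv ((b.rtimes _).cmpr f g w) ⊟ (q.vh u f ⫿ q.vh u g) ⊟
      (b.rtimes _).cmpr f g w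
    have i := (b.rtimes (B.v.src u)).cmpr_iso f g w
    have h₁ := q.vh_bd u f
    have h₂ := q.vh_bd u g
    rw [over_assoc _ (by simp [bot_vinv, i, h₁.right, h₂.left, h₁.top, h₂.top, w])]
    exact eq_over_of_isInverse (isInverse_vinv i) (by simp [(q.vh_bd u _).top])
      (q.vh_seq u f g w)
  -- Conjugation unfolded: the inverse compositor sits at the target of `k`, the compositor at its
  -- source.
  · change q.hh k (f ≫ₕ g) = (B.idH _ ⫿ vinv ((b.rtimes _).cmpr f g w)) ⊟
      ((q.hh k f ⫿ B.idH _) ⊟ (B.idH _ ⫿ q.hh k g)) ⊟ ((b.rtimes _).cmpr f g w ⫿ B.idH _)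
    have i := (b.rtimes (B.h.tgt k)).cmpr_iso f g w
    have h₁ := q.hh_bd k f
    have h₂ := q.hh_bd k g
    have h₃ := ((b.rtimes (B.h.tgt k)).cmpr_bd f g w).vinv i
    rw [over_assoc _ (by
      simp [h₁.right, h₁.top, h₃.left, h₃.bot, (q.leftH g).app_eq, w])]
    exact eq_over_of_isInverse
      (isInverse_idH_beside (isInverse_vinv i) (by simp) h₃.left (by simp))
      (by simp [(q.hh_bd k _).top]) (q.hh_seq k f g w)

/-- As for composites, with unitors in place of compositors and the axioms `vh_hid` and `hh_hid`. -/
theorem QuasiCells.centerH_id (q : QuasiCells b) (A : B.Obj) :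
    (⟨B.hid A, q.leftH (B.hid A)⟩ : CenterH b) = CenterH.id b A := by
  refine CenterH.ext rfl (funext fun u => ?_) (funext fun k => ?_)
  · change q.vh u (B.hid A) = vinv ((b.rtimes _).unit A) ⊟ B.idV ((b.ltimes A).ver u) ⊟
      (b.rtimes _).unit A
    have i := (b.rtimes (B.v.src u)).unit_iso A
    rw [over_assoc _ (by simp [bot_vinv, i])]
    exact eq_over_of_isInverse (isInverse_vinv i) (by simp [(q.vh_bd u _).top]) (q.vh_hid u A)
  · change q.hh k (B.hid A) = (B.idH _ ⫿ vinv ((b.rtimes _).unit A)) ⊟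
      B.idH ((b.ltimes A).hor k) ⊟ ((b.rtimes _).unit A ⫿ B.idH _)
    have i := (b.rtimes (B.h.tgt k)).unit_iso A
    have h₃ := ((b.rtimes (B.h.tgt k)).unit_bd A).vinv i
    rw [over_idH]
    exact eq_over_of_isInverse
      (isInverse_idH_beside (isInverse_vinv i) (by simp) h₃.left (by simp))
      (by simp [(q.hh_bd k _).top]) (q.hh_hid k A)

/-- The functors are strict in the vertical direction, so no conjugation intervenes and the axioms
apply verbatim. -/
theorem QuasiCells.centerV_seq (q : QuasiCells b) (x y : B.Ver) (w : B.v.tgt x = B.v.src y) :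
    (⟨x ≫ᵥ y, q.leftV (x ≫ᵥ y)⟩ : CenterV b) =
      CenterV.comp ⟨x, q.leftV x⟩ ⟨y, q.leftV y⟩ w :=
  CenterV.ext rfl (funext fun k => q.hv_seq k x y w) (funext fun u => q.vv_seq u x y w)

theorem QuasiCells.centerV_id (q : QuasiCells b) (A : B.Obj) :
    (⟨B.vid A, q.leftV (B.vid A)⟩ : CenterV b) = CenterV.id b A :=
  CenterV.ext rfl (funext fun k => q.hv_vid k A) (funext fun u => q.vv_vid u A)

/-- A 2-cell with its modification, as a 2-cell of the left center. -/
def QuasiCells.centerCell (q : QuasiCells b) (ζ : B.Cell) : CenterCell b :=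
  ⟨⟨_, q.leftH (B.top ζ)⟩, ⟨_, q.leftH (B.bot ζ)⟩, ⟨_, q.leftV (B.left ζ)⟩,
    ⟨_, q.leftV (B.right ζ)⟩, ζ, Bd.self ζ, q.leftCell ζ⟩

/-- The double functor `b ↦ (b, b ⋉ -)` to the left center given by a quasi-functor. -/
noncomputable def QuasiCells.toLeftCenter (q : QuasiCells b) :
    DoubleFunctor B (leftCenter b) where
  obj A := A
  hor K := ⟨K, q.leftH K⟩
  ver U := ⟨U, q.leftV U⟩
  cell := q.centerCell
  hor_bd _ := ⟨rfl, rfl⟩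
  ver_bd _ := ⟨rfl, rfl⟩
  cell_bd _ := ⟨rfl, rfl, rfl, rfl⟩
  -- `≫ₕ` is the totalized composition; on composable pairs `cmp_eq` identifies it with the
  -- composition of the center.
  hor_seq f g w := (q.centerH_seq f g w).trans ((leftCenter b).h.cmp_eq (f := ⟨f, q.leftH f⟩)
    (g := ⟨g, q.leftH g⟩) w).symm
  hor_id A := q.centerH_id A
  ver_seq x y w := (q.centerV_seq x y w).trans ((leftCenter b).v.cmp_eq (f := ⟨x, q.leftV x⟩)
    (g := ⟨y, q.leftV y⟩) w).symm
  ver_id A := q.centerV_id A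
  cell_over x y w := by
    have w' : (⟨_, q.leftH (B.bot x)⟩ : CenterH b) = ⟨_, q.leftH (B.top y)⟩ := by rw [w]
    refine Eq.trans ?_ ((leftCenter b).cv.cmp_eq (f := q.centerCell x)
      (g := q.centerCell y) w').symm
    -- The underlying 2-cells agree definitionally and being a modification is a property, so only
    -- the four boundaries are left. Two are immediate, and the other two are functoriality on
    -- 1v-cells.
    refine CenterCell.ext' ?_ ?_ ?_ ?_ rfl
    -- Displaying the dependent pair lets the rewrite replace the 1h-cell together with the
    -- transformation that depends on it.
    · change (⟨_, q.leftH _⟩ : CenterH b) = ⟨_, q.leftH _⟩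
      rw [top_over]
    · change (⟨_, q.leftH _⟩ : CenterH b) = ⟨_, q.leftH _⟩
      rw [bot_over w]
    · refine Eq.trans ?_ (q.centerV_seq _ _ (by rw [← src_of_bot, ← src_of_top, w]))
      change (⟨_, q.leftV _⟩ : CenterV b) = _
      rw [left_over w]
    · refine Eq.trans ?_ (q.centerV_seq _ _ (by rw [← tgt_of_bot, ← tgt_of_top, w]))
      change (⟨_, q.leftV _⟩ : CenterV b) = _
      rw [right_over w]
  cell_beside x y w := by
    have w' : (⟨_, q.leftV (B.right x)⟩ : CenterV b) = ⟨_, q.leftV (B.left y)⟩ := by rw [w]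
    refine Eq.trans ?_ ((leftCenter b).ch.cmp_eq (f := q.centerCell x)
      (g := q.centerCell y) w').symm
    refine CenterCell.ext' ?_ ?_ ?_ ?_ rfl
    · refine Eq.trans ?_ (q.centerH_seq _ _ (by rw [tgt_of_top, src_of_top, w]))
      change (⟨_, q.leftH _⟩ : CenterH b) = _
      rw [top_beside w]
    · refine Eq.trans ?_ (q.centerH_seq _ _ (by rw [tgt_of_bot, src_of_bot, w]))
      change (⟨_, q.leftH _⟩ : CenterH b) = _
      rw [bot_beside w]
    · change (⟨_, q.leftV _⟩ : CenterV b) = ⟨_, q.leftV _⟩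
      rw [left_beside]
    · change (⟨_, q.leftV _⟩ : CenterV b) = ⟨_, q.leftV _⟩
      rw [right_beside w]
  cell_idH f := by
    refine CenterCell.ext' ?_ ?_ ?_ ?_ rfl
    · change (⟨_, q.leftH _⟩ : CenterH b) = ⟨_, q.leftH _⟩
      rw [top_idH]
    · change (⟨_, q.leftH _⟩ : CenterH b) = ⟨_, q.leftH _⟩
      rw [bot_idH]
    · refine Eq.trans ?_ (q.centerV_id _)
      change (⟨_, q.leftV _⟩ : CenterV b) = _
      rw [left_idH]
    · refine Eq.trans ?_ (q.centerV_id _)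
      change (⟨_, q.leftV _⟩ : CenterV b) = _
      rw [right_idH]
  cell_idV x := by
    refine CenterCell.ext' ?_ ?_ ?_ ?_ rfl
    · refine Eq.trans ?_ (q.centerH_id _)
      change (⟨_, q.leftH _⟩ : CenterH b) = _
      rw [top_idV]
    · refine Eq.trans ?_ (q.centerH_id _)
      change (⟨_, q.leftH _⟩ : CenterH b) = _
      rw [bot_idV]
    · change (⟨_, q.leftV _⟩ : CenterV b) = ⟨_, q.leftV _⟩
      rw [left_idV]
    · change (⟨_, q.leftV _⟩ : CenterV b) = ⟨_, q.leftV _⟩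
      rw [right_idV]

/-- The purely central structure given by a quasi-functor. -/
noncomputable def QuasiCells.toPureStr (q : QuasiCells b) : PureStr b where
  Zl := q.toLeftCenter
  Zr := q.swap.toLeftCenter
  Zl_proj := rfl
  Zr_proj := rfl
  hh_inv _ _ := isInverse_vinv (q.hh_iso _ _)
  vv_inv _ _ := isInverse_hinv (q.vv_iso _ _)
  vh_eq _ _ := rfl
  hv_eq _ _ := rfl

/-! ### Sections of the projection from a center -/

section Section
variable {Z Z' : DoubleFunctor B (leftCenter b)}

/-- The section condition gives only a propositional equality of underlying 1h-cells, while the type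
of the transformation depends on the 1h-cell. The transformation has to be transported once, and
this lemma does so. -/
theorem exists_hor_eq (h : Z.comp (leftCenterProj b) = .id B)
    (K : B.Hor) : ∃ α : LeftCentralH b K, Z.hor K = ⟨K, α⟩ := by
  have e : (Z.hor K).1 = K := congrArg (fun F => F.hor K) h
  -- For an arbitrary pair the equation can be eliminated by substitution; for the first component
  -- of `Z.hor K` it cannot.
  have : ∀ f : CenterH b, f.1 = K → ∃ α : LeftCentralH b K, f = ⟨K, α⟩ := by
    rintro ⟨_, α⟩ rfl; exact ⟨α, rfl⟩
  exact this _ e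

theorem exists_ver_eq (h : Z.comp (leftCenterProj b) = .id B)
    (U : B.Ver) : ∃ α : LeftCentralV b U, Z.ver U = ⟨U, α⟩ := by
  have e : (Z.ver U).1 = U := congrArg (fun F => F.ver U) h
  have : ∀ f : CenterV b, f.1 = U → ∃ α : LeftCentralV b U, f = ⟨U, α⟩ := by
    rintro ⟨_, α⟩ rfl; exact ⟨α, rfl⟩
  exact this _ e

/-- The transformation `K ⋉ -` given by a section of the projection from the left center. -/
noncomputable def sectionH (h : Z.comp (leftCenterProj b) = .id B)
    (K : B.Hor) : LeftCentralH b K := (exists_hor_eq h K).choose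

/-- The transformation `U ⋉ -` given by a section of the projection from the left center. -/
noncomputable def sectionV (h : Z.comp (leftCenterProj b) = .id B)
    (U : B.Ver) : LeftCentralV b U := (exists_ver_eq h U).choose

theorem hor_eq_section (h : Z.comp (leftCenterProj b) = .id B)
    (K : B.Hor) : Z.hor K = ⟨K, sectionH h K⟩ := (exists_hor_eq h K).choose_spec

theorem ver_eq_section (h : Z.comp (leftCenterProj b) = .id B)
    (U : B.Ver) : Z.ver U = ⟨U, sectionV h U⟩ := (exists_ver_eq h U).choose_spec

/-- The choice in `sectionH` is harmless: the second component of a dependent pair with fixed first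
component is unique. -/
theorem sectionH_eq (h : Z.comp (leftCenterProj b) = .id B)
    {K : B.Hor} {α : LeftCentralH b K} (e : Z.hor K = ⟨K, α⟩) :
    sectionH h K = α :=
  eq_of_heq (Sigma.mk.inj ((hor_eq_section h K).symm.trans e)).2

theorem sectionV_eq (h : Z.comp (leftCenterProj b) = .id B)
    {U : B.Ver} {α : LeftCentralV b U} (e : Z.ver U = ⟨U, α⟩) :
    sectionV h U = α :=
  eq_of_heq (Sigma.mk.inj ((ver_eq_section h U).symm.trans e)).2

theorem cell_section (h : Z.comp (leftCenterProj b) = .id B)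
    (ζ : B.Cell) : (Z.cell ζ).cell = ζ := congrArg (fun F => F.cell ζ) h

/-- The image of `ζ` in the center carries a modification, and preservation of boundaries identifies
its structural transformations with the chosen ones. -/
theorem isModification_section (h : Z.comp (leftCenterProj b) = .id B)
    (ζ : B.Cell) :
    IsModification (sectionH h (B.top ζ)).toHTrans (sectionH h (B.bot ζ)).toHTrans
      (sectionV h (B.left ζ)).toVTrans (sectionV h (B.right ζ)).toVTrans
      (fun X => (b.rtimes X).cell ζ) := by
  have d := Z.cell_bd ζ
  have m := (Z.cell ζ).isMod
  rw [cell_section h] at m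
  rw [show (Z.cell ζ).top = _ from d.top.trans (hor_eq_section h _),
    show (Z.cell ζ).bot = _ from d.bot.trans (hor_eq_section h _),
    show (Z.cell ζ).left = _ from d.left.trans (ver_eq_section h _),
    show (Z.cell ζ).right = _ from d.right.trans (ver_eq_section h _)] at m
  exact m

/-- Objects and underlying 2-cells are fixed by the section condition. The image of a 2-cell is
determined by its underlying 2-cell and its boundary, and the boundary is determined by the values
on 1-cells. -/
theorem section_ext (h : Z.comp (leftCenterProj b) = .id B)
    (h' : Z'.comp (leftCenterProj b) = .id B) (e : ∀ K, Z.hor K = Z'.hor K)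
    (e' : ∀ U, Z.ver U = Z'.ver U) : Z = Z' := by
  refine DoubleFunctor.ext' (funext fun A => ?_) (funext e) (funext e') (funext fun ζ => ?_)
  · exact (congrArg (fun F => F.obj A) h).trans (congrArg (fun F => F.obj A) h').symm
  · have d := Z.cell_bd ζ
    have d' := Z'.cell_bd ζ
    exact CenterCell.ext' (d.top.trans ((e _).trans d'.top.symm))
      (d.bot.trans ((e _).trans d'.bot.symm)) (d.left.trans ((e' _).trans d'.left.symm))
      (d.right.trans ((e' _).trans d'.right.symm))
      ((cell_section h ζ).trans (cell_section h' ζ).symm)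

end Section

/-! ### Purely central structures as choices of structural transformations -/

/-- The structural transformations given by a purely central structure. -/
noncomputable def PureStr.toLRCentral (z : PureStr b) : LRCentral b where
  lh := sectionH z.Zl_proj
  rh := sectionH z.Zr_proj
  lv := sectionV z.Zl_proj
  rv := sectionV z.Zr_proj
  lcell := isModification_section z.Zl_proj
  rcell := isModification_section z.Zr_proj
  hh_inv k K := by
    have h := z.hh_inv k K
    rwa [hor_eq_section z.Zl_proj, hor_eq_section z.Zr_proj] at h
  vv_inv u U := by
    have h := z.vv_inv u U
    rwa [ver_eq_section z.Zl_proj, ver_eq_section z.Zr_proj] at h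
  vh_eq u K := by
    have h := z.vh_eq u K
    rwa [hor_eq_section z.Zl_proj, ver_eq_section z.Zr_proj] at h
  hv_eq k U := by
    have h := z.hv_eq k U
    rwa [ver_eq_section z.Zl_proj, hor_eq_section z.Zr_proj] at h

/-- The purely central structure given by structural transformations. -/
noncomputable def LRCentral.toPureStr (c : LRCentral b) : PureStr b :=
  ((quasiCellsEquiv b).symm c).toPureStr

theorem LRCentral.toPureStr_corresponds (c : LRCentral b) : c.Corresponds c.toPureStr := by
  -- When the choice is written as coming from a quasi-functor, the double functors are built from
  -- the very same transformations and all six conditions are definitional.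
  obtain ⟨q, rfl⟩ := (quasiCellsEquiv b).surjective c
  rw [LRCentral.toPureStr, Equiv.symm_apply_apply]
  exact ⟨fun _ => rfl, fun _ => rfl, fun _ => rfl, fun _ => rfl, fun _ => rfl, fun _ => rfl⟩

/-- Choices of structural transformations correspond to purely central structures. -/
noncomputable def lrCentralEquiv (b : Binoidal B) : LRCentral b ≃ PureStr b where
  toFun := LRCentral.toPureStr
  invFun := PureStr.toLRCentral
  left_inv c := by
    have h := c.toPureStr_corresponds
    exact LRCentral.ext' (funext fun K => sectionH_eq c.toPureStr.Zl_proj (h.lh K))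
      (funext fun k => sectionH_eq c.toPureStr.Zr_proj (h.rh k))
      (funext fun U => sectionV_eq c.toPureStr.Zl_proj (h.lv U))
      (funext fun u => sectionV_eq c.toPureStr.Zr_proj (h.rv u))
  right_inv z := by
    have h := z.toLRCentral.toPureStr_corresponds
    -- The rebuilt and the given double functor are sections with the same values on 1-cells, hence
    -- equal.
    have hl := section_ext z.toLRCentral.toPureStr.Zl_proj z.Zl_proj
      (fun K => (h.lh K).trans (hor_eq_section z.Zl_proj K).symm)
      (fun U => (h.lv U).trans (ver_eq_section z.Zl_proj U).symm)
    have hr := section_ext z.toLRCentral.toPureStr.Zr_proj z.Zr_proj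
      (fun K => (h.rh K).trans (hor_eq_section z.Zr_proj K).symm)
      (fun U => (h.rv U).trans (ver_eq_section z.Zr_proj U).symm)
    -- The rebuilt structure depends on `z`; as an independent variable it can be decomposed and its
    -- double functors substituted. The other fields are propositions.
    generalize z.toLRCentral.toPureStr = z' at hl hr
    cases z; cases z'; cases hl; cases hr; rfl

theorem tfae_binoidal (b : Binoidal B) :
    List.TFAE [∃ H : QuasiFunctor B B B, H.families = b, Nonempty (LRCentral b),
      PurelyCentral b] := by
  tfae_have 1 → 2 := by
    rintro ⟨H, rfl⟩; exact ⟨quasiCellsEquiv _ H.cells⟩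
  tfae_have 2 → 1 := fun ⟨c⟩ => ⟨⟨b, (quasiCellsEquiv b).symm c⟩, rfl⟩
  tfae_have 2 ↔ 3 := (lrCentralEquiv b).nonempty_congr
  tfae_finish

end Pure
end DoubleCat

/-! ### The main theorem -/

theorem mainTheorem4 (B : DoubleCat.{u₁, u₂, u₃, u₄}) :
    List.TFAE
      [Nonempty (DoubleCat.QuasiFunctor B B B),
        ∃ b : DoubleCat.Binoidal B, Nonempty (DoubleCat.LRCentral b),
        ∃ b : DoubleCat.Binoidal B, DoubleCat.PurelyCentral b] ∧
    ∀ b : DoubleCat.Binoidal B,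
      List.TFAE
        [∃ H : DoubleCat.QuasiFunctor B B B, H.families = b,
          Nonempty (DoubleCat.LRCentral b),
          DoubleCat.PurelyCentral b] ∧
      (∃ e : DoubleCat.QuasiCells b ≃ DoubleCat.LRCentral b,
        ∀ q : DoubleCat.QuasiCells b, q.Corresponds (e q)) ∧
      (∃ e : DoubleCat.LRCentral b ≃ DoubleCat.PureStr b,
        ∀ c : DoubleCat.LRCentral b, c.Corresponds (e c)) ∧
      ∀ c : DoubleCat.LRCentral b,
        (∀ k K, (c.lh K).δ k = (c.rh k).lax K ∧ (c.lh K).lax k = (c.rh k).δ K) ∧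
        (∀ u U, (c.lv U).δ u = (c.rv u).oplax U ∧ (c.lv U).oplax u = (c.rv u).δ U) := by
  refine ⟨?_, fun b => ⟨DoubleCat.tfae_binoidal b,
    ⟨DoubleCat.quasiCellsEquiv b, DoubleCat.quasiCellsEquiv_corresponds⟩,
    ⟨DoubleCat.lrCentralEquiv b, DoubleCat.LRCentral.toPureStr_corresponds⟩, fun c =>
    -- The exchange of lax and oplax components is `(*)` read in both directions, with uniqueness of
    -- inverses.
    ⟨fun k K => ⟨(c.hh_inv k K).symm.eq_inv, (c.hh_inv k K).eq_inv.symm⟩,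
      fun u U => ⟨(c.vv_inv u U).symm.eq_inv, (c.vv_inv u U).eq_inv.symm⟩⟩⟩⟩
  -- The binoidal structure is the pair of families underlying the quasi-functor, so the global
  -- equivalence is the one for fixed families with the families quantified existentially.
  tfae_have 1 → 2 := fun ⟨H⟩ => ⟨H.families, ⟨DoubleCat.quasiCellsEquiv _ H.cells⟩⟩
  tfae_have 2 → 1 := fun ⟨b, ⟨c⟩⟩ => ⟨⟨b, (DoubleCat.quasiCellsEquiv b).symm c⟩⟩
  tfae_have 2 ↔ 3 := exists_congr fun b => (DoubleCat.lrCentralEquiv b).nonempty_congr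
  tfae_finish
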